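/- Let $p$ be a prime and let $A$ be a complete (Hausdorff) Tate $\mathbb{Z}_p$-algebra: a commutative complete topological ring with continuous structure map $\mathbb{Z}_p \to A$ which has an open subring $A_0$ whose topology is $(\varpi)$-adic for some $\varpi \in A_0$ that is a topologically nilpotent unit of $A$. Let $\alpha \in A^\times$ be topologically nilpotent. Manifolds are Hausdorff, paracompact and of pure (finite) dimension. *Functions and distributions on $\mathbb{Z}_p^k$.* Let $I_\Delta$ be the augmentation ideal of $\mathbb{Z}_p[[\mathbb{Z}_p^k]] = \varprojlim_n \mathbb{Z}_p[\mathbb{Z}_p^k/p^n]$, i.e. the ideal generated by the elements $[z]-[0]$; this ring acts on the space $\mathcal{C}(\mathbb{Z}_p^k,A)$ of continuous functions by extending translation $([z]f)(y)=f(y+z)$. For real $r>0$ let $\mathcal{A}^{(\alpha,r)}(\mathbb{Z}_p^k,A)$ be the set of $f \in \mathcal{C}(\mathbb{Z}_p^k,A)$ such that for every open neighborhood $U$ of $0$ in $A$ there is $N$ such that $\alpha^{\lfloor -rn \rfloor}\delta f$ takes values in $U$ for all $n>N$ and all $\delta \in I_\Delta^n$. Its topology has as a basis of neighborhoods of $0$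 the sets $U_r$ of all $f$ such that $\alpha^{\lfloor -rn\rfloor}\delta f$ takes values in $U$ for all $n \ge 0$ and all $\delta\in I_\Delta^n$. Let $\mathcal{A}(\mathbb{Z}_p^k,A)=\varinjlim_r \mathcal{A}^{(\alpha,r)}(\mathbb{Z}_p^k,A)=\bigcup_r \mathcal{A}^{(\alpha,r)}(\mathbb{Z}_p^k,A)$. For a topological $A$-module $M$ let $\mathcal{L}_b(M,A)$ be the module of continuous $A$-linear maps $M \to A$ with the topology of uniform convergence on bounded sets, where $B\subseteq M$ is bounded if for each neighborhood $U$ of $0$ there is $a\in A^\times$ with $aB\subseteq U$. Let $\mathcal{D}^{(\alpha,r)}(\mathbb{Z}_p^k,A)$ be the closure of the image of $\mathcal{L}_b(\mathcal{C}(\mathbb{Z}_p^k,A),A)$ (uniform convergence topology on $\mathcal{C}$) in $\mathcal{L}_b(\mathcal{A}^{(\alpha,r)}(\mathbb{Z}_p^k,A),A)$, and $\mathcal{D}(\mathbb{Z}_p^k,A)=\varprojlim_r \mathcal{D}^{(\alpha,r)}(\mathbb{Z}_p^k,A)$. *Gluing.* For a locally $\mathbb{Q}_p$-analytic manifold $X$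 of dimension $k$ choose a decomposition $X=\bigsqcup_{i\in I}X_i$ into open subsets with locally analytic isomorphisms $X_i\cong\mathbb{Z}_p^k$, and put $\mathcal{A}(X,A)=\prod_i\mathcal{A}(X_i,A)$ (a set of functions $X\to A$), $\mathcal{A}_c(X,A)=\bigoplus_i\mathcal{A}(X_i,A)$, $\mathcal{D}(X,A)=\bigoplus_i\mathcal{D}(X_i,A)$, $\mathcal{D}_c(X,A)=\prod_i\mathcal{D}(X_i,A)$. Elements of $\mathcal{D}(X,A)$ (resp. $\mathcal{D}_c(X,A)$) are evaluated on $\mathcal{A}(X,A)$ (resp. $\mathcal{A}_c(X,A)$) by $\varphi(f)=\sum_i\varphi_i(f|_{X_i})$. **Theorem.** Such decompositions exist for $X$ and for all its open subsets, and the four modules do not depend on the decomposition or on $\alpha$ (for $\mathcal{D}$ and $\mathcal{D}_c$: up to a unique $A$-linear isomorphism compatible with evaluation). They have the following properties. 1. $\mathcal{A}(X,A)$ is a ring under pointwise operations (an $A$-subalgebra of the algebra of all functions $X\to A$). 2. If $g\colon X\to Y$ is a locally analytic map of locally $\mathbb{Q}_p$-analytic manifolds, then $f\mapsto f\circ g$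 is a homomorphism $\mathcal{A}(Y,A)\to\mathcal{A}(X,A)$, and there is a unique $A$-linear homomorphism $g_*\colon\mathcal{D}(X,A)\to\mathcal{D}(Y,A)$ with $(g_*\varphi)(f)=\varphi(f\circ g)$ for all $\varphi\in\mathcal{D}(X,A)$ and $f\in\mathcal{A}(Y,A)$. 3. $U\mapsto\mathcal{A}(U,A)$, with restriction of functions, and $U\mapsto\mathcal{D}_c(U,A)$, with restriction maps dual to extension by zero $\mathcal{A}_c(V,A)\to\mathcal{A}_c(U,A)$ for $V\subseteq U$, are sheaves of $A$-modules on $X$. 4. If $X$ has the structure of a finitely generated $\mathbb{Z}_p$-module whose addition $X\times X\to X$ and scalar multiplication $\mathbb{Z}_p\times X\to X$ are locally analytic, then every continuous group homomorphism $X\to A^\times$ is in $\mathcal{A}(X,A)$. -/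

import Mathlib

open scoped Manifold ContDiff Topology

universe u v w

noncomputable section

namespace LocAn

/-! ### Tate rings -/

/-- `A₀` is a ring of definition of the topological ring `A`, with ideal of definition `I`:
`A₀` is an open subring, `I` is finitely generated and `A₀` carries the `I`-adic topology. -/
structure IsPairOfDefinition {A : Type*} [CommRing A] [TopologicalSpace A]
    (A₀ : Subring A) (I : Ideal A₀) : Prop where
  isOpen : IsOpen (A₀ : Set A)
  fg : I.FG
  isAdic : IsAdic I

/-- A Tate ring: a Huber ring some ring of definition of which has an ideal of definition that is
generated by a topologically nilpotent unit of `A`. -/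
class IsTateRing (A : Type*) [CommRing A] [TopologicalSpace A] : Prop
    extends IsTopologicalRing A where
  exists_pair : ∃ (A₀ : Subring A) (I : Ideal A₀), IsPairOfDefinition A₀ I ∧
    ∃ ϖ : A₀, IsTopologicallyNilpotent (ϖ : A) ∧ IsUnit (ϖ : A) ∧ I = Ideal.span {ϖ}

theorem IsTateRing.nonarchimedean (A : Type*) [CommRing A] [TopologicalSpace A] [IsTateRing A] :
    NonarchimedeanRing A where
  is_nonarchimedean := by
    intro U hU
    obtain ⟨A₀, I, hI, -⟩ := IsTateRing.exists_pair (A := A)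
    have hU' : ((↑) : A₀ → A) ⁻¹' U ∈ 𝓝 (0 : A₀) :=
      continuous_subtype_val.continuousAt.preimage_mem_nhds (by simpa using hU)
    obtain ⟨n, -, hn⟩ := hI.isAdic.hasBasis_nhds_zero.mem_iff.1 hU'
    have hopen : IsOpen ((I ^ n : Ideal A₀) : Set A₀) := (isAdic_iff.1 hI.isAdic).1 n
    refine ⟨⟨((I ^ n : Ideal A₀).toAddSubgroup).map A₀.subtype.toAddMonoidHom, ?_⟩, ?_⟩
    · exact hI.isOpen.isOpenMap_subtype_val _ hopen
    · rintro _ ⟨x, hx, rfl⟩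
      exact hn hx

/-! ### The completed group ring `ℤ_p⟦ℤ_p^k⟧` and its action on continuous functions -/

section GroupRing

variable (p : ℕ) [hp : Fact p.Prime] (k : ℕ)

/-- The projection `(ℤ/p^n)^k → (ℤ/p^m)^k` for `m ≤ n`. -/
def transition {m n : ℕ} (h : m ≤ n) : (Fin k → ZMod (p ^ n)) →+ (Fin k → ZMod (p ^ m)) :=
  (ZMod.castHom (pow_dvd_pow p h) (ZMod (p ^ m))).toAddMonoidHom.compLeft (Fin k)

/-- The completed group ring `ℤ_p⟦ℤ_p^k⟧ = lim_n ℤ_p[ℤ_p^k / p^n ℤ_p^k]`, as the subring of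
compatible sequences in the product. -/
def completedGroupRing :
    Subring (∀ n : ℕ, AddMonoidAlgebra ℤ_[p] (Fin k → ZMod (p ^ n))) :=
  ⨅ (m : ℕ) (n : ℕ) (h : m ≤ n), RingHom.eqLocus
    (Pi.evalRingHom (fun n : ℕ => AddMonoidAlgebra ℤ_[p] (Fin k → ZMod (p ^ n))) m)
    ((AddMonoidAlgebra.mapDomainRingHom ℤ_[p] (transition p k h)).comp
      (Pi.evalRingHom (fun n : ℕ => AddMonoidAlgebra ℤ_[p] (Fin k → ZMod (p ^ n))) n))

theorem mem_completedGroupRing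
    {x : ∀ n : ℕ, AddMonoidAlgebra ℤ_[p] (Fin k → ZMod (p ^ n))} :
    x ∈ completedGroupRing p k ↔ ∀ (m n : ℕ) (h : m ≤ n),
      x m = AddMonoidAlgebra.mapDomainRingHom ℤ_[p] (transition p k h) (x n) := by
  simp [completedGroupRing, Subring.mem_iInf, RingHom.mem_eqLocus]

/-- Reduction `ℤ_p^k → (ℤ/p^n)^k`. -/
def reduce (n : ℕ) (z : Fin k → ℤ_[p]) : Fin k → ZMod (p ^ n) :=
  fun i => PadicInt.toZModPow n (z i)

theorem transition_reduce {m n : ℕ} (h : m ≤ n) (z : Fin k → ℤ_[p]) :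
    transition p k h (reduce p k n z) = reduce p k m z := by
  funext i
  simp [transition, reduce, PadicInt.cast_toZModPow m n h]

/-- The group-like element `[z]` of the completed group ring. -/
def groupLike (z : Fin k → ℤ_[p]) : completedGroupRing p k :=
  ⟨fun n => AddMonoidAlgebra.single (reduce p k n z) 1, by
    rw [mem_completedGroupRing]
    intro m n h
    simp [transition_reduce]⟩

/-- The augmentation ideal `I_Δ`, generated by the elements `Δ_z = [z] - [0]`. -/
def augIdeal : Ideal (completedGroupRing p k) :=
  Ideal.span (Set.range fun z : Fin k → ℤ_[p] => groupLike p k z - groupLike p k 0)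

/-- A representative in `ℤ_p^k` of a class in `(ℤ/p^n)^k`. -/
def lift (n : ℕ) (c : Fin k → ZMod (p ^ n)) : Fin k → ℤ_[p] :=
  fun i => ((c i).val : ℤ_[p])

variable {p k}
variable {A : Type*} [CommRing A] [UniformSpace A] [Algebra ℤ_[p] A]

/-- The `n`-th approximation `∑_c δ_n(c) f(y + c)` (sum over `c ∈ ℤ_p^k / p^n`) of `(δ f)(y)`. -/
def actApprox (δ : completedGroupRing p k) (f : (Fin k → ℤ_[p]) → A) (y : Fin k → ℤ_[p])
    (n : ℕ) : A :=
  ((δ : ∀ n : ℕ, AddMonoidAlgebra ℤ_[p] (Fin k → ZMod (p ^ n))) n).coeff.sum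
    fun c a => a • f (y + lift p k n c)

/-- The action of `ℤ_p⟦ℤ_p^k⟧` on continuous functions `ℤ_p^k → A` that extends the translation
action `([z] f)(y) = f (y + z)`. The limit exists for every continuous `f` when `A` is a complete
Tate `ℤ_p`-algebra, see `tendsto_act`. -/
def act (δ : completedGroupRing p k) (f : (Fin k → ℤ_[p]) → A) (y : Fin k → ℤ_[p]) : A :=
  Filter.limUnder Filter.atTop (actApprox δ f y)

theorem reduce_lift (n : ℕ) (c : Fin k → ZMod (p ^ n)) : reduce p k n (lift p k n c) = c := by
  funext i
  simp [reduce, lift]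

section Convergence

variable [IsUniformAddGroup A] [IsTateRing A] [ContinuousSMul ℤ_[p] A]

/-- Every neighbourhood of zero contains an open `ℤ_p`-stable subgroup. -/
theorem exists_stable_subgroup {U : Set A} (hU : U ∈ 𝓝 (0 : A)) :
    ∃ V : AddSubgroup A, IsOpen (V : Set A) ∧ (V : Set A) ⊆ U ∧
      ∀ (z : ℤ_[p]), ∀ a ∈ V, z • a ∈ V := by
  have := IsTateRing.nonarchimedean A
  obtain ⟨H, hH⟩ := NonarchimedeanRing.is_nonarchimedean U hU
  let V : AddSubgroup A :=
    { carrier := {a | ∀ z : ℤ_[p], z • a ∈ H}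
      add_mem' := fun {a b} ha hb z => by rw [smul_add]; exact H.add_mem (ha z) (hb z)
      zero_mem' := fun z => by rw [smul_zero]; exact H.zero_mem
      neg_mem' := fun {a} ha z => by rw [smul_neg]; exact H.neg_mem (ha z) }
  have hV : (V : Set A) ∈ 𝓝 (0 : A) := by
    have : ∀ᶠ a in 𝓝 (0 : A), ∀ z ∈ (Set.univ : Set ℤ_[p]), z • a ∈ H := by
      refine isCompact_univ.eventually_forall_of_forall_eventually fun z _ => ?_
      have hc : Continuous fun q : A × ℤ_[p] => q.2 • q.1 := by fun_prop
      refine hc.continuousAt.preimage_mem_nhds ?_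
      simpa using H.mem_nhds_zero
    filter_upwards [this] with a ha z using ha z trivial
  refine ⟨V, V.isOpen_of_mem_nhds (g := 0) hV, ?_, ?_⟩
  · intro a ha
    exact hH (by simpa using ha 1)
  · intro z a ha w
    rw [smul_smul]
    exact ha _

theorem exists_reduce_eq_imp_sub_mem {f : (Fin k → ℤ_[p]) → A} (hf : Continuous f)
    {U : Set A} (hU : U ∈ 𝓝 (0 : A)) :
    ∃ N : ℕ, ∀ n ≥ N, ∀ y z, reduce p k n y = reduce p k n z → f y - f z ∈ U := by
  have huc := CompactSpace.uniformContinuous_of_continuous hf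
  have h1 : {q : (Fin k → ℤ_[p]) × (Fin k → ℤ_[p]) | f q.1 - f q.2 ∈ U} ∈
      uniformity (Fin k → ℤ_[p]) := by
    have := (uniformity_eq_comap_nhds_zero_swapped A)
    have h2 : {q : A × A | q.1 - q.2 ∈ U} ∈ uniformity A := by
      rw [this]
      exact Filter.preimage_mem_comap hU
    exact huc h2
  obtain ⟨ε, hε, h⟩ := Metric.mem_uniformity_dist.1 h1
  obtain ⟨N, hN⟩ := PadicInt.exists_pow_neg_lt p hε
  refine ⟨N, fun n hn y z hyz => h ?_⟩
  refine (dist_pi_lt_iff hε).2 fun i => lt_of_le_of_lt ?_ hN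
  have h3 : PadicInt.toZModPow N (y i) = PadicInt.toZModPow N (z i) := by
    rw [← PadicInt.cast_toZModPow N n hn, ← PadicInt.cast_toZModPow N n hn]
    exact congrArg _ (congrFun hyz i)
  rw [dist_eq_norm, PadicInt.norm_le_pow_iff_mem_span_pow, ← PadicInt.ker_toZModPow,
    RingHom.mem_ker, map_sub, h3, sub_self]

theorem tendsto_act [CompleteSpace A] (δ : completedGroupRing p k)
    {f : (Fin k → ℤ_[p]) → A} (hf : Continuous f) (y : Fin k → ℤ_[p]) :
    Filter.Tendsto (actApprox δ f y) Filter.atTop (𝓝 (act δ f y)) := by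
  have := IsTateRing.nonarchimedean A
  refine CauchySeq.tendsto_limUnder
    (NonarchimedeanAddGroup.cauchySeq_of_tendsto_sub_nhds_zero ?_)
  intro U hU
  obtain ⟨V, hVo, hVU, hVs⟩ := exists_stable_subgroup (p := p) hU
  obtain ⟨N, hN⟩ := exists_reduce_eq_imp_sub_mem hf (hVo.mem_nhds V.zero_mem)
  refine Filter.mem_map.2 (Filter.mem_atTop_sets.2 ⟨N, fun n hn => hVU ?_⟩)
  have key : actApprox δ f y n =
      ((δ : ∀ n : ℕ, AddMonoidAlgebra ℤ_[p] (Fin k → ZMod (p ^ n))) (n + 1)).coeff.sum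
        fun c a => a • f (y + lift p k n (transition p k n.le_succ c)) := by
    unfold actApprox
    rw [(mem_completedGroupRing p k).1 δ.2 n (n + 1) n.le_succ]
    simp only [AddMonoidAlgebra.mapDomainRingHom_apply, AddMonoidAlgebra.coeff_mapDomain]
    rw [Finsupp.sum_mapDomain_index]
    · intros; simp
    · intros; simp [add_smul]
  change actApprox δ f y (n + 1) - actApprox δ f y n ∈ V
  rw [key]
  unfold actApprox
  rw [← Finsupp.sum_sub]
  refine V.sum_mem fun c _ => ?_
  change _ • _ - _ • _ ∈ V
  rw [← smul_sub]
  refine hVs _ _ (hN n hn _ _ ?_)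
  have h1 : reduce p k n (lift p k (n + 1) c) =
      reduce p k n (lift p k n (transition p k n.le_succ c)) := by
    rw [reduce_lift, ← transition_reduce p k n.le_succ, reduce_lift]
  funext i
  have h2 := congrFun h1 i
  simp only [reduce, Pi.add_apply, map_add] at h2 ⊢
  rw [h2]

/-- The action extends translation. -/
theorem act_groupLike [CompleteSpace A] [T2Space A] (z : Fin k → ℤ_[p])
    {f : (Fin k → ℤ_[p]) → A} (hf : Continuous f) (y : Fin k → ℤ_[p]) :
    act (groupLike p k z) f y = f (y + z) := by
  refine tendsto_nhds_unique (tendsto_act _ hf y) ?_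
  have h : ∀ n, actApprox (groupLike p k z) f y n = f (y + lift p k n (reduce p k n z)) := by
    intro n
    simp [actApprox, groupLike]
  rw [funext h]
  have : Filter.Tendsto (fun n => f (y + lift p k n (reduce p k n z)) - f (y + z))
      Filter.atTop (𝓝 0) := by
    intro U hU
    obtain ⟨N, hN⟩ := exists_reduce_eq_imp_sub_mem hf hU
    refine Filter.mem_map.2 (Filter.mem_atTop_sets.2 ⟨N, fun n hn => hN n hn _ _ ?_⟩)
    have h2 := reduce_lift n (reduce p k n z)
    funext i
    have h3 := congrFun h2 i
    simp only [reduce, Pi.add_apply, map_add] at h3 ⊢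
    rw [h3]
  simpa using this.add_const (f (y + z))

theorem act_add [CompleteSpace A] [T2Space A] (δ : completedGroupRing p k)
    {f g : (Fin k → ℤ_[p]) → A} (hf : Continuous f) (hg : Continuous g) (y : Fin k → ℤ_[p]) :
    act δ (f + g) y = act δ f y + act δ g y := by
  refine tendsto_nhds_unique (tendsto_act δ (hf.add hg) y) ?_
  have h : actApprox δ (f + g) y = fun n => actApprox δ f y n + actApprox δ g y n := by
    funext n
    simp [actApprox, Finsupp.sum_add]
  rw [h]
  exact (tendsto_act δ hf y).add (tendsto_act δ hg y)

theorem act_smul [CompleteSpace A] [T2Space A] (δ : completedGroupRing p k) (a : A)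
    {f : (Fin k → ℤ_[p]) → A} (hf : Continuous f) (y : Fin k → ℤ_[p]) :
    act δ (a • f) y = a * act δ f y := by
  have hc : Continuous (a • f) := hf.const_smul a
  refine tendsto_nhds_unique (tendsto_act δ hc y) ?_
  have h : actApprox δ (a • f) y = fun n => a * actApprox δ f y n := by
    funext n
    simp [actApprox, Finsupp.mul_sum]
  rw [h]
  exact (tendsto_act δ hf y).const_mul a

end Convergence

end GroupRing

/-! ### Topological modules: bounded sets and convergence on bounded sets -/

section Bounded

variable (A : Type*) [CommRing A] (M : Type*) [AddCommGroup M] [Module A M] [TopologicalSpace M]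

/-- A subset `B` of a topological `A`-module is bounded if for every neighbourhood `U` of zero
there is a unit `a` of `A` with `a B ⊆ U`. -/
def IsBddSet (B : Set M) : Prop :=
  ∀ U ∈ 𝓝 (0 : M), ∃ a : Aˣ, ∀ b ∈ B, (a : A) • b ∈ U

variable [UniformSpace A] [IsTopologicalRing A]

/-- The map from continuous linear forms to functions with the uniform structure of convergence on
bounded sets. -/
def toUniformOnFun : (M →L[A] A) →ₗ[A] UniformOnFun M A {B | IsBddSet A M B} where
  toFun φ := UniformOnFun.ofFun _ φ
  map_add' _ _ := rfl
  map_smul' _ _ := rfl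

/-- The topology of convergence on bounded subsets on the module `ℒ_b(M, A)` of continuous linear
forms. -/
@[reducible]
def boundedConvergence : TopologicalSpace (M →L[A] A) :=
  TopologicalSpace.induced (toUniformOnFun A M) inferInstance

/-- The closure in `ℒ_b(M, A)` of a submodule. -/
def boundedClosure [IsUniformAddGroup A] (S : Submodule A (M →L[A] A)) :
    Submodule A (M →L[A] A) :=
  letI := boundedConvergence A M
  haveI : IsTopologicalAddGroup (M →L[A] A) := topologicalAddGroup_induced (toUniformOnFun A M)
  haveI : ContinuousConstSMul A (M →L[A] A) :=
    ⟨fun a => continuous_induced_rng.2 (by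
      have h : Continuous (toUniformOnFun A M) := continuous_induced_dom
      have h' : (toUniformOnFun A M ∘ fun φ : M →L[A] A => a • φ) =
          fun φ => a • toUniformOnFun A M φ := by
        funext φ
        simp
      rw [h']
      exact h.const_smul a)⟩
  S.topologicalClosure

theorem coe_boundedClosure [IsUniformAddGroup A] (S : Submodule A (M →L[A] A)) :
    (boundedClosure A M S : Set (M →L[A] A)) = @closure _ (boundedConvergence A M) S := rfl

end Bounded

/-! ### Locally analytic functions and distributions on `ℤ_p^k` -/

section Zp

variable (p : ℕ) [Fact p.Prime] (k : ℕ)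
variable {A : Type v} [CommRing A] [UniformSpace A] [IsUniformAddGroup A] [CompleteSpace A]
  [T2Space A] [IsTateRing A] [Algebra ℤ_[p] A] [ContinuousSMul ℤ_[p] A]

/-- `𝒜^(α,r)(ℤ_p^k, A)`: the continuous functions `f` such that for every neighbourhood `U` of zero
there is `N` such that `α^⌊-rn⌋ δ f` takes values in `U` for all `n > N` and `δ ∈ I_Δ^n`. -/
def radFun (α : Aˣ) (r : ℝ) : Submodule A ((Fin k → ℤ_[p]) → A) where
  carrier := {f | Continuous f ∧ ∀ U ∈ 𝓝 (0 : A), ∃ N : ℕ, ∀ n > N,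
    ∀ δ ∈ augIdeal p k ^ n, ∀ y, ((α ^ ⌊-(r * n)⌋ : Aˣ) : A) * act δ f y ∈ U}
  zero_mem' := by
    refine ⟨continuous_const, fun U hU => ⟨0, fun n _ δ _ y => ?_⟩⟩
    have h := act_smul δ (0 : A) (f := (0 : (Fin k → ℤ_[p]) → A)) continuous_const y
    rw [zero_smul, zero_mul] at h
    rw [h, mul_zero]
    exact mem_of_mem_nhds hU
  add_mem' := by
    rintro f g ⟨hf, hf'⟩ ⟨hg, hg'⟩
    refine ⟨hf.add hg, fun U hU => ?_⟩
    obtain ⟨V, hV, hVU⟩ := exists_nhds_zero_half hU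
    obtain ⟨N, hN⟩ := hf' V hV
    obtain ⟨N', hN'⟩ := hg' V hV
    refine ⟨max N N', fun n hn δ hδ y => ?_⟩
    rw [act_add δ hf hg, mul_add]
    exact hVU _ (hN n (lt_of_le_of_lt (le_max_left _ _) hn) δ hδ y) _
      (hN' n (lt_of_le_of_lt (le_max_right _ _) hn) δ hδ y)
  smul_mem' := by
    rintro a f ⟨hf, hf'⟩
    refine ⟨hf.const_smul a, fun U hU => ?_⟩
    have hV : (fun x => a * x) ⁻¹' U ∈ 𝓝 (0 : A) :=
      (continuous_const_mul a).continuousAt.preimage_mem_nhds (by simpa using hU)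
    obtain ⟨N, hN⟩ := hf' _ hV
    refine ⟨N, fun n hn δ hδ y => ?_⟩
    rw [act_smul δ a hf, mul_left_comm]
    exact hN n hn δ hδ y

/-- `𝒜^(α,r)(ℤ_p^k, A)` as a type of its own, since its topology is not the subspace topology. -/
def RadFun (α : Aˣ) (r : ℝ) : Type v := ↥(radFun p k α r)

instance (α : Aˣ) (r : ℝ) : AddCommGroup (RadFun p k α r) :=
  inferInstanceAs (AddCommGroup ↥(radFun p k α r))

instance (α : Aˣ) (r : ℝ) : Module A (RadFun p k α r) :=
  inferInstanceAs (Module A ↥(radFun p k α r))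

/-- The subset `U_r` of `𝒜^(α,r)(ℤ_p^k, A)`: all `f` such that `α^⌊-rn⌋ δ f` takes values in `U` for
all `n` and all `δ ∈ I_Δ^n`. -/
def radNhd (α : Aˣ) (r : ℝ) (U : Set A) : Set (RadFun p k α r) :=
  {f | ∀ n : ℕ, ∀ δ ∈ augIdeal p k ^ n, ∀ y,
    ((α ^ ⌊-(r * n)⌋ : Aˣ) : A) * act δ f.1 y ∈ U}

/-- The translation invariant topology on `𝒜^(α,r)(ℤ_p^k, A)` in which the sets `U_r`, for `U` a
neighbourhood of zero in `A`, are a basis of neighbourhoods of zero. -/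
instance (α : Aˣ) (r : ℝ) : TopologicalSpace (RadFun p k α r) where
  IsOpen W := ∀ f ∈ W, ∃ U ∈ 𝓝 (0 : A), ∀ g, g - f ∈ radNhd p k α r U → g ∈ W
  isOpen_univ := fun _ _ => ⟨Set.univ, Filter.univ_mem, fun _ _ => trivial⟩
  isOpen_inter := by
    intro W W' h h' f hf
    obtain ⟨U, hU, hUW⟩ := h f hf.1
    obtain ⟨U', hU', hUW'⟩ := h' f hf.2
    exact ⟨U ∩ U', Filter.inter_mem hU hU', fun g hg =>
      ⟨hUW g fun n δ hδ y => (hg n δ hδ y).1, hUW' g fun n δ hδ y => (hg n δ hδ y).2⟩⟩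
  isOpen_sUnion := by
    rintro S h f ⟨W, hW, hf⟩
    obtain ⟨U, hU, hUW⟩ := h W hW f hf
    exact ⟨U, hU, fun g hg => ⟨W, hW, hUW g hg⟩⟩

/-- The image of `ℒ_b(𝒞(ℤ_p^k, A), A)` in `ℒ_b(𝒜^(α,r)(ℤ_p^k, A), A)`: the continuous linear forms
on `𝒜^(α,r)(ℤ_p^k, A)` that are restrictions of continuous linear forms on `𝒞(ℤ_p^k, A)`. Here
`𝒞(ℤ_p^k, A)` has the topology of uniform convergence, which is the compact-open topology. -/
def radMeasures (α : Aˣ) (r : ℝ) : Submodule A (RadFun p k α r →L[A] A) where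
  carrier := {φ | ∃ ψ : C(Fin k → ℤ_[p], A) →L[A] A,
    ∀ f : RadFun p k α r, φ f = ψ ⟨f.1, f.2.1⟩}
  zero_mem' := ⟨0, fun _ => rfl⟩
  add_mem' := by
    rintro _ _ ⟨ψ, hψ⟩ ⟨ψ', hψ'⟩
    exact ⟨ψ + ψ', fun f => congrArg₂ (· + ·) (hψ f) (hψ' f)⟩
  smul_mem' := by
    rintro a _ ⟨ψ, hψ⟩
    exact ⟨a • ψ, fun f => congrArg (a • ·) (hψ f)⟩

/-- `𝒟^(α,r)(ℤ_p^k, A)`: the closure of the image of `ℒ_b(𝒞(ℤ_p^k, A), A)` in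
`ℒ_b(𝒜^(α,r)(ℤ_p^k, A), A)`. -/
def radDist (α : Aˣ) (r : ℝ) : Submodule A (RadFun p k α r →L[A] A) :=
  boundedClosure A (RadFun p k α r) (radMeasures p k α r)

/-- `𝒜(ℤ_p^k, A)`: the direct limit, that is, the union, of the modules `𝒜^(α,r)(ℤ_p^k, A)` over all
`r > 0`. -/
def zpFun (α : Aˣ) : Submodule A ((Fin k → ℤ_[p]) → A) :=
  ⨆ r : Set.Ioi (0 : ℝ), radFun p k α r

theorem radFun_le_zpFun (α : Aˣ) {r : ℝ} (hr : 0 < r) : radFun p k α r ≤ zpFun p k α :=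
  le_iSup (fun r : Set.Ioi (0 : ℝ) => radFun p k α r) ⟨r, hr⟩

/-- `𝒟(ℤ_p^k, A)`: the inverse limit of the modules `𝒟^(α,r)(ℤ_p^k, A)` over all `r > 0`. A family of
linear forms on the modules `𝒜^(α,r)(ℤ_p^k, A)` that is compatible with the inclusions is the same
as a linear form on their union, so an element of the inverse limit is a linear form on
`𝒜(ℤ_p^k, A)` whose restriction to each `𝒜^(α,r)(ℤ_p^k, A)` belongs to `𝒟^(α,r)(ℤ_p^k, A)`. -/
def zpDist (α : Aˣ) : Submodule A (↥(zpFun p k α) →ₗ[A] A) where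
  carrier := {φ | ∀ (r : ℝ) (hr : 0 < r), ∃ ψ ∈ radDist p k α r,
    ∀ f : RadFun p k α r, ψ f = φ ⟨f.1, radFun_le_zpFun p k α hr f.2⟩}
  zero_mem' := fun _ _ => ⟨0, Submodule.zero_mem _, fun _ => rfl⟩
  add_mem' := by
    intro φ φ' h h' r hr
    obtain ⟨ψ, hψ, hψφ⟩ := h r hr
    obtain ⟨ψ', hψ', hψφ'⟩ := h' r hr
    exact ⟨ψ + ψ', Submodule.add_mem _ hψ hψ',
      fun f => congrArg₂ (· + ·) (hψφ f) (hψφ' f)⟩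
  smul_mem' := by
    intro a φ h r hr
    obtain ⟨ψ, hψ, hψφ⟩ := h r hr
    exact ⟨a • ψ, Submodule.smul_mem _ a hψ, fun f => congrArg (a • ·) (hψφ f)⟩

end Zp

/-! ### Gluing -/

section Manifold

/-- The inclusion of `ℤ_p^k` into `ℚ_p^k`. -/
def intPoint (p : ℕ) [Fact p.Prime] (k : ℕ) (z : Fin k → ℤ_[p]) : Fin k → ℚ_[p] :=
  fun i => (z i : ℚ_[p])

/-- A decomposition of a locally `ℚ_p`-analytic manifold `X` of dimension `k` as a disjoint union
of open subsets `X_i`, with an identification of each `X_i` with `ℤ_p^k`. The identification is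
given by a locally analytic chart with source `X_i` and target `ℤ_p^k ⊆ ℚ_p^k`. -/
structure Decomposition (p : ℕ) [Fact p.Prime] (k : ℕ) (X : Type u) [TopologicalSpace X]
    [ChartedSpace (Fin k → ℚ_[p]) X] where
  ι : Type u
  chart : ι → OpenPartialHomeomorph X (Fin k → ℚ_[p])
  chart_mem : ∀ i, chart i ∈ IsManifold.maximalAtlas 𝓘(ℚ_[p], Fin k → ℚ_[p]) ω X
  target_eq : ∀ i, (chart i).target = Set.range (intPoint p k)
  pairwise_disjoint : Pairwise fun i j => Disjoint (chart i).source (chart j).source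
  cover : ⋃ i, (chart i).source = Set.univ

variable {p : ℕ} [Fact p.Prime] {k : ℕ}
variable {X : Type u} [TopologicalSpace X] [ChartedSpace (Fin k → ℚ_[p]) X]

/-- The parametrization `ℤ_p^k ≃ X_i ⊆ X` of a piece of a decomposition. -/
def Decomposition.param (d : Decomposition p k X) (i : d.ι) (z : Fin k → ℤ_[p]) : X :=
  (d.chart i).symm (intPoint p k z)

variable {A : Type v} [CommRing A] [UniformSpace A] [IsUniformAddGroup A] [CompleteSpace A]
  [T2Space A] [IsTateRing A] [Algebra ℤ_[p] A] [ContinuousSMul ℤ_[p] A]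

/-- `𝒜(X, A) = ∏_i 𝒜(X_i, A)`: the functions `X → A` whose restriction to each piece `X_i ≃ ℤ_p^k`
belongs to `𝒜(ℤ_p^k, A)`. -/
def laFun (α : Aˣ) (d : Decomposition p k X) : Submodule A (X → A) :=
  ⨅ i, (zpFun p k α).comap (LinearMap.funLeft A A (d.param i))

/-- Restriction to a piece, `𝒜(X, A) → 𝒜(X_i, A)`. -/
def laFun.piece {α : Aˣ} {d : Decomposition p k X} (f : laFun α d) (i : d.ι) : zpFun p k α :=
  ⟨f.1 ∘ d.param i, (Submodule.mem_iInf _).1 f.2 i⟩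

/-- `𝒜_c(X, A) = ⨁_i 𝒜(X_i, A)`: the elements of `𝒜(X, A)` that vanish on all but finitely many
pieces. -/
def laFunC (α : Aˣ) (d : Decomposition p k X) : Submodule A (X → A) where
  carrier := {f | f ∈ laFun α d ∧ {i | f ∘ d.param i ≠ 0}.Finite}
  zero_mem' := ⟨Submodule.zero_mem _, by
    convert Set.finite_empty
    ext i
    simp⟩
  add_mem' := by
    rintro f g ⟨hf, hf'⟩ ⟨hg, hg'⟩
    refine ⟨Submodule.add_mem _ hf hg, (hf'.union hg').subset fun i hi => ?_⟩
    by_contra h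
    simp only [Set.mem_union, Set.mem_ofPred_eq, not_or, not_not] at h
    refine hi ?_
    change f ∘ d.param i + g ∘ d.param i = 0
    rw [h.1, h.2, add_zero]
  smul_mem' := by
    rintro a f ⟨hf, hf'⟩
    refine ⟨Submodule.smul_mem _ a hf, hf'.subset fun i hi h => hi ?_⟩
    change a • (f ∘ d.param i) = 0
    rw [h, smul_zero]

theorem laFunC_le {α : Aˣ} {d : Decomposition p k X} : laFunC α d ≤ laFun α d := fun _ h => h.1

/-- `𝒟(X, A) = ⨁_i 𝒟(X_i, A)`. -/
abbrev Dist (α : Aˣ) (d : Decomposition p k X) : Type (max u v) :=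
  DirectSum d.ι fun _ => zpDist p k α

/-- `𝒟_c(X, A) = ∏_i 𝒟(X_i, A)`. -/
abbrev DistC (α : Aˣ) (d : Decomposition p k X) : Type (max u v) :=
  d.ι → zpDist p k α

/-- The value `φ(f) = ∑_i φ_i(f|X_i)` of `φ ∈ 𝒟(X, A)` at `f ∈ 𝒜(X, A)`; all but finitely many `φ_i`
vanish. -/
def Dist.eval {α : Aˣ} {d : Decomposition p k X} (φ : Dist α d) (f : laFun α d) : A :=
  ∑ᶠ i, (φ i).1 (laFun.piece f i)

/-- The value `φ(f) = ∑_i φ_i(f|X_i)` of `φ ∈ 𝒟_c(X, A)` at `f ∈ 𝒜_c(X, A)`; all but finitely many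
`f|X_i` vanish. -/
def DistC.eval {α : Aˣ} {d : Decomposition p k X} (φ : DistC α d) (f : laFunC α d) : A :=
  ∑ᶠ i, (φ i).1 (laFun.piece ⟨f.1, laFunC_le f.2⟩ i)

/-- Extension by zero of a function along an inclusion of open subsets. -/
def extendByZero {X : Type*} [TopologicalSpace X] {A : Type*} [Zero A]
    {V U : TopologicalSpace.Opens X} (h : V ≤ U) (f : V → A) : U → A :=
  Function.extend (Set.inclusion h) f 0

end Manifold

/-- The closed unit ball `ℤ_p`, as an open subset of the analytic manifold `ℚ_p`. -/
def unitBall (p : ℕ) [Fact p.Prime] : TopologicalSpace.Opens ℚ_[p] :=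
  ⟨{x | ‖x‖ ≤ 1}, by
    simpa [Metric.closedBall, dist_zero_right] using
      IsUltrametricDist.isOpen_closedBall (0 : ℚ_[p]) one_ne_zero⟩

/-- A point of the unit ball of `ℚ_p` as a `p`-adic integer. -/
def unitBall.toInt {p : ℕ} [Fact p.Prime] (x : unitBall p) : ℤ_[p] := ⟨x.1, x.2⟩

end LocAn

end

/-! A *gauge* on `A` is a nonarchimedean submultiplicative size function `N` that defines the
topology; every Tate ring has one (`exists_isGauge`). With it the definition of `𝒜(ℤ_p^k, A)`
becomes elementary. The ideal `I_Δ^n` is generated by `n`-fold products of elements `[z] - [0]`,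
which act by the difference operators `Δ_z f = f(· + z) - f`, so a continuous function belongs to
`𝒜(ℤ_p^k, A)` if and only if its `n`-fold differences have size at most `C ρ^n` for some `C` and
some `ρ < 1` (`forall_augIdeal_pow_iff`, `mem_zpFun_iff`). This criterion does not mention `α`. The
estimates below keep track of how the constants depend on `f`, so that they also give continuity
for the topologies of the spaces `𝒜^(α,r)`.

Functions with exponentially decaying differences are stable under the following operations.
* Products, by the Leibniz rule for differences (`ExpBd.mul`).
* Gluing: it is enough to bound the differences with steps in `p^m ℤ_p^k`, since modulo `p` the
  operator `Δ_e^(p^m)` agrees with `Δ_(p^m e)`, and `p` is topologically nilpotent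
  (`exists_expBd_of_steps`, `zpFun_of_local`).
* Composition with a *contracting* map `G`, one whose `n`-fold differences are divisible by `p^(2n)`.
  In the Newton (Mahler) expansion `f ∘ G = ∑ (Δ^m f)(0) choose(G, m)` the coefficients are small for
  large `m`, and the binomial functions have small differences for small `m`, as dividing by `m!`
  costs at most `p^|m|` (`exists_expBd_comp`).

A convergent power series is contracting on small balls (`exists_contracting_of_analyticAt`). Hence
`𝒜(X, A)` consists of the functions that lie in `𝒜(ℤ_p^k, A)` in some analytic ball around each point
(`mem_laFun_iff`), which is independent of the decomposition, functorial, and a local condition.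

For distributions, let `γ` be a partially defined locally analytic map between two copies of
`ℤ_p^k`, defined on a clopen set. Pullback along `γ`, with value zero outside of the domain, is
continuous on functions, and its dual preserves distributions (`comp_extPull_mem_zpDist`). Evaluation
embeds `𝒟(X, A)` and `𝒟_c(X, A)` into spaces of linear forms, and the image consists of the forms
that restrict to distributions on the pieces (and, for `𝒟`, depend on finitely many pieces only), see
`Dist.exists_eval_eq` and `DistC.exists_eval_eq`. So the comparison isomorphisms, the push-forward and
the restriction maps are duals of maps between spaces of functions, and they are unique.

Decompositions exist because a paracompact manifold over `ℚ_p` is a disjoint union of open subsets of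
chart domains (`exists_partition`), and in such a subset the maximal balls that are contained in a
member of a given open cover form a partition (`exists_decomposition`). The refinement by a cover is
what is needed to glue distributions (`DistC.existsUnique_glue`).

Finally, let `X` be a `ℤ_p`-module with analytic operations. In a chart, the logarithm
`ℓ(x) = d/dt (t • x)` at `t = 0` is additive near the origin, and its derivative there is the
identity: by the symmetry of second derivatives, this follows from the fact that multiplication by
`p^n` has derivative `p^n` (`fderiv_chartLog`). The inverse function theorem gives a continuous
homomorphism `η` from `ℤ_p^k` onto a neighbourhood of the origin (`exists_exp`). For a continuous
character `χ`, the function `ξ = χ ∘ η` satisfies `Δ_z ξ = (ξ(z) - 1) ξ`, so its differences decay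
exponentially on a small ball, and near every point `χ` is a constant times the composite of `ξ` with
an analytic map. -/

set_option linter.unusedSectionVars false

noncomputable section

namespace LocAn

open Filter

/-! ### Gauges -/

/-- A nonarchimedean submultiplicative size function on a topological ring that defines its
topology. The norms of `ℤ_p` and `ℚ_p` are gauges, and every Tate ring has one. Working with such a
function instead of a norm avoids a second topology on the ring. -/
structure IsGauge {B : Type*} [CommRing B] [TopologicalSpace B] (N : B → ℝ) : Prop where
  nonneg : ∀ a, 0 ≤ N a
  map_zero : N 0 = 0
  add_le : ∀ a b, N (a + b) ≤ max (N a) (N b)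
  map_neg : ∀ a, N (-a) = N a
  mul_le : ∀ a b, N (a * b) ≤ N a * N b
  mem_nhds : ∀ ε > 0, {a | N a < ε} ∈ 𝓝 (0 : B)
  exists_lt : ∀ U ∈ 𝓝 (0 : B), ∃ ε > 0, ∀ a, N a < ε → a ∈ U

namespace IsGauge

variable {B : Type*} [CommRing B] [TopologicalSpace B] {N : B → ℝ}

theorem sum_le (hN : IsGauge N) {ι : Type*} (s : Finset ι) (f : ι → B) {c : ℝ} (hc : 0 ≤ c)
    (h : ∀ i ∈ s, N (f i) ≤ c) : N (∑ i ∈ s, f i) ≤ c := by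
  classical
  induction s using Finset.induction_on with
  | empty => simpa [hN.map_zero] using hc
  | insert a s ha ih =>
    rw [Finset.sum_insert ha]
    exact (hN.add_le _ _).trans (max_le (h a (by simp)) (ih fun i hi => h i (by simp [hi])))

theorem nsmul_le (hN : IsGauge N) (n : ℕ) (a : B) : N (n • a) ≤ N a := by
  induction n with
  | zero => simpa [hN.map_zero] using hN.nonneg a
  | succ n ih =>
    rw [succ_nsmul]
    exact (hN.add_le _ _).trans (max_le ih le_rfl)

theorem isClosed_le [IsTopologicalRing B] (hN : IsGauge N) (c : ℝ) : IsClosed {a | N a ≤ c} := by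
  refine isClosed_of_closure_subset fun a ha => ?_
  have key : ∀ ε > 0, ∃ b, N b ≤ c ∧ N (a - b) < ε := by
    intro ε hε
    have h1 : {b | N (a - b) < ε} ∈ 𝓝 a := by
      have h2 : Tendsto (fun b => a - b) (𝓝 a) (𝓝 0) := by
        have : Continuous fun b : B => a - b := by fun_prop
        simpa using this.tendsto a
      exact h2 (hN.mem_nhds ε hε)
    obtain ⟨b, hb, hb'⟩ := mem_closure_iff_nhds.1 ha _ h1
    exact ⟨b, hb', hb⟩
  obtain ⟨b, hb, -⟩ := key 1 one_pos
  have hc : 0 ≤ c := (hN.nonneg b).trans hb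
  change N a ≤ c
  refine le_of_forall_pos_le_add fun ε hε => ?_
  obtain ⟨b, hb, hb'⟩ := key ε hε
  calc N a = N (a - b + b) := by rw [sub_add_cancel]
    _ ≤ max (N (a - b)) (N b) := hN.add_le _ _
    _ ≤ c + ε := max_le (hb'.le.trans (le_add_of_nonneg_left hc)) (hb.trans (le_add_of_nonneg_right hε.le))

/-- The constant accounts for `N 1`, which may differ from `1`. -/
theorem pow_le (hN : IsGauge N) (a : B) (n : ℕ) : N (a ^ n) ≤ max (N 1) 1 * N a ^ n := by
  induction n with
  | zero => simp
  | succ n ih =>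
    rw [pow_succ, pow_succ, ← mul_assoc]
    exact (hN.mul_le _ _).trans (mul_le_mul_of_nonneg_right ih (hN.nonneg _))

/-- Powers of a topologically nilpotent element decay exponentially. -/
theorem exists_pow_le (hN : IsGauge N) {a : B} (ha : IsTopologicallyNilpotent a) :
    ∃ C b : ℝ, 1 ≤ C ∧ 0 < b ∧ b < 1 ∧ ∀ n : ℕ, N (a ^ n) ≤ C * b ^ n := by
  obtain ⟨K, hK⟩ := eventually_atTop.1
    (Filter.Tendsto.eventually ha (hN.mem_nhds (1 / 2) (by norm_num)))
  have hK1 : N (a ^ (K + 1)) < 1 / 2 := hK (K + 1) (by omega)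
  -- the rate is chosen such that `b ^ (K + 1) = 1 / 2`
  set b : ℝ := (1 / 2 : ℝ) ^ ((K + 1 : ℝ)⁻¹) with hb
  have hb0 : 0 < b := Real.rpow_pos_of_pos (by norm_num) _
  have hb1 : b < 1 := Real.rpow_lt_one (by norm_num) (by norm_num) (by positivity)
  have hbK : b ^ (K + 1) = 1 / 2 := by
    rw [hb, ← Real.rpow_natCast, ← Real.rpow_mul (by norm_num)]
    push_cast
    rw [inv_mul_cancel₀ (by positivity), Real.rpow_one]
  obtain ⟨C, hC⟩ : ∃ C : ℝ, ∀ i < K + 1, N (a ^ i) ≤ C := by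
    obtain ⟨C, hC⟩ := ((Finset.range (K + 1)).image fun i => N (a ^ i)).bddAbove
    exact ⟨C, fun i hi => hC (by
      simp only [Finset.coe_image, Set.mem_image, Finset.coe_range, Set.mem_Iio]
      exact ⟨i, hi, rfl⟩)⟩
  set C' : ℝ := max C 1 * max (N 1) 1 * 2 with hC'
  have h1 : (1 : ℝ) ≤ max (N 1) 1 := le_max_right _ _
  have h2 : (1 : ℝ) ≤ max C 1 := le_max_right _ _
  refine ⟨C', b, by nlinarith, hb0, hb1, fun n => ?_⟩
  have hn := Nat.div_add_mod n (K + 1)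
  have hlt : n % (K + 1) < K + 1 := Nat.mod_lt _ (by omega)
  set q := n / (K + 1)
  set s := n % (K + 1)
  have e1 : N (a ^ n) ≤ max (N 1) 1 * (1 / 2) ^ q * max C 1 := by
    rw [← hn, pow_add, pow_mul]
    refine (hN.mul_le _ _).trans (mul_le_mul ?_ ((hC s hlt).trans (le_max_left _ _))
      (hN.nonneg _) (by positivity))
    exact (hN.pow_le _ _).trans (mul_le_mul_of_nonneg_left
      (pow_le_pow_left₀ (hN.nonneg _) hK1.le _) (by positivity))
  have e2 : (1 / 2 : ℝ) * (1 / 2) ^ q ≤ b ^ n := by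
    rw [← hbK, ← pow_mul, ← pow_add]
    exact pow_le_pow_of_le_one hb0.le hb1.le (by omega)
  calc N (a ^ n) ≤ max (N 1) 1 * (1 / 2) ^ q * max C 1 := e1
    _ = C' * ((1 / 2 : ℝ) * (1 / 2) ^ q) := by rw [hC']; ring
    _ ≤ C' * b ^ n := mul_le_mul_of_nonneg_left e2 (by positivity)

theorem tendsto_zero (hN : IsGauge N) {ι : Type*} {l : Filter ι} {f : ι → B}
    (hf : Tendsto f l (𝓝 0)) {ε : ℝ} (hε : 0 < ε) : ∀ᶠ i in l, N (f i) < ε :=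
  hf (hN.mem_nhds ε hε)

theorem exists_bound [IsTopologicalRing B] (hN : IsGauge N) {M : Type*} [TopologicalSpace M]
    [CompactSpace M] {f : M → B} (hf : Continuous f) : ∃ C, 0 ≤ C ∧ ∀ x, N (f x) ≤ C := by
  have hopen : ∀ y, ∀ᶠ x in 𝓝 y, N (f x) ≤ max (N (f y)) 1 := by
    intro y
    have h : Tendsto (fun x => f x - f y) (𝓝 y) (𝓝 0) := by
      have : Continuous fun x => f x - f y := by fun_prop
      simpa using this.tendsto y
    filter_upwards [hN.tendsto_zero h one_pos] with x hx
    have := hN.add_le (f x - f y) (f y)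
    rw [sub_add_cancel] at this
    exact this.trans (max_le (hx.le.trans (le_max_right _ _)) (le_max_left _ _))
  obtain ⟨t, -, ht⟩ := isCompact_univ.elim_nhds_subcover _ fun y _ => hopen y
  obtain ⟨C, hC⟩ := (t.image fun y => max (N (f y)) 1).bddAbove
  refine ⟨max C 0, le_max_right _ _, fun x => ?_⟩
  obtain ⟨y, hy, hxy⟩ := Set.mem_iUnion₂.1 (ht (Set.mem_univ x))
  refine le_trans hxy (le_max_of_le_left (hC ?_))
  simp only [Finset.coe_image, Set.mem_image]
  exact ⟨y, hy, rfl⟩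

variable {p : ℕ} [Fact p.Prime]

/-- For natural numbers this is the ultrametric inequality; they are dense in `ℤ_p`. -/
theorem padicInt_smul_le [IsTopologicalRing B] [Algebra ℤ_[p] B] [ContinuousSMul ℤ_[p] B]
    (hN : IsGauge N) (z : ℤ_[p]) (a : B) : N (z • a) ≤ N a := by
  have hcl : IsClosed {z : ℤ_[p] | N (z • a) ≤ N a} :=
    (hN.isClosed_le (N a)).preimage (by fun_prop : Continuous fun z : ℤ_[p] => z • a)
  have : {z : ℤ_[p] | N (z • a) ≤ N a} = Set.univ := by
    refine Set.eq_univ_of_univ_subset ?_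
    rw [← (PadicInt.denseRange_natCast (p := p)).closure_range]
    refine hcl.closure_subset_iff.2 ?_
    rintro _ ⟨n, rfl⟩
    have h1 : (n : ℤ_[p]) • a = n • a := by rw [Nat.cast_smul_eq_nsmul]
    simpa [h1] using hN.nsmul_le n a
  exact (Set.ext_iff.1 this z).2 trivial

/-- Multiplication by powers of `p` shrinks exponentially. -/
theorem exists_p_pow_smul_le [IsTopologicalRing B] [Algebra ℤ_[p] B] [ContinuousSMul ℤ_[p] B]
    (hN : IsGauge N) : ∃ C b : ℝ, 1 ≤ C ∧ 0 < b ∧ b < 1 ∧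
      ∀ (n : ℕ) (a : B), N (((p : ℤ_[p]) ^ n) • a) ≤ C * b ^ n * N a := by
  have hp : IsTopologicallyNilpotent ((p : ℤ_[p]) • (1 : B)) := by
    have h0 : Tendsto (fun n : ℕ => (p : ℤ_[p]) ^ n) atTop (𝓝 0) :=
      tendsto_pow_atTop_nhds_zero_of_norm_lt_one (by
        rw [PadicInt.norm_p]
        exact inv_lt_one_of_one_lt₀ (by exact_mod_cast (Fact.out : p.Prime).one_lt))
    have h1 := h0.smul_const (1 : B)
    rw [zero_smul] at h1
    refine h1.congr fun n => ?_
    rw [smul_pow, one_pow]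
  obtain ⟨C, b, hC, hb0, hb1, h⟩ := hN.exists_pow_le hp
  refine ⟨C, b, hC, hb0, hb1, fun n a => ?_⟩
  have h1 : ((p : ℤ_[p]) ^ n) • a = ((p : ℤ_[p]) • (1 : B)) ^ n * a := by
    rw [smul_pow, one_pow, smul_mul_assoc, one_mul]
  rw [h1]
  exact (hN.mul_le _ _).trans (mul_le_mul_of_nonneg_right (h n) (hN.nonneg _))

/-- An element of norm at most `p^{-n}` acts with the contraction of `p^n`. -/
theorem smul_le_of_norm_le [IsTopologicalRing B] [Algebra ℤ_[p] B] [ContinuousSMul ℤ_[p] B]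
    (hN : IsGauge N) {C b : ℝ}
    (h : ∀ (n : ℕ) (a : B), N (((p : ℤ_[p]) ^ n) • a) ≤ C * b ^ n * N a) {z : ℤ_[p]} {n : ℕ}
    (hz : ‖z‖ ≤ (p : ℝ) ^ (-n : ℤ)) (a : B) : N (z • a) ≤ C * b ^ n * N a := by
  obtain ⟨w, rfl⟩ := Ideal.mem_span_singleton'.1 ((PadicInt.norm_le_pow_iff_mem_span_pow z n).1 hz)
  rw [mul_smul]
  exact (hN.padicInt_smul_le _ _).trans (h n a)

end IsGauge

theorem isGauge_norm_of_ultrametric {B : Type*} [NormedCommRing B] [IsUltrametricDist B] :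
    IsGauge (fun a : B => ‖a‖) where
  nonneg := norm_nonneg
  map_zero := norm_zero
  add_le := IsUltrametricDist.norm_add_le_max
  map_neg := norm_neg
  mul_le := norm_mul_le
  mem_nhds ε hε := by
    simpa [Metric.ball, dist_zero_right] using Metric.ball_mem_nhds (0 : B) hε
  exists_lt U hU := by
    obtain ⟨ε, hε, h⟩ := Metric.mem_nhds_iff.1 hU
    exact ⟨ε, hε, fun a ha => h (by simpa using ha)⟩

/-- Every Tate ring has a gauge: if the topology of the open subring `A₀` is `ϖ`-adic, the size of
`a` is the infimum of the `2^{-n}` with `a ∈ ϖ^n A₀`. -/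
theorem exists_isGauge (A : Type*) [CommRing A] [TopologicalSpace A] [IsTateRing A] :
    ∃ N : A → ℝ, IsGauge N := by
  obtain ⟨A₀, I, hI, ϖ, hnil, hunit, rfl⟩ := IsTateRing.exists_pair (A := A)
  obtain ⟨x, hx⟩ := hunit
  have hx0 : (x : A) ∈ A₀ := by rw [hx]; exact ϖ.2
  have hxpow : ∀ n : ℕ, ((x ^ n : Aˣ) : A) ∈ A₀ := fun n => by
    rw [Units.val_pow_eq_pow_val]
    exact pow_mem hx0 n
  -- `V n a` says that `a` lies in `ϖ^n A₀`, where `x` is `ϖ` as a unit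
  let V : ℤ → A → Prop := fun n a => ((x ^ (-n) : Aˣ) : A) * a ∈ A₀
  have hVmono : ∀ {m n : ℤ} {a : A}, m ≤ n → V n a → V m a := by
    intro m n a hmn h
    obtain ⟨d, rfl⟩ := Int.le.dest hmn
    have e : x ^ (-m) = x ^ d * x ^ (-(m + d)) := by
      rw [← zpow_natCast, ← zpow_add]
      congr 1
      ring
    change _ ∈ A₀
    rw [e, Units.val_mul, mul_assoc]
    exact mul_mem (hxpow d) h
  have hVadd : ∀ {n : ℤ} {a b : A}, V n a → V n b → V n (a + b) := by
    intro n a b ha hb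
    change _ ∈ A₀
    rw [mul_add]
    exact add_mem ha hb
  have hVmul : ∀ {m n : ℤ} {a b : A}, V m a → V n b → V (m + n) (a * b) := by
    intro m n a b ha hb
    change _ ∈ A₀
    have e : x ^ (-(m + n)) = x ^ (-m) * x ^ (-n) := by
      rw [← zpow_add]
      congr 1
      ring
    rw [e, Units.val_mul, mul_mul_mul_comm]
    exact mul_mem ha hb
  have hVne : ∀ a : A, ∃ n : ℤ, V n a := by
    intro a
    have h1 : Tendsto (fun n : ℕ => (x : A) ^ n * a) atTop (𝓝 0) := by
      have := hnil.mul_const a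
      rw [← hx, zero_mul] at this
      exact this
    obtain ⟨n, hn⟩ := (h1.eventually (hI.isOpen.mem_nhds A₀.zero_mem)).exists
    refine ⟨-(n : ℤ), ?_⟩
    change _ ∈ A₀
    rw [neg_neg, zpow_natCast, Units.val_pow_eq_pow_val]
    exact hn
  let S : A → Set ℝ := fun a => {c | ∃ n : ℤ, V n a ∧ c = (2 : ℝ) ^ (-n)}
  have hSne : ∀ a, (S a).Nonempty := fun a => by
    obtain ⟨n, hn⟩ := hVne a
    exact ⟨_, n, hn, rfl⟩
  have hSbdd : ∀ a, BddBelow (S a) := fun a => ⟨0, by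
    rintro _ ⟨n, -, rfl⟩
    positivity⟩
  have hle : ∀ {n : ℤ} {a : A}, V n a → sInf (S a) ≤ (2 : ℝ) ^ (-n) := fun {n a} h =>
    csInf_le (hSbdd a) ⟨n, h, rfl⟩
  have hlt : ∀ {a : A} {c : ℝ}, sInf (S a) < c → ∃ n : ℤ, V n a ∧ (2 : ℝ) ^ (-n) < c := by
    intro a c h
    obtain ⟨_, ⟨n, hn, rfl⟩, hc⟩ := exists_lt_of_csInf_lt (hSne a) h
    exact ⟨n, hn, hc⟩
  have hnn : ∀ a, 0 ≤ sInf (S a) := fun a => le_csInf (hSne a) (by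
    rintro _ ⟨n, -, rfl⟩
    positivity)
  have hVneg : ∀ {n : ℤ} {a : A}, V n a ↔ V n (-a) := by
    intro n a
    change _ ∈ A₀ ↔ _ ∈ A₀
    rw [mul_neg, neg_mem_iff]
  refine ⟨fun a => sInf (S a), hnn, ?_, ?_, ?_, ?_, ?_, ?_⟩
  · refine le_antisymm (le_of_forall_pos_le_add fun ε hε => ?_) (hnn 0)
    obtain ⟨n, hn⟩ := exists_pow_lt_of_lt_one hε (by norm_num : (1 / 2 : ℝ) < 1)
    have h0 : V n 0 := by
      change _ ∈ A₀
      rw [mul_zero]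
      exact A₀.zero_mem
    have h1 : sInf (S 0) ≤ (2 : ℝ) ^ (-(n : ℤ)) := hle h0
    rw [zpow_neg, zpow_natCast, ← inv_pow, inv_eq_one_div] at h1
    linarith
  · intro a b
    refine le_of_forall_gt fun c hc => ?_
    obtain ⟨n, hn, hnc⟩ := hlt ((le_max_left _ _).trans_lt hc)
    obtain ⟨m, hm, hmc⟩ := hlt ((le_max_right _ _).trans_lt hc)
    rcases le_total m n with h | h
    · exact (hle (hVadd (hVmono h hn) hm)).trans_lt hmc
    · exact (hle (hVadd hn (hVmono h hm))).trans_lt hnc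
  · intro a
    have : S (-a) = S a := by
      ext c
      exact exists_congr fun n => and_congr_left fun _ => hVneg.symm
    simp only [this]
  · intro a b
    refine le_mul_of_forall_lt₀ fun c hc d hd => ?_
    obtain ⟨n, hn, hnc⟩ := hlt hc
    obtain ⟨m, hm, hmc⟩ := hlt hd
    refine (hle (hVmul hn hm)).trans ?_
    rw [neg_add, zpow_add₀ (by norm_num)]
    exact mul_le_mul hnc.le hmc.le (by positivity) ((hnn a).trans hc.le)
  · intro ε hε
    obtain ⟨n, hn⟩ := exists_pow_lt_of_lt_one hε (by norm_num : (1 / 2 : ℝ) < 1)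
    have hc : Continuous fun a : A => ((x ^ (-(n : ℤ)) : Aˣ) : A) * a := by fun_prop
    have h1 : {a | V n a} ∈ 𝓝 (0 : A) :=
      hc.continuousAt.preimage_mem_nhds (by
        rw [mul_zero]
        exact hI.isOpen.mem_nhds A₀.zero_mem)
    filter_upwards [h1] with a ha
    have h2 : sInf (S a) ≤ (2 : ℝ) ^ (-(n : ℤ)) := hle ha
    rw [zpow_neg, zpow_natCast, ← inv_pow, inv_eq_one_div] at h2
    exact h2.trans_lt hn
  · intro U hU
    have hU' : ((↑) : A₀ → A) ⁻¹' U ∈ 𝓝 (0 : A₀) :=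
      continuous_subtype_val.continuousAt.preimage_mem_nhds (by simpa using hU)
    obtain ⟨n, -, hn⟩ := hI.isAdic.hasBasis_nhds_zero.mem_iff.1 hU'
    refine ⟨(2 : ℝ) ^ (-(n : ℤ)), by positivity, fun a ha => ?_⟩
    obtain ⟨m, hm, hmn⟩ := hlt ha
    have hnm : (n : ℤ) ≤ m := by
      rw [zpow_lt_zpow_iff_right₀ (by norm_num)] at hmn
      omega
    have h1 : ((x ^ (-(n : ℤ)) : Aˣ) : A) * a ∈ A₀ := hVmono hnm hm
    have h2 : ϖ ^ n * (⟨_, h1⟩ : A₀) ∈ ((Ideal.span {ϖ}) ^ n : Ideal A₀) := by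
      rw [Ideal.span_singleton_pow]
      exact Ideal.mul_mem_right _ _ (Ideal.mem_span_singleton_self _)
    have h3 := hn h2
    have h4 : ((ϖ ^ n * (⟨_, h1⟩ : A₀) : A₀) : A) = a := by
      push_cast
      rw [← hx, ← mul_assoc, ← Units.val_pow_eq_pow_val, ← Units.val_mul, ← zpow_natCast,
        ← zpow_add]
      simp
    rw [Set.mem_preimage, h4] at h3
    exact h3

/-! ### Iterated differences -/

section DiffBd

variable {M : Type*} [AddCommGroup M] {B : Type*} [CommRing B]

/-- All `n`-fold differences `Δ_{z_1} ⋯ Δ_{z_n} f` with steps `z_i` in `Z` have size at most `c`. -/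
def DiffBd (N : B → ℝ) (Z : Set M) : ℕ → (M → B) → ℝ → Prop
  | 0, f, c => ∀ y, N (f y) ≤ c
  | n + 1, f, c => ∀ z ∈ Z, DiffBd N Z n (fwdDiff z f) c

variable {N : B → ℝ} {Z : Set M} {n : ℕ} {f g : M → B} {c d : ℝ}

theorem fwdDiff_comm (z w : M) (f : M → B) :
    fwdDiff z (fwdDiff w f) = fwdDiff w (fwdDiff z f) := by
  funext y
  simp only [fwdDiff, add_right_comm y w z]
  abel

theorem fwdDiff_translate (z w : M) (f : M → B) :
    fwdDiff z (fun y => f (y + w)) = fun y => fwdDiff z f (y + w) := by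
  funext y
  simp only [fwdDiff, add_right_comm y z w]

theorem fwdDiff_mul (z : M) (f g : M → B) :
    fwdDiff z (f * g) = fwdDiff z f * (fun y => g (y + z)) + f * fwdDiff z g := by
  funext y
  simp only [fwdDiff, Pi.mul_apply, Pi.add_apply]
  ring

theorem fwdDiff_step_add (z w : M) (f : M → B) :
    fwdDiff (z + w) f = fwdDiff z f + fun y => fwdDiff w f (y + z) := by
  funext y
  simp only [fwdDiff, Pi.add_apply, add_assoc]
  abel

namespace DiffBd

theorem mono (h : DiffBd N Z n f c) (hcd : c ≤ d) : DiffBd N Z n f d := by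
  induction n generalizing f with
  | zero => exact fun y => (h y).trans hcd
  | succ n ih => exact fun z hz => ih (h z hz)

theorem mono_set {Z' : Set M} (hZ : Z' ⊆ Z) (h : DiffBd N Z n f c) : DiffBd N Z' n f c := by
  induction n generalizing f with
  | zero => exact h
  | succ n ih => exact fun z hz => ih (h z (hZ hz))

theorem translate (h : DiffBd N Z n f c) (w : M) : DiffBd N Z n (fun y => f (y + w)) c := by
  induction n generalizing f with
  | zero => exact fun y => h _
  | succ n ih =>
    intro z hz
    rw [fwdDiff_translate]
    exact ih (h z hz)

/-- Postcomposition with an additive map. -/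
theorem map {B' : Type*} [CommRing B'] {N' : B' → ℝ} (L : B →+ B')
    (hL : ∀ b, N b ≤ c → N' (L b) ≤ d) (h : DiffBd N Z n f c) :
    DiffBd N' Z n (fun y => L (f y)) d := by
  induction n generalizing f with
  | zero => exact fun y => hL _ (h y)
  | succ n ih =>
    intro z hz
    have : fwdDiff z (fun y => L (f y)) = fun y => L (fwdDiff z f y) := by
      funext y
      simp [fwdDiff]
    rw [this]
    exact ih (h z hz)

/-- Descent along an additive map that does not shrink sizes too much. -/
theorem of_map {B' : Type*} [CommRing B'] {N' : B' → ℝ} (L : B →+ B')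
    (hL : ∀ b, N' (L b) ≤ d → N b ≤ c) (h : DiffBd N' Z n (fun y => L (f y)) d) :
    DiffBd N Z n f c := by
  induction n generalizing f with
  | zero => exact fun y => hL _ (h y)
  | succ n ih =>
    intro z hz
    have : fwdDiff z (fun y => L (f y)) = fun y => L (fwdDiff z f y) := by
      funext y
      simp [fwdDiff]
    have h' := h z hz
    rw [this] at h'
    exact ih h'

/-- Precomposition with an additive map. -/
theorem comp_hom {M' : Type*} [AddCommGroup M'] (L : M' →+ M) {Z' : Set M'}
    (hL : Set.MapsTo L Z' Z) (h : DiffBd N Z n f c) :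
    DiffBd N Z' n (fun y => f (L y)) c := by
  induction n generalizing f with
  | zero => exact fun y => h _
  | succ n ih =>
    intro z hz
    have : fwdDiff z (fun y => f (L y)) = fun y => fwdDiff (L z) f (L y) := by
      funext y
      simp [fwdDiff]
    rw [this]
    exact ih (h _ (hL hz))

variable [TopologicalSpace B]

theorem nonneg (hN : IsGauge N) (hZ : Z.Nonempty) (h : DiffBd N Z n f c) : 0 ≤ c := by
  induction n generalizing f with
  | zero => exact (hN.nonneg _).trans (h 0)
  | succ n ih =>
    obtain ⟨z, hz⟩ := hZ
    exact ih (h z hz)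

theorem zero (hN : IsGauge N) (hc : 0 ≤ c) : DiffBd N Z n (0 : M → B) c := by
  induction n with
  | zero => exact fun y => by simpa [hN.map_zero] using hc
  | succ n ih =>
    intro z _
    have : fwdDiff z (0 : M → B) = 0 := by
      funext y
      simp [fwdDiff]
    rw [this]
    exact ih

theorem add (hN : IsGauge N) (hf : DiffBd N Z n f c) (hg : DiffBd N Z n g c) :
    DiffBd N Z n (f + g) c := by
  induction n generalizing f g with
  | zero => exact fun y => (hN.add_le _ _).trans (max_le (hf y) (hg y))
  | succ n ih =>
    intro z hz
    rw [fwdDiff_add]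
    exact ih (hf z hz) (hg z hz)

theorem neg (hN : IsGauge N) (hf : DiffBd N Z n f c) : DiffBd N Z n (-f) c :=
  hf.map (-AddMonoidHom.id B) (by simp [hN.map_neg])

theorem sub (hN : IsGauge N) (hf : DiffBd N Z n f c) (hg : DiffBd N Z n g c) :
    DiffBd N Z n (f - g) c := by
  rw [sub_eq_add_neg]
  exact hf.add hN (hg.neg hN)

theorem sum (hN : IsGauge N) {ι : Type*} {s : Finset ι} {F : ι → M → B} (hc : 0 ≤ c)
    (h : ∀ i ∈ s, DiffBd N Z n (F i) c) : DiffBd N Z n (∑ i ∈ s, F i) c := by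
  classical
  induction s using Finset.induction_on with
  | empty => exact DiffBd.zero hN hc
  | insert a s ha ih =>
    rw [Finset.sum_insert ha]
    exact (h a (by simp)).add hN (ih fun i hi => h i (by simp [hi]))

/-- Differencing once more in an arbitrary direction does not increase sizes. -/
theorem diff (hN : IsGauge N) (w : M) (h : DiffBd N Z n f c) : DiffBd N Z n (fwdDiff w f) c :=
  (h.translate w).sub hN h

theorem diff_iterate (hN : IsGauge N) (w : M) (m : ℕ) (h : DiffBd N Z n f c) :
    DiffBd N Z n ((fwdDiff w)^[m] f) c := by
  induction m generalizing f with
  | zero => exact h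
  | succ m ih => exact ih (h.diff hN w)

theorem succ (hN : IsGauge N) (h : DiffBd N Z n f c) : DiffBd N Z (n + 1) f c := by
  induction n generalizing f with
  | zero => exact fun z _ => DiffBd.diff (n := 0) hN z h
  | succ n ih => exact fun z hz => ih (h z hz)

theorem of_le (hN : IsGauge N) {m : ℕ} (hmn : m ≤ n) (h : DiffBd N Z m f c) :
    DiffBd N Z n f c := by
  induction n, hmn using Nat.le_induction with
  | base => exact h
  | succ n _ ih => exact ih.succ hN

/-- Bounds on differences pass to pointwise limits, because closed balls of a gauge are closed. -/
theorem of_tendsto [IsTopologicalRing B] (hN : IsGauge N) {ι : Type*} {l : Filter ι} [l.NeBot]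
    {F : ι → M → B} (hF : ∀ y, Tendsto (fun i => F i y) l (𝓝 (f y)))
    (h : ∀ᶠ i in l, DiffBd N Z n (F i) c) : DiffBd N Z n f c := by
  induction n generalizing f F with
  | zero => exact fun y => (hN.isClosed_le c).mem_of_tendsto (hF y) (h.mono fun i hi => hi y)
  | succ n ih =>
    exact fun z hz => ih (fun y => (hF (y + z)).sub (hF y)) (h.mono fun i hi => hi z hz)

/-- Iterated differences with steps in `Z` control those with steps in the closed subgroup
generated by `Z`. -/
theorem closure [IsTopologicalRing B] [TopologicalSpace M] [ContinuousAdd M] (hN : IsGauge N)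
    (hc : 0 ≤ c) (hf : Continuous f) (h : DiffBd N Z n f c) :
    DiffBd N (closure (AddSubgroup.closure Z : Set M)) n f c := by
  induction n generalizing f with
  | zero => exact h
  | succ n ih =>
    have hcl : IsClosed {w : M | DiffBd N (_root_.closure (AddSubgroup.closure Z : Set M)) n
        (fwdDiff w f) c} := by
      refine isClosed_of_closure_subset fun w hw => ?_
      obtain ⟨l, hl, hlw⟩ := mem_closure_iff_ultrafilter.1 hw
      refine DiffBd.of_tendsto hN (F := fun w => fwdDiff w f) (l := (l : Filter M)) (fun y => ?_) hl
      have hc : Continuous fun w => fwdDiff w f y := by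
        unfold fwdDiff
        fun_prop
      exact (hc.tendsto w).mono_left hlw
    suffices hs : (AddSubgroup.closure Z : Set M) ⊆ {w : M | DiffBd N
        (_root_.closure (AddSubgroup.closure Z : Set M)) n (fwdDiff w f) c} from
      fun z hz => hcl.closure_subset_iff.2 hs hz
    intro w hw
    induction hw using AddSubgroup.closure_induction with
    | mem x hx =>
      refine ih ?_ (h x hx)
      unfold fwdDiff
      fun_prop
    | zero =>
      have : fwdDiff 0 f = 0 := by
        funext y
        simp [fwdDiff]
      change DiffBd _ _ _ _ _
      rw [this]
      exact DiffBd.zero hN hc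
    | add x y _ _ hx hy =>
      change DiffBd _ _ _ _ _
      rw [fwdDiff_step_add]
      exact hx.add hN (hy.translate x)
    | neg x _ hx =>
      have : fwdDiff (-x) f = -fun y => fwdDiff x f (y + -x) := by
        funext y
        simp [fwdDiff]
      change DiffBd _ _ _ _ _
      rw [this]
      exact (hx.translate (-x)).neg hN

omit [TopologicalSpace B] in
/-- Differences with steps in `Z ∪ {e}` are sorted into those along `e` and those along `Z`. -/
theorem insert {e : M} (h : ∀ a b, a + b = n → DiffBd N Z a ((fwdDiff e)^[b] f) c) :
    DiffBd N (insert e Z) n f c := by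
  induction n generalizing f with
  | zero => exact h 0 0 rfl
  | succ n ih =>
    intro z hz
    rcases Set.mem_insert_iff.1 hz with rfl | hz
    · exact ih fun a b hab => h a (b + 1) (by omega)
    · refine ih fun a b hab => ?_
      have := h (a + 1) b (by omega) z hz
      rwa [Function.Commute.iterate_right (f := fwdDiff z) (g := fwdDiff e)
        (fun f => fwdDiff_comm z e f) b f] at this

end DiffBd

variable [TopologicalSpace B]

/-- The `n`-fold differences of `f` decay like `C ρ^n`. For functions on `ℤ_p^k` and `ρ < 1` this is
local analyticity. -/
def ExpBd (N : B → ℝ) (C ρ : ℝ) (f : M → B) : Prop :=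
  ∀ n : ℕ, DiffBd N Set.univ n f (C * ρ ^ n)

namespace ExpBd

variable {C C' ρ ρ' : ℝ}

omit [TopologicalSpace B] in
theorem mono (hC : 0 ≤ C) (hρ : 0 ≤ ρ) (h : ExpBd N C ρ f) (hCC : C ≤ C') (hρρ : ρ ≤ ρ') :
    ExpBd N C' ρ' f := fun n => (h n).mono
  (mul_le_mul hCC (pow_le_pow_left₀ hρ hρρ n) (pow_nonneg hρ n) (hC.trans hCC))

theorem nonneg (hN : IsGauge N) (h : ExpBd N C ρ f) : 0 ≤ C := by
  simpa using (h 0).nonneg hN Set.univ_nonempty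

/-- By the Leibniz rule `Δ_z (f g) = Δ_z f · g(· + z) + f · Δ_z g`. -/
theorem mul (hN : IsGauge N) (hf : ExpBd N C ρ f) (hg : ExpBd N C' ρ g) :
    ExpBd N (C * C') ρ (f * g) := by
  intro n
  induction n generalizing f g C C' with
  | zero =>
    intro y
    have h1 := hf 0 y
    have h2 := hg 0 y
    rw [pow_zero, mul_one] at h1 h2 ⊢
    exact (hN.mul_le _ _).trans (mul_le_mul h1 h2 (hN.nonneg _) (hf.nonneg hN))
  | succ n ih =>
    intro z _
    rw [fwdDiff_mul]
    have hstep : ∀ {h : M → B} {D : ℝ}, ExpBd N D ρ h → ExpBd N (D * ρ) ρ (fwdDiff z h) := by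
      intro h D hh m
      have := hh (m + 1) z trivial
      rwa [pow_succ', ← mul_assoc] at this
    have h1 := ih (hstep hf) (fun m => (hg m).translate z)
    have h2 := ih hf (hstep hg)
    refine DiffBd.add hN (h1.mono (le_of_eq ?_)) (h2.mono (le_of_eq ?_)) <;> ring

theorem const (hN : IsGauge N) (hρ : 0 ≤ ρ) (a : B) (ha : N a ≤ C) :
    ExpBd N C ρ (fun _ : M => a) := by
  have hC : 0 ≤ C := (hN.nonneg a).trans ha
  intro n
  cases n with
  | zero =>
    intro y
    simpa using ha
  | succ n =>
    intro z _
    rw [fwdDiff_const]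
    exact DiffBd.zero hN (by positivity)

end ExpBd

/-! ### Gluing: differences with large steps -/

/-- If `p` divides the inner binomial coefficients of `q`, then `Δ_e^q ≡ Δ_{qe}` modulo `p`. So
exponential decay of the differences with steps in a set `Z` containing `q e`, jointly with
multiplications by `p`, implies the same with steps in `Z ∪ {e}`. -/
theorem DiffBd.insert_of_nsmul_mem (hN : IsGauge N) {p q : ℕ} (hq : 0 < q)
    (hpq : ∀ i, 0 < i → i < q → p ∣ q.choose i) {e : M} (he : q • e ∈ Z) {C ρ : ℝ}
    (hC : 0 ≤ C) (hρ : 0 < ρ) (hρ1 : ρ ≤ 1)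
    (h : ∀ a l : ℕ, DiffBd N Z a (p ^ l • f) (C * ρ ^ (a + l))) (b a l : ℕ) :
    DiffBd N Z a (p ^ l • (fwdDiff e)^[b] f) (C * ρ ^ (a + l + b / q)) := by
  induction b using Nat.strong_induction_on generalizing a l with
  | _ b ih =>
  rcases lt_or_ge b q with hb | hb
  · rw [Nat.div_eq_of_lt hb, add_zero, ← fwdDiff_iter_const_smul]
    exact (h a l).diff_iterate hN e b
  obtain ⟨b', rfl⟩ := Nat.exists_eq_add_of_le' hb
  rw [Nat.add_div_right _ hq]
  -- Newton's formula expresses `Δ_{qe}` through the powers `Δ_e^i`, `1 ≤ i ≤ q`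
  set g := (fwdDiff e)^[b'] f with hg
  have hiter : ∀ i, (fwdDiff e)^[i] g = (fwdDiff e)^[b' + i] f := fun i => by
    rw [hg, ← Function.iterate_add_apply, add_comm]
  have hdecomp : (fwdDiff e)^[b' + q] f =
      fwdDiff (q • e) g - ∑ i ∈ Finset.Ico 1 q, q.choose i • (fwdDiff e)^[i] g := by
    rw [← hiter]
    funext y
    have h1 := shift_eq_sum_fwdDiff_iter e g q y
    rw [Finset.sum_range_succ, Finset.range_eq_Ico, Finset.sum_eq_sum_Ico_succ_bot hq] at h1
    simp only [Nat.choose_zero_right, Function.iterate_zero, id_eq, one_smul, zero_add,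
      Nat.choose_self] at h1
    simp only [Pi.sub_apply, Finset.sum_apply, Pi.smul_apply]
    change _ = (g (y + q • e) - g y) - _
    rw [h1]
    abel
  rw [hdecomp, smul_sub, Finset.smul_sum]
  refine DiffBd.sub hN ?_ (DiffBd.sum hN (by positivity) fun i hi => ?_)
  · have h1 := ih b' (by omega) (a + 1) l (q • e) he
    rw [fwdDiff_const_smul] at h1
    convert h1 using 2
    ring
  · obtain ⟨hi1, hi2⟩ := Finset.mem_Ico.1 hi
    obtain ⟨m, hm⟩ := hpq i hi1 hi2
    have h1 := ih (b' + i) (by omega) a (l + 1)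
    rw [hm, hiter, ← mul_smul, ← mul_assoc, ← pow_succ, mul_comm, mul_smul]
    refine (h1.map (d := C * ρ ^ (a + l + (b' / q + 1))) (nsmulAddMonoidHom m) fun x hx =>
      (hN.nsmul_le m x).trans (hx.trans ?_))
    refine mul_le_mul_of_nonneg_left (pow_le_pow_of_le_one hρ.le hρ1 ?_) hC
    have : b' / q ≤ (b' + i) / q := Nat.div_le_div_right (by omega)
    omega

/-- Exponential decay for steps in `Z ∋ q e` implies it for steps in `Z ∪ {e}`, with constants that
depend linearly on the given one. Since one factor `ρ` is gained only for `q` differences along `e`,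
the new rate is `ρ^(1/q)`. -/
theorem DiffBd.exists_insert (hN : IsGauge N) {p q : ℕ} (hq : 0 < q)
    (hpq : ∀ i, 0 < i → i < q → p ∣ q.choose i) (Z : Set M) (e : M) (he : q • e ∈ Z) {ρ : ℝ}
    (hρ : 0 < ρ) (hρ1 : ρ < 1) :
    ∃ K ρ' : ℝ, 0 < K ∧ 0 < ρ' ∧ ρ' < 1 ∧ ∀ (C : ℝ) (f : M → B), 0 ≤ C →
      (∀ a l : ℕ, DiffBd N Z a (p ^ l • f) (C * ρ ^ (a + l))) →
      ∀ a l : ℕ, DiffBd N (Insert.insert e Z) a (p ^ l • f) (K * C * ρ' ^ (a + l)) := by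
  set ρ' : ℝ := ρ ^ ((q : ℝ)⁻¹) with hρ'
  have hρ'0 : 0 < ρ' := Real.rpow_pos_of_pos hρ _
  have hq' : (0 : ℝ) < q := by exact_mod_cast hq
  have hρ'1 : ρ' < 1 := Real.rpow_lt_one hρ.le hρ1 (by positivity)
  have hρq : ρ' ^ q = ρ := by
    rw [hρ', ← Real.rpow_natCast, ← Real.rpow_mul hρ.le, inv_mul_cancel₀ hq'.ne', Real.rpow_one]
  refine ⟨ρ⁻¹, ρ', by positivity, hρ'0, hρ'1, fun C f hC h n l => DiffBd.insert fun a b hab => ?_⟩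
  rw [fwdDiff_iter_const_smul]
  refine (DiffBd.insert_of_nsmul_mem hN hq hpq he hC hρ hρ1.le h b a l).mono ?_
  have h1 : ρ ^ (a + l) ≤ ρ' ^ (a + l) := by
    refine pow_le_pow_left₀ hρ.le ?_ _
    rw [← hρq]
    exact pow_le_of_le_one hρ'0.le hρ'1.le hq.ne'
  have h2 : ρ * ρ ^ (b / q) ≤ ρ' ^ b := by
    rw [← hρq, ← pow_mul, ← pow_add]
    refine pow_le_pow_of_le_one hρ'0.le hρ'1.le ?_
    have := Nat.lt_mul_div_succ b hq
    rw [mul_add, mul_one] at this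
    omega
  calc C * ρ ^ (a + l + b / q) = ρ⁻¹ * C * (ρ ^ (a + l) * (ρ * ρ ^ (b / q))) := by
        rw [pow_add]
        field_simp
    _ ≤ ρ⁻¹ * C * (ρ' ^ (a + l) * ρ' ^ b) := by gcongr
    _ = ρ⁻¹ * C * ρ' ^ (n + l) := by
        rw [← pow_add, ← hab]
        congr 2
        omega

end DiffBd

section ZpPower

variable {p : ℕ} [Fact p.Prime] {k : ℕ}
variable {B : Type*} [CommRing B] [TopologicalSpace B] [IsTopologicalRing B] [Algebra ℤ_[p] B]
  [ContinuousSMul ℤ_[p] B] {N : B → ℝ}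

/-- The standard basis vectors topologically generate `ℤ_p^k`. -/
theorem closure_single_eq_univ (p : ℕ) [Fact p.Prime] (k : ℕ) :
    closure (AddSubgroup.closure (Set.range fun i : Fin k => (Pi.single i 1 : Fin k → ℤ_[p])) :
      Set (Fin k → ℤ_[p])) = Set.univ := by
  have h : DenseRange (Pi.map fun (_ : Fin k) (n : ℕ) => (n : ℤ_[p])) :=
    DenseRange.piMap fun _ => PadicInt.denseRange_natCast
  refine Set.eq_univ_of_univ_subset ?_
  rw [← h.closure_range]
  refine closure_mono ?_
  rintro _ ⟨n, rfl⟩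
  have : Pi.map (fun (_ : Fin k) (n : ℕ) => (n : ℤ_[p])) n =
      ∑ i, n i • (Pi.single i 1 : Fin k → ℤ_[p]) := by
    funext j
    simp [Finset.sum_apply, Pi.single_apply]
  rw [this]
  exact sum_mem fun i _ => nsmul_mem (AddSubgroup.subset_closure (Set.mem_range_self i)) (n i)

/-- Exponential decay of the differences with steps in `p^m ℤ_p^k` implies exponential decay of all
differences. The basis vectors are added to the set of steps one after the other; together they
generate `ℤ_p^k` topologically. -/
theorem exists_expBd_of_steps (hN : IsGauge N) (k m : ℕ) {ρ : ℝ} (hρ : 0 < ρ) (hρ1 : ρ < 1) :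
    ∃ K ρ' : ℝ, 0 < K ∧ 0 < ρ' ∧ ρ' < 1 ∧ ∀ (C : ℝ) (f : (Fin k → ℤ_[p]) → B), 0 ≤ C →
      Continuous f →
      (∀ a : ℕ, DiffBd N (Set.range fun z : Fin k → ℤ_[p] => p ^ m • z) a f (C * ρ ^ a)) →
      ExpBd N (K * C) ρ' f := by
  classical
  obtain ⟨C₁, b, hC₁, hb0, hb1, hp⟩ := hN.exists_p_pow_smul_le (p := p) (B := B)
  set Z₀ : Set (Fin k → ℤ_[p]) := Set.range fun z : Fin k → ℤ_[p] => p ^ m • z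
  let e : Fin k → Fin k → ℤ_[p] := fun i => Pi.single i 1
  have key : ∀ S : Finset (Fin k), ∀ σ : ℝ, 0 < σ → σ < 1 →
      ∃ K ρ' : ℝ, 0 < K ∧ 0 < ρ' ∧ ρ' < 1 ∧ ∀ (C : ℝ) (f : (Fin k → ℤ_[p]) → B), 0 ≤ C →
      (∀ a l : ℕ, DiffBd N Z₀ a (p ^ l • f) (C * σ ^ (a + l))) →
      ∀ a l : ℕ, DiffBd N (Z₀ ∪ e '' S) a (p ^ l • f) (K * C * ρ' ^ (a + l)) := by
    intro S
    induction S using Finset.induction_on with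
    | empty =>
      intro σ hσ hσ1
      exact ⟨1, σ, one_pos, hσ, hσ1, fun C f _ h => by simpa using h⟩
    | insert i S _ ih =>
      intro σ hσ hσ1
      obtain ⟨K, ρ', hK, hρ', hρ'1, h⟩ := ih σ hσ hσ1
      obtain ⟨K', ρ'', hK', hρ'', hρ''1, h'⟩ := DiffBd.exists_insert (M := Fin k → ℤ_[p]) hN
        (p := p) (q := p ^ m)
        (pow_pos (Fact.out : p.Prime).pos m)
        (fun j hj0 hj => (Fact.out : p.Prime).dvd_choose_pow hj0.ne' hj.ne)
        (Z₀ ∪ e '' S) (e i) (Or.inl ⟨e i, rfl⟩) hρ' hρ'1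
      refine ⟨K' * K, ρ'', by positivity, hρ'', hρ''1, fun C f hC hf => ?_⟩
      have := h' (K * C) f (by positivity) (h C f hC hf)
      rw [Finset.coe_insert, Set.image_insert_eq, Set.union_insert]
      simpa only [mul_assoc] using this
  obtain ⟨K, ρ', hK, hρ', hρ'1, h⟩ := key Finset.univ (max ρ b) (lt_max_of_lt_left hρ)
    (max_lt hρ1 hb1)
  refine ⟨K * C₁, ρ', by positivity, hρ', hρ'1, fun C f hC hcont hf n => ?_⟩
  have h1 := h (C₁ * C) f (by positivity) (fun a l => by
    refine (hf a).map (nsmulAddMonoidHom (p ^ l)) fun x hx => ?_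
    have h2 := hp l x
    have h3 : ((p : ℤ_[p]) ^ l) • x = p ^ l • x := by
      rw [← Nat.cast_pow, Nat.cast_smul_eq_nsmul]
    rw [h3] at h2
    refine h2.trans ?_
    calc C₁ * b ^ l * N x ≤ C₁ * (max ρ b) ^ l * (C * (max ρ b) ^ a) := by
          have h4 : b ≤ max ρ b := le_max_right _ _
          have h5 : N x ≤ C * (max ρ b) ^ a := hx.trans (by
            have : ρ ≤ max ρ b := le_max_left _ _
            gcongr)
          have h6 := hN.nonneg x
          gcongr
      _ = C₁ * C * max ρ b ^ (a + l) := by ring) n 0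
  rw [pow_zero, one_smul, add_zero] at h1
  have h2 := (h1.mono_set (Z' := Set.range e) (by simp)).closure hN (by positivity) hcont
  rw [closure_single_eq_univ p k, ← mul_assoc] at h2
  exact h2

omit [TopologicalSpace B] [IsTopologicalRing B] [Algebra ℤ_[p] B] [ContinuousSMul ℤ_[p] B] in
/-- Bounds on all balls of radius `p^{-m}` are bounds for steps in `p^m ℤ_p^k`. -/
theorem diffBd_steps_of_balls {m n : ℕ} {c : ℝ} {f : (Fin k → ℤ_[p]) → B}
    (h : ∀ a, DiffBd N Set.univ n (fun z => f (a + p ^ m • z)) c) :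
    DiffBd N (Set.range fun z : Fin k → ℤ_[p] => p ^ m • z) n f c := by
  induction n generalizing f with
  | zero =>
    intro y
    simpa using h y 0
  | succ n ih =>
    rintro _ ⟨z, rfl⟩
    refine ih fun a => ?_
    have := h a z trivial
    convert this using 1
    funext w
    simp [fwdDiff, add_assoc]

end ZpPower

/-! ### The augmentation ideal and iterated differences -/

section Act

variable {p : ℕ} [Fact p.Prime] {k : ℕ}
variable {A : Type v} [CommRing A] [UniformSpace A] [IsUniformAddGroup A] [CompleteSpace A]
  [T2Space A] [IsTateRing A] [Algebra ℤ_[p] A] [ContinuousSMul ℤ_[p] A]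

theorem act_add_left (δ δ' : completedGroupRing p k) {f : (Fin k → ℤ_[p]) → A}
    (hf : Continuous f) (y : Fin k → ℤ_[p]) : act (δ + δ') f y = act δ f y + act δ' f y := by
  refine tendsto_nhds_unique (tendsto_act _ hf y) ?_
  have h : actApprox (δ + δ') f y = fun n => actApprox δ f y n + actApprox δ' f y n := by
    funext n
    simp only [actApprox, Subring.coe_add, Pi.add_apply, AddMonoidAlgebra.coeff_add]
    exact Finsupp.sum_add_index' (by simp) (by simp [add_smul])
  rw [h]
  exact (tendsto_act δ hf y).add (tendsto_act δ' hf y)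

theorem act_zero_left {f : (Fin k → ℤ_[p]) → A} (hf : Continuous f) (y : Fin k → ℤ_[p]) :
    act (0 : completedGroupRing p k) f y = 0 := by
  have h := act_add_left 0 0 hf y
  rw [add_zero] at h
  exact left_eq_add.1 h

theorem act_sub_left (δ δ' : completedGroupRing p k) {f : (Fin k → ℤ_[p]) → A}
    (hf : Continuous f) (y : Fin k → ℤ_[p]) : act (δ - δ') f y = act δ f y - act δ' f y := by
  rw [eq_sub_iff_add_eq, ← act_add_left _ _ hf, sub_add_cancel]

/-- At finite level the two sides differ only in the choice of lifts of residue classes, which does not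
matter in the limit. -/
theorem act_mul_groupLike (δ : completedGroupRing p k) (z : Fin k → ℤ_[p])
    {f : (Fin k → ℤ_[p]) → A} (hf : Continuous f) (y : Fin k → ℤ_[p]) :
    act (δ * groupLike p k z) f y = act δ (fun y => f (y + z)) y := by
  have hf' : Continuous fun y => f (y + z) := by fun_prop
  refine tendsto_nhds_unique (tendsto_act _ hf y) ?_
  suffices h : Tendsto (fun n => actApprox (δ * groupLike p k z) f y n -
      actApprox δ (fun y => f (y + z)) y n) atTop (𝓝 0) by
    simpa using h.add (tendsto_act δ hf' y)
  intro U hU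
  obtain ⟨V, hVo, hVU, hVs⟩ := exists_stable_subgroup (p := p) hU
  obtain ⟨N, hN⟩ := exists_reduce_eq_imp_sub_mem hf (hVo.mem_nhds V.zero_mem)
  refine Filter.mem_map.2 (Filter.mem_atTop_sets.2 ⟨N, fun n hn => hVU ?_⟩)
  have key : ∀ x : AddMonoidAlgebra ℤ_[p] (Fin k → ZMod (p ^ n)),
      (x * AddMonoidAlgebra.single (reduce p k n z) 1).coeff.sum
        (fun c a => a • f (y + lift p k n c)) =
      x.coeff.sum fun c a => a • f (y + lift p k n (c + reduce p k n z)) := by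
    intro x
    induction x using AddMonoidAlgebra.induction_linear with
    | zero => simp
    | add x x' hx hx' =>
      rw [add_mul, AddMonoidAlgebra.coeff_add, AddMonoidAlgebra.coeff_add,
        Finsupp.sum_add_index' (by simp) (by simp [add_smul]), hx, hx',
        Finsupp.sum_add_index' (by simp) (by simp [add_smul])]
    | single m r => simp
  change actApprox (δ * groupLike p k z) f y n - actApprox δ (fun y => f (y + z)) y n ∈ V
  have h1 : actApprox (δ * groupLike p k z) f y n = _ := key (δ.1 n)
  rw [h1]
  unfold actApprox
  rw [← Finsupp.sum_sub]
  refine V.sum_mem fun c _ => ?_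
  change _ • _ - _ • _ ∈ V
  rw [← smul_sub]
  refine hVs _ _ (hN n hn _ _ ?_)
  have h2 := reduce_lift n (c + reduce p k n z)
  have h3 := reduce_lift n c
  funext i
  have h4 := congrFun h2 i
  have h5 := congrFun h3 i
  simp only [reduce, Pi.add_apply, map_add] at h4 h5 ⊢
  rw [h4, h5, add_assoc]

theorem act_mul_sub (δ : completedGroupRing p k) (z : Fin k → ℤ_[p])
    {f : (Fin k → ℤ_[p]) → A} (hf : Continuous f) (y : Fin k → ℤ_[p]) :
    act (δ * (groupLike p k z - groupLike p k 0)) f y = act δ (fwdDiff z f) y := by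
  have h1 : Continuous fun y => f (y + z) := by fun_prop
  rw [mul_sub, act_sub_left _ _ hf, act_mul_groupLike _ _ hf, act_mul_groupLike _ _ hf]
  simp only [add_zero]
  rw [sub_eq_iff_eq_add]
  have h2 : Continuous (fwdDiff z f) := by
    unfold fwdDiff
    fun_prop
  rw [← act_add _ h2 hf]
  congr 1
  funext y
  simp [fwdDiff]

variable {N : A → ℝ}

/-- The action of `I_Δ^n` is controlled by the `n`-fold differences, and conversely. -/
theorem forall_augIdeal_pow_iff (hN : IsGauge N) {n : ℕ} {c : ℝ} (hc : 0 ≤ c)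
    {f : (Fin k → ℤ_[p]) → A} (hf : Continuous f) :
    (∀ δ ∈ augIdeal p k ^ n, ∀ y, N (act δ f y) ≤ c) ↔ DiffBd N Set.univ n f c := by
  have hcont : ∀ (z : Fin k → ℤ_[p]) {f : (Fin k → ℤ_[p]) → A}, Continuous f →
      Continuous (fwdDiff z f) := fun z f hf => by
    unfold fwdDiff
    fun_prop
  constructor
  · intro h
    induction n generalizing f with
    | zero =>
      intro y
      have := h (groupLike p k 0) (by simp) y
      rwa [act_groupLike _ hf, add_zero] at this
    | succ n ih =>
      intro z _
      refine ih (hcont z hf) fun δ hδ y => ?_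
      rw [← act_mul_sub _ _ hf]
      refine h _ ?_ y
      rw [pow_succ]
      exact Ideal.mul_mem_mul hδ (Ideal.subset_span ⟨z, rfl⟩)
  · intro h
    induction n generalizing f with
    | zero =>
      intro δ _ y
      refine (hN.isClosed_le c).mem_of_tendsto (tendsto_act δ hf y) (Eventually.of_forall fun n => ?_)
      exact hN.sum_le _ _ hc fun i _ => (hN.padicInt_smul_le _ _).trans (h _)
    | succ n ih =>
      intro δ hδ
      rw [pow_succ] at hδ
      refine Submodule.mul_induction_on hδ ?_ ?_
      · intro a ha b hb
        induction hb using Submodule.span_induction generalizing a with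
        | mem x hx =>
          obtain ⟨z, rfl⟩ := hx
          intro y
          simp only
          rw [act_mul_sub _ _ hf]
          exact ih (hcont z hf) (h z trivial) a ha y
        | zero =>
          intro y
          rw [mul_zero, act_zero_left hf, hN.map_zero]
          exact hc
        | add x x' _ _ hx hx' =>
          intro y
          rw [mul_add, act_add_left _ _ hf]
          exact (hN.add_le _ _).trans (max_le (hx a ha y) (hx' a ha y))
        | smul l x _ hx =>
          intro y
          rw [smul_eq_mul, ← mul_assoc]
          exact hx _ (Ideal.mul_mem_right _ _ ha) y
      · intro a b ha hb y
        rw [act_add_left _ _ hf]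
        exact (hN.add_le _ _).trans (max_le (ha y) (hb y))

/-! ### Radii -/

theorem zpow_floor_neg (α : Aˣ) {r : ℝ} (hr : 0 < r) (n : ℕ) :
    α ^ ⌊-(r * n)⌋ = α⁻¹ ^ ⌈r * n⌉₊ := by
  rw [Int.floor_neg, ← Int.natCast_ceil_eq_ceil (a := r * n) (by positivity), zpow_neg,
    zpow_natCast, inv_pow]

/-- Multiplication by `α ^ ⌊-r n⌋` enlarges at least by a factor `(b ^ r) ^ (-n)`, up to a constant. -/
theorem exists_le_of_unit (hN : IsGauge N) {α : Aˣ} (hα : IsTopologicallyNilpotent (α : A)) :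
    ∃ C b : ℝ, 1 ≤ C ∧ 0 < b ∧ b < 1 ∧ ∀ (r : ℝ), 0 < r → ∀ (n : ℕ) (x : A),
      N x ≤ C * (b ^ r) ^ n * N (((α ^ ⌊-(r * n)⌋ : Aˣ) : A) * x) := by
  obtain ⟨C, b, hC, hb0, hb1, h⟩ := hN.exists_pow_le hα
  refine ⟨C, b, hC, hb0, hb1, fun r hr n x => ?_⟩
  rw [zpow_floor_neg α hr]
  set e := ⌈r * n⌉₊
  have h1 : x = (α : A) ^ e * (((α⁻¹ ^ e : Aˣ) : A) * x) := by
    rw [← mul_assoc, ← Units.val_pow_eq_pow_val, ← Units.val_mul, ← mul_pow]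
    simp
  have h2 : b ^ e ≤ (b ^ r) ^ n := by
    rw [← Real.rpow_natCast, ← Real.rpow_natCast, ← Real.rpow_mul hb0.le]
    exact Real.rpow_le_rpow_of_exponent_ge hb0 hb1.le (Nat.le_ceil _)
  have h3 := hN.nonneg (((α⁻¹ ^ e : Aˣ) : A) * x)
  calc N x = N ((α : A) ^ e * (((α⁻¹ ^ e : Aˣ) : A) * x)) := by rw [← h1]
    _ ≤ N ((α : A) ^ e) * N (((α⁻¹ ^ e : Aˣ) : A) * x) := hN.mul_le _ _
    _ ≤ C * b ^ e * N (((α⁻¹ ^ e : Aˣ) : A) * x) := by gcongr; exact h e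
    _ ≤ _ := by gcongr

/-- Multiplication by `α ^ ⌊-r n⌋` enlarges at most by a factor `(b ^ r) ^ n`, up to a constant. -/
theorem exists_unit_le (hN : IsGauge N) (α : Aˣ) :
    ∃ D b : ℝ, 0 < D ∧ 1 < b ∧ ∀ (r : ℝ), 0 < r → ∀ (n : ℕ) (x : A),
      N (((α ^ ⌊-(r * n)⌋ : Aˣ) : A) * x) ≤ D * (b ^ r) ^ n * N x := by
  set b : ℝ := max (N ((α⁻¹ : Aˣ) : A)) 2
  have hb : 2 ≤ b := le_max_right _ _
  have hD : 1 ≤ max (N 1) 1 := le_max_right _ _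
  refine ⟨max (N 1) 1 * b, b, by positivity, by linarith, fun r hr n x => ?_⟩
  rw [zpow_floor_neg α hr, Units.val_pow_eq_pow_val]
  set e := ⌈r * n⌉₊ with he
  have h2 : b ^ e ≤ b * (b ^ r) ^ n := by
    have h3 : (e : ℝ) ≤ r * n + 1 := (Nat.ceil_lt_add_one (by positivity)).le
    calc b ^ e = b ^ (e : ℝ) := (Real.rpow_natCast _ _).symm
      _ ≤ b ^ (r * n + 1) := Real.rpow_le_rpow_of_exponent_le (by linarith) h3
      _ = b * (b ^ r) ^ n := by
        rw [Real.rpow_add (by linarith), Real.rpow_one, Real.rpow_mul (by linarith),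
          Real.rpow_natCast, mul_comm]
  have h4 := hN.nonneg x
  have h5 := hN.nonneg ((α⁻¹ : Aˣ) : A)
  calc N (((α⁻¹ : Aˣ) : A) ^ e * x) ≤ N (((α⁻¹ : Aˣ) : A) ^ e) * N x := hN.mul_le _ _
    _ ≤ max (N 1) 1 * N ((α⁻¹ : Aˣ) : A) ^ e * N x := by gcongr; exact hN.pow_le _ _
    _ ≤ max (N 1) 1 * b ^ e * N x := by gcongr; exact le_max_left _ _
    _ ≤ max (N 1) 1 * (b * (b ^ r) ^ n) * N x := by gcongr
    _ = _ := by ring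

/-- Functions of radius `r` have exponentially decaying differences, with a rate that depends only
on `r` and constants that are controlled by the topology of `𝒜^(α,r)`. -/
theorem exists_expBd_of_radFun (hN : IsGauge N) {α : Aˣ} (hα : IsTopologicallyNilpotent (α : A))
    {r : ℝ} (hr : 0 < r) : ∃ K ρ : ℝ, 0 < K ∧ 0 < ρ ∧ ρ < 1 ∧
      (∀ f ∈ radFun (A := A) p k α r, ∃ C, ExpBd N C ρ f) ∧
      ∀ ε > 0, ∀ f ∈ radNhd p k α r {a : A | N a < ε}, ExpBd N (K * ε) ρ f.1 := by
  obtain ⟨C, b, hC, hb0, hb1, h⟩ := exists_le_of_unit hN hα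
  have hρ : 0 < b ^ r := Real.rpow_pos_of_pos hb0 _
  refine ⟨C, b ^ r, by linarith, hρ, Real.rpow_lt_one hb0.le hb1 hr, ?_, ?_⟩
  · rintro f ⟨hf, hf'⟩
    obtain ⟨n₀, hn₀⟩ := hf' _ (hN.mem_nhds 1 one_pos)
    obtain ⟨D, hD0, hD⟩ := hN.exists_bound hf
    refine ⟨max C (D * ((b ^ r) ^ n₀)⁻¹), fun n => ?_⟩
    rcases le_or_gt n n₀ with hn | hn
    · -- for small `n` the sup norm is enough, with a large constant
      have h1 : DiffBd N Set.univ n f D := DiffBd.of_le hN (Nat.zero_le n) hD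
      refine h1.mono ?_
      have h2 : (b ^ r) ^ n₀ ≤ (b ^ r) ^ n :=
        pow_le_pow_of_le_one hρ.le (Real.rpow_le_one hb0.le hb1.le hr.le) hn
      calc D = D * ((b ^ r) ^ n₀)⁻¹ * (b ^ r) ^ n₀ := by field_simp
        _ ≤ D * ((b ^ r) ^ n₀)⁻¹ * (b ^ r) ^ n := by gcongr
        _ ≤ _ := by gcongr; exact le_max_right _ _
    · refine (forall_augIdeal_pow_iff hN (by positivity) hf).1 fun δ hδ y => ?_
      refine (h r hr n _).trans ?_
      have h1 : N (((α ^ ⌊-(r * n)⌋ : Aˣ) : A) * act δ f y) ≤ 1 := le_of_lt (hn₀ n hn δ hδ y)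
      calc _ ≤ C * (b ^ r) ^ n * 1 := by gcongr
        _ ≤ _ := by
          rw [mul_one]
          gcongr
          exact le_max_left _ _
  · intro ε hε f hf n
    refine (forall_augIdeal_pow_iff hN (by positivity) f.2.1).1 fun δ hδ y => ?_
    refine (h r hr n _).trans ?_
    have h1 : N (((α ^ ⌊-(r * n)⌋ : Aˣ) : A) * act δ f.1 y) ≤ ε := (hf n δ hδ y).le
    calc _ ≤ C * (b ^ r) ^ n * ε := by gcongr
      _ = _ := by ring

/-- Functions with exponentially decaying differences belong to some `𝒜^(α,r)`, where `r` depends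
only on the rate, with control of the topology. -/
theorem exists_radius (hN : IsGauge N) (α : Aˣ) {ρ : ℝ} (hρ : 0 < ρ) (hρ1 : ρ < 1) :
    ∃ r K : ℝ, 0 < r ∧ 0 < K ∧
      (∀ (C : ℝ) (f : (Fin k → ℤ_[p]) → A), Continuous f → ExpBd N C ρ f → f ∈ radFun p k α r) ∧
      ∀ (C ε : ℝ) (f : RadFun (A := A) p k α r), K * C < ε → ExpBd N C ρ f.1 →
        f ∈ radNhd p k α r {a : A | N a < ε} := by
  obtain ⟨D, b, hD, hb, h⟩ := exists_unit_le hN α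
  -- half of the decay compensates the growth of `α ^ ⌊-r n⌋`, the other half tends to zero
  set σ := √ρ with hσ
  have hσ0 : 0 < σ := Real.sqrt_pos.2 hρ
  have hσ1 : σ < 1 := by
    rw [hσ, Real.sqrt_lt' one_pos]
    simpa using hρ1
  have hσσ : σ * σ = ρ := Real.mul_self_sqrt hρ.le
  set r := Real.logb b σ⁻¹ with hr
  have hr0 : 0 < r := Real.logb_pos hb (one_lt_inv₀ hσ0 |>.2 hσ1)
  have hbr : b ^ r = σ⁻¹ := Real.rpow_logb (by linarith) hb.ne' (by positivity)
  have key : ∀ (C : ℝ) (f : (Fin k → ℤ_[p]) → A), Continuous f → ExpBd N C ρ f → ∀ n : ℕ,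
      ∀ δ ∈ augIdeal p k ^ n, ∀ y, N (((α ^ ⌊-(r * n)⌋ : Aˣ) : A) * act δ f y) ≤
        D * C * σ ^ n := by
    intro C f hf hC n δ hδ y
    have hC0 := hC.nonneg hN
    have h1 := (forall_augIdeal_pow_iff hN (by positivity) hf).2 (hC n) δ hδ y
    refine (h r hr0 n _).trans ?_
    rw [hbr]
    calc D * σ⁻¹ ^ n * N (act δ f y) ≤ D * σ⁻¹ ^ n * (C * ρ ^ n) := by gcongr
      _ = D * C * (σ⁻¹ * (σ * σ)) ^ n := by rw [hσσ, mul_pow]; ring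
      _ = _ := by rw [inv_mul_cancel_left₀ hσ0.ne']
  refine ⟨r, D, hr0, hD, fun C f hf hC => ⟨hf, fun U hU => ?_⟩, fun C ε f hε hC n δ hδ y => ?_⟩
  · obtain ⟨ε, hε, hεU⟩ := hN.exists_lt U hU
    have h1 : Tendsto (fun n : ℕ => D * C * σ ^ n) atTop (𝓝 0) := by
      simpa using (tendsto_pow_atTop_nhds_zero_of_lt_one hσ0.le hσ1).const_mul (D * C)
    obtain ⟨n₀, hn₀⟩ := eventually_atTop.1 (h1.eventually_lt_const hε)
    exact ⟨n₀, fun n hn δ hδ y => hεU _ ((key C f hf hC n δ hδ y).trans_lt (hn₀ n hn.le))⟩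
  · refine (key C f.1 f.2.1 hC n δ hδ y).trans_lt (lt_of_le_of_lt ?_ hε)
    have := hC.nonneg hN
    exact mul_le_of_le_one_right (by positivity) (pow_le_one₀ hσ0.le hσ1.le)

/-- `𝒜(ℤ_p^k, A)` consists of the continuous functions with exponentially decaying differences; in
particular it does not depend on the topologically nilpotent unit. -/
theorem mem_zpFun_iff (hN : IsGauge N) {α : Aˣ} (hα : IsTopologicallyNilpotent (α : A))
    {f : (Fin k → ℤ_[p]) → A} : f ∈ zpFun p k α ↔
      Continuous f ∧ ∃ C ρ : ℝ, 0 < ρ ∧ ρ < 1 ∧ ExpBd N C ρ f := by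
  constructor
  · intro hf
    refine Submodule.iSup_induction (fun r : Set.Ioi (0 : ℝ) => radFun p k α r)
      (motive := fun f => Continuous f ∧ ∃ C ρ : ℝ, 0 < ρ ∧ ρ < 1 ∧ ExpBd N C ρ f) hf ?_ ?_ ?_
    · intro r f hf
      obtain ⟨-, ρ, -, hρ, hρ1, h, -⟩ := exists_expBd_of_radFun (p := p) (k := k) hN hα r.2
      obtain ⟨C, hC⟩ := h f hf
      exact ⟨hf.1, C, ρ, hρ, hρ1, hC⟩
    · exact ⟨continuous_const, 0, 1 / 2, by norm_num, by norm_num, fun n => by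
        rw [zero_mul]
        exact DiffBd.zero hN le_rfl⟩
    · rintro f g ⟨hf, C, ρ, hρ, hρ1, hfC⟩ ⟨hg, C', ρ', hρ', hρ'1, hgC⟩
      refine ⟨hf.add hg, max C C', max ρ ρ', lt_max_of_lt_left hρ, max_lt hρ1 hρ'1, fun n => ?_⟩
      exact (hfC.mono (hfC.nonneg hN) hρ.le (le_max_left _ _) (le_max_left _ _) n).add hN
        (hgC.mono (hgC.nonneg hN) hρ'.le (le_max_right _ _) (le_max_right _ _) n)
  · rintro ⟨hf, C, ρ, hρ, hρ1, h⟩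
    obtain ⟨r, K, hr, -, h1, -⟩ := exists_radius (p := p) (k := k) hN α hρ hρ1
    exact radFun_le_zpFun p k α hr (h1 C f hf h)

end Act

/-! ### Newton expansions and composition -/

section Newton

variable {M : Type*} [AddCommGroup M] {B : Type*} [CommRing B]

/-- The action of the group ring `ℤ[M]` on functions on `M` by translations. -/
def translationHom (M B : Type*) [AddCommGroup M] [CommRing B] :
    AddMonoidAlgebra ℤ M →ₐ[ℤ] Module.End ℤ (M → B) :=
  AddMonoidAlgebra.lift ℤ _ M
    { toFun := fun z => LinearMap.funLeft ℤ B fun y => y + z.toAdd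
      map_one' := by
        ext f y
        simp [LinearMap.funLeft]
      map_mul' := fun z w => by
        ext f y
        simp [LinearMap.funLeft, add_assoc, add_comm z.toAdd] }

theorem translationHom_single (z : M) (f : M → B) (y : M) :
    translationHom M B (AddMonoidAlgebra.single z 1) f y = f (y + z) := by
  simp [translationHom, LinearMap.funLeft]

theorem translationHom_single_sub_one (z : M) (f : M → B) :
    translationHom M B (AddMonoidAlgebra.single z 1 - 1) f = fwdDiff z f := by
  funext y
  rw [map_sub, LinearMap.sub_apply, Pi.sub_apply, translationHom_single, map_one]
  rfl

variable {N : B → ℝ} [TopologicalSpace B]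

/-- A product of powers of elements `[e_i] - [0]` acts as an iterated difference. -/
theorem DiffBd.translationHom_prod {ι : Type*} (e : ι → M) (m : ι → ℕ) (S : Finset ι) {n : ℕ}
    {c : ℝ} {f : M → B} (h : DiffBd N Set.univ (∑ i ∈ S, m i + n) f c) :
    DiffBd N Set.univ n (translationHom M B
      (∏ i ∈ S, (AddMonoidAlgebra.single (e i) 1 - 1) ^ m i) f) c := by
  classical
  have hpow : ∀ (z : M) (l n : ℕ) (f : M → B), DiffBd N Set.univ (l + n) f c →
      DiffBd N Set.univ n (translationHom M B ((AddMonoidAlgebra.single z 1 - 1) ^ l) f) c := by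
    intro z l
    induction l with
    | zero =>
      intro n f h
      rw [zero_add] at h
      simpa using h
    | succ l ih =>
      intro n f h
      rw [pow_succ, map_mul, Module.End.mul_apply, translationHom_single_sub_one]
      refine ih n _ ?_
      rw [add_right_comm] at h
      exact h z trivial
  induction S using Finset.induction_on generalizing f with
  | empty => simpa using h
  | insert i S hi ih =>
    rw [Finset.prod_insert hi, mul_comm, map_mul, Module.End.mul_apply]
    refine ih (hpow _ _ _ _ ?_)
    rwa [Finset.sum_insert hi, add_assoc] at h

end Newton

/-- The binomial expansion of `∏ (1 + (x_i - 1)) ^ y_i`. -/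
theorem prod_pow_eq_sum_choose {R ι : Type*} [CommRing R] [Fintype ι] [DecidableEq ι] (x : ι → R)
    (y : ι → ℕ) (L : ℕ) (hy : ∀ i, y i < L) :
    ∏ i, x i ^ y i = ∑ m ∈ Fintype.piFinset fun _ : ι => Finset.range L,
      (∏ i, (y i).choose (m i)) • ∏ i, (x i - 1) ^ m i := by
  have h4 : ∀ i, x i ^ y i = ∑ l ∈ Finset.range L, ((y i).choose l : R) * (x i - 1) ^ l := by
    intro i
    conv_lhs => rw [← sub_add_cancel (x i) 1, add_pow]
    simp only [one_pow, mul_one]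
    rw [Finset.sum_congr rfl fun l _ => mul_comm _ _]
    refine Finset.sum_subset (Finset.range_subset_range.2 (hy i)) fun l _ hl => ?_
    rw [Finset.mem_range, not_lt] at hl
    rw [Nat.choose_eq_zero_of_lt (by omega), Nat.cast_zero, zero_mul]
  rw [Finset.prod_congr rfl fun i _ => h4 i, Finset.prod_univ_sum]
  refine Finset.sum_congr rfl fun m _ => ?_
  rw [Finset.prod_mul_distrib, nsmul_eq_mul, Nat.cast_prod]

theorem single_sum_nsmul {ι M : Type*} [AddCommGroup M] (s : Finset ι) (e : ι → M) (y : ι → ℕ) :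
    (AddMonoidAlgebra.single (∑ i ∈ s, y i • e i) 1 : AddMonoidAlgebra ℤ M) =
      ∏ i ∈ s, AddMonoidAlgebra.single (e i) 1 ^ y i := by
  classical
  induction s using Finset.induction_on with
  | empty => simp [AddMonoidAlgebra.one_def]
  | insert i s hi ih =>
    rw [Finset.sum_insert hi, Finset.prod_insert hi, ← ih, AddMonoidAlgebra.single_pow,
      AddMonoidAlgebra.single_mul_single, one_pow, mul_one]

section Composition

variable {p : ℕ} [Fact p.Prime] {j k : ℕ}
variable {A : Type v} [CommRing A] [TopologicalSpace A] [IsTopologicalRing A]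
  [Algebra ℤ_[p] A] [ContinuousSMul ℤ_[p] A] {N : A → ℝ}

/-- The Newton (Mahler) coefficient of index `m`, that is `(Δ^m f)(0)`. -/
def newtonCoeff (f : (Fin j → ℤ_[p]) → A) (m : Fin j → ℕ) : A :=
  translationHom (Fin j → ℤ_[p]) A
    (∏ i, (AddMonoidAlgebra.single (Pi.single i 1) 1 - 1) ^ m i) f 0

theorem newtonCoeff_le {C ρ : ℝ} {f : (Fin j → ℤ_[p]) → A}
    (hf : ExpBd N C ρ f) (m : Fin j → ℕ) : N (newtonCoeff f m) ≤ C * ρ ^ ∑ i, m i :=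
  DiffBd.translationHom_prod (n := 0) _ m Finset.univ (hf _) 0

/-- The partial sum of the Newton expansion over multi-indices below `L`. -/
def newtonSum (f : (Fin j → ℤ_[p]) → A) (L : ℕ) (y : Fin j → ℤ_[p]) : A :=
  ∑ m ∈ Fintype.piFinset fun _ : Fin j => Finset.range L,
    (∏ i, Ring.choose (y i) (m i)) • newtonCoeff f m

/-- On points with natural coordinates below `L` the Newton expansion is finite and exact. -/
theorem newtonSum_natCast (f : (Fin j → ℤ_[p]) → A) (L : ℕ) (y : Fin j → ℕ)
    (hy : ∀ i, y i < L) : newtonSum f L (fun i => (y i : ℤ_[p])) = f fun i => (y i : ℤ_[p]) := by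
  classical
  let e : Fin j → Fin j → ℤ_[p] := fun i => Pi.single i 1
  have h1 : (fun i => (y i : ℤ_[p])) = ∑ i, y i • e i := by
    funext l
    simp [e, Finset.sum_apply, Pi.single_apply]
  have h2 := (single_sum_nsmul Finset.univ e y).trans
    (prod_pow_eq_sum_choose (fun i => AddMonoidAlgebra.single (e i) (1 : ℤ)) y L hy)
  have h5 : f (∑ i, y i • e i) =
      translationHom _ A (AddMonoidAlgebra.single (∑ i, y i • e i) 1) f 0 := by
    rw [translationHom_single, zero_add]
  rw [h1, h5, h2, map_sum, LinearMap.sum_apply, Finset.sum_apply, ← h1]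
  refine Finset.sum_congr rfl fun m _ => ?_
  rw [map_nsmul, LinearMap.smul_apply, Pi.smul_apply]
  simp only [Ring.choose_natCast]
  rw [← Nat.cast_prod, Nat.cast_smul_eq_nsmul]
  rfl

theorem continuous_newtonSum (f : (Fin j → ℤ_[p]) → A) (L : ℕ) :
    Continuous (newtonSum f L) := by
  unfold newtonSum
  refine continuous_finsetSum _ fun m _ => Continuous.smul ?_ continuous_const
  exact continuous_finsetProd _ fun i _ =>
    (PadicInt.continuous_choose (m i)).comp (continuous_apply i)

/-- The Newton expansion of a function with exponentially decaying differences converges uniformly to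
the function: this holds on the dense subset of points with natural coordinates. -/
theorem newtonSum_sub_le (hN : IsGauge N) {C ρ : ℝ} (hρ : 0 ≤ ρ) (hρ1 : ρ ≤ 1)
    {f : (Fin j → ℤ_[p]) → A} (hcont : Continuous f) (hf : ExpBd N C ρ f) (L : ℕ)
    (y : Fin j → ℤ_[p]) : N (newtonSum f L y - f y) ≤ C * ρ ^ L := by
  classical
  have hC := hf.nonneg hN
  have hcl : IsClosed {y | N (newtonSum f L y - f y) ≤ C * ρ ^ L} :=
    (hN.isClosed_le _).preimage ((continuous_newtonSum f L).sub hcont)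
  have hd : DenseRange (Pi.map fun (_ : Fin j) (n : ℕ) => (n : ℤ_[p])) :=
    DenseRange.piMap fun _ => PadicInt.denseRange_natCast
  suffices h : {y | N (newtonSum f L y - f y) ≤ C * ρ ^ L} = Set.univ from
    (Set.ext_iff.1 h y).2 trivial
  refine Set.eq_univ_of_univ_subset ?_
  rw [← hd.closure_range]
  refine hcl.closure_subset_iff.2 ?_
  rintro _ ⟨n, rfl⟩
  set L' := max L (∑ i, n i + 1) with hL'
  have h1 : newtonSum f L' (fun i => (n i : ℤ_[p])) = f fun i => (n i : ℤ_[p]) := by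
    refine newtonSum_natCast f L' n fun i => ?_
    have := Finset.single_le_sum (f := n) (fun _ _ => Nat.zero_le _) (Finset.mem_univ i)
    omega
  change N (newtonSum f L (fun i => (n i : ℤ_[p])) - f fun i => (n i : ℤ_[p])) ≤ _
  rw [← h1, ← hN.map_neg, neg_sub]
  unfold newtonSum
  have hsub : (Fintype.piFinset fun _ : Fin j => Finset.range L) ⊆
      Fintype.piFinset fun _ : Fin j => Finset.range L' :=
    Fintype.piFinset_subset _ _ fun _ => Finset.range_subset_range.2 (le_max_left _ _)
  rw [← Finset.sum_sdiff hsub, add_sub_cancel_right]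
  refine hN.sum_le _ _ (by positivity) fun m hm => ?_
  refine (hN.padicInt_smul_le _ _).trans ((newtonCoeff_le hf m).trans ?_)
  refine mul_le_mul_of_nonneg_left (pow_le_pow_of_le_one hρ hρ1 ?_) hC
  obtain ⟨i, hi⟩ : ∃ i, L ≤ m i := by
    by_contra! hcon
    refine (Finset.mem_sdiff.1 hm).2 (Fintype.mem_piFinset.2 fun i => ?_)
    exact Finset.mem_range.2 (hcon i)
  exact hi.trans (Finset.single_le_sum (f := m) (fun _ _ => Nat.zero_le _) (Finset.mem_univ i))

/-- A map `G : ℤ_p^k → ℤ_p^j` is contracting-analytic if the `n`-fold differences of its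
coordinates are divisible by `p^{2n}`. Power series on a sufficiently small ball have this
property, see `exists_contracting_of_analyticAt`. The exponent `2n` leaves a factor `p^n` after
division by factorials, see `IsContracting.diffBd_choose`. -/
structure IsContracting (G : (Fin k → ℤ_[p]) → Fin j → ℤ_[p]) : Prop where
  continuous : Continuous G
  expBd : ∀ i, ExpBd (fun a : ℤ_[p] => ‖a‖) 1 ((p : ℝ) ^ (-2 : ℤ)) fun z => G z i

theorem norm_factorial_ge (m : ℕ) : (p : ℝ) ^ (-m : ℤ) ≤ ‖((m.factorial : ℕ) : ℤ_[p])‖ := by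
  rw [PadicInt.norm_eq_zpow_neg_valuation (by exact_mod_cast m.factorial_ne_zero)]
  refine zpow_le_zpow_right₀ (by exact_mod_cast (Fact.out : p.Prime).one_lt.le) ?_
  rw [← PadicInt.valuation_coe, PadicInt.coe_natCast, Padic.valuation_natCast]
  have := padicValNat_factorial_le (p := p) m
  omega

/-- The binomial functions of a contracting map: since `m! choose(G, m)` is a product of contracting
functions, dividing by `m!` costs at most `p^m`. -/
theorem IsContracting.diffBd_choose {G : (Fin k → ℤ_[p]) → Fin j → ℤ_[p]} (hG : IsContracting G)
    (m : Fin j → ℕ) {n : ℕ} (hn : ∑ i, m i ≤ n) :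
    DiffBd (fun a : ℤ_[p] => ‖a‖) Set.univ n (fun z => ∏ i, Ring.choose (G z i) (m i))
      ((p : ℝ) ^ (-n : ℤ)) := by
  classical
  have hN : IsGauge fun a : ℤ_[p] => ‖a‖ := isGauge_norm_of_ultrametric
  have hp1 : (1 : ℝ) ≤ p := by exact_mod_cast (Fact.out : p.Prime).one_lt.le
  have hp0 : (0 : ℝ) < p := by linarith
  set ρ : ℝ := (p : ℝ) ^ (-2 : ℤ) with hρ
  have hρ0 : 0 ≤ ρ := by positivity
  -- falling factorials `G (G - 1) ⋯ (G - l + 1)` are products of contracting functions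
  have hpoch : ∀ i l, ExpBd (fun a : ℤ_[p] => ‖a‖) 1 ρ
      fun z => (descPochhammer ℤ l).smeval (G z i) := by
    intro i l
    induction l with
    | zero =>
      simpa using ExpBd.const hN hρ0 (1 : ℤ_[p]) (by simp)
    | succ l ih =>
      have h1 : ExpBd (fun a : ℤ_[p] => ‖a‖) 1 ρ ((fun z => G z i) - fun _ => (l : ℤ_[p])) :=
        fun n => (hG.expBd i n).sub hN (ExpBd.const hN hρ0 _ (PadicInt.norm_le_one _) n)
      have h2 := ih.mul hN h1
      rw [one_mul] at h2
      convert h2 using 1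
      funext z
      simp [descPochhammer_succ_right, Polynomial.smeval_mul, Polynomial.smeval_natCast]
  have hprod : ∀ s : Finset (Fin j), ExpBd (fun a : ℤ_[p] => ‖a‖) 1 ρ
      fun z => ∏ i ∈ s, (descPochhammer ℤ (m i)).smeval (G z i) := by
    intro s
    induction s using Finset.induction_on with
    | empty => simpa using ExpBd.const hN hρ0 (1 : ℤ_[p]) (by simp)
    | insert i s hi ih =>
      have h2 := (hpoch i (m i)).mul hN ih
      rw [one_mul] at h2
      convert h2 using 1
      funext z
      simp [Finset.prod_insert hi]
  set c : ℤ_[p] := ∏ i, ((m i).factorial : ℤ_[p]) with hc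
  have hcn : (p : ℝ) ^ (-n : ℤ) ≤ ‖c‖ := by
    have h1 : (p : ℝ) ^ (-((∑ i, m i : ℕ) : ℤ)) ≤ ‖c‖ := by
      rw [hc, norm_prod]
      have h2 : (p : ℝ) ^ (-((∑ i, m i : ℕ) : ℤ)) = ∏ i, (p : ℝ) ^ (-(m i : ℤ)) := by
        simp only [zpow_neg, zpow_natCast]
        rw [Finset.prod_inv_distrib, Finset.prod_pow_eq_pow_sum]
      rw [h2]
      exact Finset.prod_le_prod (fun _ _ => by positivity) fun i _ => norm_factorial_ge (m i)
    exact (zpow_le_zpow_right₀ hp1 (by omega)).trans h1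
  have hfin := hprod Finset.univ n
  have heq : (fun z => ∏ i, (descPochhammer ℤ (m i)).smeval (G z i)) =
      fun z => AddMonoidHom.mulLeft c (∏ i, Ring.choose (G z i) (m i)) := by
    funext z
    simp only [Ring.descPochhammer_eq_factorial_smul_choose, nsmul_eq_mul]
    rw [Finset.prod_mul_distrib]
    rfl
  rw [heq] at hfin
  refine hfin.of_map _ fun a ha => ?_
  rw [AddMonoidHom.coe_mulLeft, norm_mul, one_mul, hρ, ← zpow_natCast, ← zpow_mul] at ha
  have h3 : (p : ℝ) ^ (-2 * (n : ℤ)) = (p : ℝ) ^ (-(n : ℤ)) * (p : ℝ) ^ (-(n : ℤ)) := by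
    rw [← zpow_add₀ hp0.ne']
    congr 1
    ring
  rw [h3] at ha
  have h4 : 0 < (p : ℝ) ^ (-(n : ℤ)) := by positivity
  have h5 := (mul_le_mul_of_nonneg_right hcn (norm_nonneg a)).trans ha
  exact le_of_mul_le_mul_left h5 h4

/-- Composition with contracting maps preserves exponential decay. The constants do not depend on the
map. -/
theorem exists_expBd_comp (hN : IsGauge N) {ρ : ℝ} (hρ : 0 < ρ) (hρ1 : ρ < 1) :
    ∃ K ρ' : ℝ, 0 < K ∧ 0 < ρ' ∧ ρ' < 1 ∧ ∀ {j k : ℕ} (G : (Fin k → ℤ_[p]) → Fin j → ℤ_[p]),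
      IsContracting G → ∀ (C : ℝ) (f : (Fin j → ℤ_[p]) → A), Continuous f → ExpBd N C ρ f →
      ExpBd N (K * C) ρ' (f ∘ G) := by
  obtain ⟨C₁, b, hC₁, hb0, hb1, hp⟩ := hN.exists_p_pow_smul_le (p := p) (B := A)
  refine ⟨C₁, max ρ b, by linarith, lt_max_of_lt_left hρ, max_lt hρ1 hb1, ?_⟩
  intro j k G hG C f hcont hf n
  have hC := hf.nonneg hN
  have hmax : 0 < max ρ b := lt_max_of_lt_left hρ
  have hlim : ∀ y, Tendsto (fun L => newtonSum f L (G y)) atTop (𝓝 ((f ∘ G) y)) := by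
    intro y
    rw [← tendsto_sub_nhds_zero_iff]
    have h0 : Tendsto (fun L : ℕ => C * ρ ^ L) atTop (𝓝 0) := by
      simpa using (tendsto_pow_atTop_nhds_zero_of_lt_one hρ.le hρ1).const_mul C
    intro U hU
    obtain ⟨ε, hε, hεU⟩ := hN.exists_lt U hU
    refine Filter.mem_map.2 ?_
    filter_upwards [h0.eventually_lt_const hε] with L hL
    exact hεU _ ((newtonSum_sub_le hN hρ.le hρ1.le hcont hf L (G y)).trans_lt hL)
  refine DiffBd.of_tendsto hN hlim (Eventually.of_forall fun L => ?_)
  have hsum : (fun z => newtonSum f L (G z)) =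
      ∑ m ∈ Fintype.piFinset fun _ : Fin j => Finset.range L,
        fun z => (∏ i, Ring.choose (G z i) (m i)) • newtonCoeff f m := by
    funext z
    simp [newtonSum, Finset.sum_apply]
  rw [hsum]
  refine DiffBd.sum hN (by positivity) fun m _ => ?_
  -- for `|m| ≤ n` the differences of the binomial functions are small, for `|m| > n` the coefficients
  rcases le_or_gt (∑ i, m i) n with hm | hm
  · refine (hG.diffBd_choose m hm).map (N' := N)
      (LinearMap.toSpanSingleton ℤ_[p] A (newtonCoeff f m)).toAddMonoidHom fun a ha => ?_
    refine (hN.smul_le_of_norm_le hp ha _).trans ?_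
    have h1 : N (newtonCoeff f m) ≤ C := (newtonCoeff_le hf m).trans
      (mul_le_of_le_one_right hC (pow_le_one₀ hρ.le hρ1.le))
    have h2 := hN.nonneg (newtonCoeff f m)
    calc C₁ * b ^ n * N (newtonCoeff f m) ≤ C₁ * max ρ b ^ n * C := by
          gcongr
          exact le_max_right _ _
      _ = _ := by ring
  · refine DiffBd.of_le hN (Nat.zero_le n) fun z => ?_
    refine (hN.padicInt_smul_le _ _).trans ((newtonCoeff_le hf m).trans ?_)
    calc C * ρ ^ ∑ i, m i ≤ 1 * C * ρ ^ n := by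
          rw [one_mul]
          exact mul_le_mul_of_nonneg_left (pow_le_pow_of_le_one hρ.le hρ1.le hm.le) hC
      _ ≤ C₁ * C * max ρ b ^ n := by
          gcongr
          exact le_max_left _ _

end Composition

/-! ### Small balls in `ℤ_p^k` -/

section Balls

variable {p : ℕ} [Fact p.Prime] {j k : ℕ}

theorem ball_mem_nhds (z : Fin k → ℤ_[p]) (n : ℕ) :
    (Set.range fun w : Fin k → ℤ_[p] => z + p ^ n • w) ∈ 𝓝 z := by
  have hpos : (0 : ℝ) < (p : ℝ) ^ (-n : ℤ) :=
    zpow_pos (by exact_mod_cast (Fact.out : p.Prime).pos) _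
  refine mem_of_superset (Metric.closedBall_mem_nhds z hpos) fun y hy => ?_
  have h : ∀ i, ∃ w : ℤ_[p], p ^ n • w = y i - z i := by
    intro i
    have h1 : ‖y i - z i‖ ≤ (p : ℝ) ^ (-n : ℤ) :=
      (norm_le_pi_norm (y - z) i).trans (by simpa [dist_eq_norm] using hy)
    obtain ⟨w, hw⟩ := Ideal.mem_span_singleton'.1 ((PadicInt.norm_le_pow_iff_mem_span_pow _ n).1 h1)
    refine ⟨w, ?_⟩
    rw [← hw, nsmul_eq_mul, mul_comm]
    push_cast
    rfl
  choose w hw using h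
  refine ⟨w, ?_⟩
  funext i
  simp only [Pi.add_apply, Pi.smul_apply, hw]
  ring

theorem isOpenEmbedding_ball (z : Fin k → ℤ_[p]) (n : ℕ) :
    Topology.IsOpenEmbedding fun w : Fin k → ℤ_[p] => z + p ^ n • w := by
  have hp : ((p ^ n : ℕ) : ℤ_[p]) ≠ 0 := by
    exact_mod_cast pow_ne_zero n (Fact.out : p.Prime).ne_zero
  have hc : Continuous fun w : Fin k → ℤ_[p] => z + p ^ n • w := by fun_prop
  have hinj : Function.Injective fun w : Fin k → ℤ_[p] => z + p ^ n • w := by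
    intro w w' h
    funext i
    have h1 := congrFun (add_left_cancel h) i
    simp only [Pi.smul_apply, nsmul_eq_mul] at h1
    exact mul_left_cancel₀ hp h1
  refine ⟨(hc.isClosedEmbedding hinj).isEmbedding, ?_⟩
  rw [isOpen_iff_mem_nhds]
  rintro _ ⟨w, rfl⟩
  refine mem_of_superset (ball_mem_nhds (z + p ^ n • w) n) ?_
  rintro _ ⟨w', rfl⟩
  exact ⟨w + w', by simp only [smul_add, add_assoc]⟩

theorem continuous_of_balls {B : Type*} [TopologicalSpace B] {f : (Fin k → ℤ_[p]) → B} (n : ℕ)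
    (h : ∀ z, Continuous fun w => f (z + p ^ n • w)) : Continuous f := by
  refine continuous_iff_continuousAt.2 fun z => ?_
  have h1 := (isOpenEmbedding_ball z n).continuousAt_iff (g := f) (x := 0)
  simpa using h1.1 (h z).continuousAt

/-- Compactness: if each point has a radius with a property that is inherited by smaller balls, then
one radius works for all points. -/
theorem exists_uniform_radius {P : (Fin k → ℤ_[p]) → ℕ → Prop}
    (hP : ∀ z n, P z n → ∀ w m, P (z + p ^ n • w) (n + m)) (h : ∀ z, ∃ n, P z n) :
    ∃ n, ∀ z, P z n := by
  choose n hn using h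
  obtain ⟨t, -, ht⟩ := isCompact_univ.elim_nhds_subcover _ fun z _ => ball_mem_nhds z (n z)
  refine ⟨t.sup n, fun y => ?_⟩
  obtain ⟨z, hz, w, rfl⟩ := Set.mem_iUnion₂.1 (ht (Set.mem_univ y))
  obtain ⟨m, hm⟩ := Nat.exists_eq_add_of_le (Finset.le_sup (f := n) hz)
  rw [hm]
  exact hP z _ (hn z) w m

theorem IsContracting.comp_ball {G : (Fin k → ℤ_[p]) → Fin j → ℤ_[p]} (hG : IsContracting G)
    (z : Fin k → ℤ_[p]) (n : ℕ) : IsContracting fun w => G (z + p ^ n • w) where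
  continuous := hG.continuous.comp (isOpenEmbedding_ball z n).continuous
  expBd i m := by
    have h := ((hG.expBd i m).translate z).comp_hom (Z' := Set.univ)
      (nsmulAddMonoidHom (p ^ n)) (Set.mapsTo_univ _ _)
    simpa [add_comm z] using h

theorem isContracting_ball (z : Fin k → ℤ_[p]) :
    IsContracting fun w : Fin k → ℤ_[p] => z + p ^ 2 • w where
  continuous := (isOpenEmbedding_ball z 2).continuous
  expBd i n := by
    have hN : IsGauge fun a : ℤ_[p] => ‖a‖ := isGauge_norm_of_ultrametric
    have hd : ∀ v, fwdDiff v (fun w : Fin k → ℤ_[p] => (z + p ^ 2 • w) i) =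
        fun _ => ((p : ℤ_[p]) ^ 2) * v i := by
      intro v
      funext w
      simp [fwdDiff, nsmul_eq_mul]
    have hp : ‖(p : ℤ_[p]) ^ 2‖ = (p : ℝ) ^ (-2 : ℤ) := PadicInt.norm_p_pow 2
    match n with
    | 0 =>
      intro w
      simpa using PadicInt.norm_le_one _
    | 1 =>
      intro v _
      rw [hd]
      intro w
      simp only [norm_mul, hp, one_mul, pow_one]
      exact mul_le_of_le_one_right (by positivity) (PadicInt.norm_le_one _)
    | n + 2 =>
      intro v _ v' _
      rw [hd, fwdDiff_const]
      exact DiffBd.zero hN (by positivity)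

end Balls

/-! ### Pullback along partially defined locally analytic maps -/

section Pull

variable {p : ℕ} [Fact p.Prime] {j k : ℕ} {Y : Type*}

/-- On the ball `z + p^n ℤ_p^k` the map `γ` either avoids the piece parametrized by `Q`, or is
given by a contracting map to this piece. -/
def GoodAt (γ : (Fin k → ℤ_[p]) → Y) (Q : (Fin j → ℤ_[p]) → Y) (z : Fin k → ℤ_[p]) (n : ℕ) :
    Prop :=
  (∀ w, γ (z + p ^ n • w) ∉ Set.range Q) ∨
    ∃ G : (Fin k → ℤ_[p]) → Fin j → ℤ_[p], IsContracting G ∧ ∀ w, γ (z + p ^ n • w) = Q (G w)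

theorem GoodAt.ball {γ : (Fin k → ℤ_[p]) → Y} {Q : (Fin j → ℤ_[p]) → Y} {z : Fin k → ℤ_[p]} {n : ℕ}
    (h : GoodAt γ Q z n) (w : Fin k → ℤ_[p]) (m : ℕ) : GoodAt γ Q (z + p ^ n • w) (n + m) := by
  have e : ∀ w', z + p ^ n • w + p ^ (n + m) • w' = z + p ^ n • (w + p ^ m • w') := fun w' => by
    rw [smul_add, add_assoc, pow_add, mul_smul]
  rcases h with h | ⟨G, hG, h⟩
  · exact Or.inl fun w' => by rw [e]; exact h _
  · exact Or.inr ⟨_, hG.comp_ball w m, fun w' => by rw [e]; exact h _⟩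

/-- The partially defined map `Q⁻¹ ∘ γ` is locally analytic on a clopen set. -/
def GoodRel (γ : (Fin k → ℤ_[p]) → Y) (Q : (Fin j → ℤ_[p]) → Y) : Prop := ∀ z, ∃ n, GoodAt γ Q z n

theorem GoodRel.uniform {γ : (Fin k → ℤ_[p]) → Y} {Q : (Fin j → ℤ_[p]) → Y} (h : GoodRel γ Q) :
    ∃ n, ∀ z, GoodAt γ Q z n :=
  exists_uniform_radius (fun _ _ h => h.ball) h

variable {A : Type v} [CommRing A] [UniformSpace A] [IsUniformAddGroup A] [CompleteSpace A]
  [T2Space A] [IsTateRing A] [Algebra ℤ_[p] A] [ContinuousSMul ℤ_[p] A]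

/-- Extension by zero along `Q` followed by pullback along `γ`. All the maps between spaces of
functions that are dualized to maps of distributions are of this form. -/
def extPull (A : Type*) [CommRing A] (γ : (Fin k → ℤ_[p]) → Y) (Q : (Fin j → ℤ_[p]) → Y) :
    ((Fin j → ℤ_[p]) → A) →ₗ[A] ((Fin k → ℤ_[p]) → A) where
  toFun f z := Function.extend Q f 0 (γ z)
  map_add' f g := by
    funext z
    have := congrFun (Function.extend_add Q f g 0 0) (γ z)
    simpa using this
  map_smul' a f := by
    funext z
    have := congrFun (Function.extend_smul a Q f 0) (γ z)
    simpa using this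

variable {γ : (Fin k → ℤ_[p]) → Y} {Q : (Fin j → ℤ_[p]) → Y}

theorem extPull_ball (hQ : Function.Injective Q) {z : Fin k → ℤ_[p]} {n : ℕ}
    (h : GoodAt γ Q z n) : (∀ f : (Fin j → ℤ_[p]) → A,
      (fun w => extPull A γ Q f (z + p ^ n • w)) = 0) ∨
    ∃ G : (Fin k → ℤ_[p]) → Fin j → ℤ_[p], IsContracting G ∧
      ∀ f : (Fin j → ℤ_[p]) → A, (fun w => extPull A γ Q f (z + p ^ n • w)) = f ∘ G := by
  rcases h with h | ⟨G, hG, h⟩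
  · refine Or.inl fun f => funext fun w => ?_
    have := Function.extend_apply' (f := Q) f 0 _ (h w)
    exact this
  · refine Or.inr ⟨G, hG, fun f => funext fun w => ?_⟩
    change Function.extend Q f 0 (γ _) = _
    rw [h, hQ.extend_apply]
    rfl

theorem continuous_extPull (hQ : Function.Injective Q) (h : GoodRel γ Q)
    {f : (Fin j → ℤ_[p]) → A} (hf : Continuous f) : Continuous (extPull A γ Q f) := by
  obtain ⟨n, hn⟩ := h.uniform
  refine continuous_of_balls n fun z => ?_
  rcases extPull_ball (A := A) hQ (hn z) with h | ⟨G, hG, h⟩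
  · rw [h f]
    exact continuous_const
  · rw [h f]
    exact hf.comp hG.continuous

variable {N : A → ℝ}

/-- On each ball of a suitable radius the pullback is zero or a composition with a contracting map. -/
theorem exists_expBd_extPull (hN : IsGauge N) (hQ : Function.Injective Q) (h : GoodRel γ Q) {ρ : ℝ}
    (hρ : 0 < ρ) (hρ1 : ρ < 1) : ∃ K ρ' : ℝ, 0 < K ∧ 0 < ρ' ∧ ρ' < 1 ∧
      ∀ (C : ℝ) (f : (Fin j → ℤ_[p]) → A), Continuous f → ExpBd N C ρ f →
      ExpBd N (K * C) ρ' (extPull A γ Q f) := by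
  obtain ⟨n, hn⟩ := h.uniform
  obtain ⟨K, ρ', hK, hρ', hρ'1, h1⟩ := exists_expBd_comp (p := p) hN hρ hρ1
  obtain ⟨K', ρ'', hK', hρ'', hρ''1, h2⟩ := exists_expBd_of_steps (p := p) hN k n hρ' hρ'1
  refine ⟨K' * K, ρ'', by positivity, hρ'', hρ''1, fun C f hf hC => ?_⟩
  have hC0 := hC.nonneg hN
  rw [mul_assoc]
  refine h2 _ _ (by positivity) (continuous_extPull hQ h hf) fun a =>
    diffBd_steps_of_balls fun z => ?_
  rcases extPull_ball (A := A) hQ (hn z) with h | ⟨G, hG, h⟩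
  · rw [h f]
    exact DiffBd.zero hN (by positivity)
  · rw [h f]
    exact h1 G hG C f hf hC a

theorem extPull_mem_zpFun {α β : Aˣ} (hα : IsTopologicallyNilpotent (α : A))
    (hβ : IsTopologicallyNilpotent (β : A)) (hQ : Function.Injective Q) (h : GoodRel γ Q)
    {f : (Fin j → ℤ_[p]) → A} (hf : f ∈ zpFun p j β) : extPull A γ Q f ∈ zpFun p k α := by
  obtain ⟨N, hN⟩ := exists_isGauge A
  obtain ⟨hcont, C, ρ, hρ, hρ1, hC⟩ := (mem_zpFun_iff hN hβ).1 hf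
  obtain ⟨K, ρ', -, hρ', hρ'1, h1⟩ := exists_expBd_extPull hN hQ h hρ hρ1
  exact (mem_zpFun_iff hN hα).2 ⟨continuous_extPull hQ h hcont, _, ρ', hρ', hρ'1, h1 C f hcont hC⟩

/-- A linear map between spaces of functions of given radius is continuous if it maps small basic
neighbourhoods of zero into given ones. -/
theorem continuous_of_radNhd {α β : Aˣ} {r r' : ℝ}
    (T : RadFun (A := A) p j β r →ₗ[A] RadFun (A := A) p k α r')
    (h : ∀ U' ∈ 𝓝 (0 : A), ∃ U ∈ 𝓝 (0 : A), ∀ f ∈ radNhd p j β r U, T f ∈ radNhd p k α r' U') :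
    Continuous T := by
  refine ⟨fun W hW f hf => ?_⟩
  obtain ⟨U', hU', hW'⟩ := hW (T f) hf
  obtain ⟨U, hU, hUU'⟩ := h U' hU'
  refine ⟨U, hU, fun g hg => hW' _ ?_⟩
  rw [← map_sub]
  exact hUU' _ hg

/-- The dual of a continuous operator `T` that extends to all continuous functions preserves the closure
of the space of measures: `T` preserves bounded sets, so its dual is continuous for bounded
convergence, and it maps measures to measures. -/
theorem comp_mem_radDist {α β : Aˣ} {r r' : ℝ}
    (T : RadFun (A := A) p j β r →L[A] RadFun (A := A) p k α r')
    (Tc : C(Fin j → ℤ_[p], A) →L[A] C(Fin k → ℤ_[p], A))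
    (hT : ∀ f, (⟨(T f).1, (T f).2.1⟩ : C(Fin k → ℤ_[p], A)) = Tc ⟨f.1, f.2.1⟩)
    {ψ : RadFun (A := A) p k α r' →L[A] A} (hψ : ψ ∈ radDist p k α r') :
    ψ.comp T ∈ radDist p j β r := by
  have hcont : @Continuous _ _ (boundedConvergence A (RadFun (A := A) p k α r'))
      (boundedConvergence A (RadFun (A := A) p j β r)) fun ψ => ψ.comp T := by
    let _ := boundedConvergence A (RadFun (A := A) p k α r')
    let _ := boundedConvergence A (RadFun (A := A) p j β r)
    refine continuous_induced_rng.2 ?_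
    -- continuous linear maps preserve bounded sets
    have hmaps : Set.MapsTo (Set.image T) {B | IsBddSet A (RadFun (A := A) p j β r) B}
        {B | IsBddSet A (RadFun (A := A) p k α r') B} := by
      intro B hB U hU
      obtain ⟨a, ha⟩ := hB (T ⁻¹' U) (T.continuous.continuousAt.preimage_mem_nhds (by
        rwa [map_zero]))
      refine ⟨a, ?_⟩
      rintro _ ⟨b, hb, rfl⟩
      rw [← map_smul]
      exact ha b hb
    have h1 := (UniformOnFun.precomp_uniformContinuous (β := A) hmaps).continuous
    exact h1.comp continuous_induced_dom
  have h2 : ψ ∈ @closure _ (boundedConvergence A (RadFun (A := A) p k α r'))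
      (radMeasures p k α r' : Set (RadFun (A := A) p k α r' →L[A] A)) := by
    rw [← coe_boundedClosure]
    exact hψ
  have h3 := @map_mem_closure _ _ (boundedConvergence A (RadFun (A := A) p k α r'))
      (boundedConvergence A (RadFun (A := A) p j β r)) _ _ _
      (radMeasures p j β r : Set (RadFun (A := A) p j β r →L[A] A)) hcont h2 (by
    rintro ψ ⟨μ, hμ⟩
    refine ⟨μ.comp Tc, fun f => ?_⟩
    rw [ContinuousLinearMap.comp_apply, ContinuousLinearMap.comp_apply, hμ, hT])
  rw [← coe_boundedClosure] at h3
  exact h3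

/-- The continuous operator on all continuous functions that extends `extPull`. -/
def extPullC (hQ : Function.Injective Q) (h : GoodRel γ Q) :
    C(Fin j → ℤ_[p], A) →L[A] C(Fin k → ℤ_[p], A) where
  toFun f := ⟨extPull A γ Q f, continuous_extPull hQ h f.continuous⟩
  map_add' f g := by
    ext z
    exact congrFun ((extPull A γ Q).map_add f g) z
  map_smul' a f := by
    ext z
    exact congrFun ((extPull A γ Q).map_smul a f) z
  cont := by
    refine ContinuousMap.continuous_of_continuous_uncurry _ ?_
    obtain ⟨n, hn⟩ := h.uniform
    refine continuous_iff_continuousAt.2 fun ⟨f, z⟩ => ?_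
    have he : Topology.IsOpenEmbedding fun q : C(Fin j → ℤ_[p], A) × (Fin k → ℤ_[p]) =>
        (q.1, z + p ^ n • q.2) := Topology.IsOpenEmbedding.id.prodMap (isOpenEmbedding_ball z n)
    have h1 := he.continuousAt_iff (g := Function.uncurry fun (f : C(Fin j → ℤ_[p], A))
      (z : Fin k → ℤ_[p]) => extPull A γ Q f z) (x := (f, 0))
    simp only [smul_zero, add_zero] at h1
    refine h1.1 (Continuous.continuousAt ?_)
    rcases extPull_ball (A := A) hQ (hn z) with h | ⟨G, hG, h⟩
    · have : (Function.uncurry (fun (f : C(Fin j → ℤ_[p], A)) (z : Fin k → ℤ_[p]) =>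
          extPull A γ Q f z)) ∘ (fun q : C(Fin j → ℤ_[p], A) × (Fin k → ℤ_[p]) =>
            (q.1, z + p ^ n • q.2)) = fun _ => 0 := by
        funext q
        exact congrFun (h q.1) q.2
      rw [this]
      exact continuous_const
    · have : (Function.uncurry (fun (f : C(Fin j → ℤ_[p], A)) (z : Fin k → ℤ_[p]) =>
          extPull A γ Q f z)) ∘ (fun q : C(Fin j → ℤ_[p], A) × (Fin k → ℤ_[p]) =>
            (q.1, z + p ^ n • q.2)) = fun q => q.1 (G q.2) := by
        funext q
        exact congrFun (h q.1) q.2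
      rw [this]
      have := hG.continuous
      fun_prop

/-- The dual of the pullback operator preserves distributions: for each radius `r` there is a radius
`r'` such that pullback is continuous from `𝒜^(β,r)` to `𝒜^(α,r')`. -/
theorem comp_extPull_mem_zpDist {α β : Aˣ} (hα : IsTopologicallyNilpotent (α : A))
    (hβ : IsTopologicallyNilpotent (β : A)) (hQ : Function.Injective Q) (h : GoodRel γ Q)
    {φ : zpFun (A := A) p k α →ₗ[A] A} (hφ : φ ∈ zpDist p k α) :
    φ ∘ₗ (extPull A γ Q).restrict (fun _ => extPull_mem_zpFun hα hβ hQ h) ∈ zpDist p j β := by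
  obtain ⟨N, hN⟩ := exists_isGauge A
  intro r hr
  obtain ⟨K, ρ, hK, hρ, hρ1, h1, h2⟩ := exists_expBd_of_radFun (p := p) (k := j) hN hβ hr
  obtain ⟨K', ρ', hK', hρ', hρ'1, h3⟩ := exists_expBd_extPull hN hQ h hρ hρ1
  obtain ⟨r', K'', hr', hK'', h4, h5⟩ := exists_radius (p := p) (k := k) hN α hρ' hρ'1
  obtain ⟨ψ, hψ, hψφ⟩ := hφ r' hr'
  have hmem : ∀ f ∈ radFun (A := A) p j β r, extPull A γ Q f ∈ radFun p k α r' := by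
    intro f hf
    obtain ⟨C, hC⟩ := h1 f hf
    exact h4 _ _ (continuous_extPull hQ h hf.1) (h3 C f hf.1 hC)
  let T₀ : RadFun (A := A) p j β r →ₗ[A] RadFun (A := A) p k α r' := (extPull A γ Q).restrict hmem
  have hT₀ : Continuous T₀ := by
    refine continuous_of_radNhd T₀ fun U' hU' => ?_
    obtain ⟨ε, hε, hεU⟩ := hN.exists_lt U' hU'
    -- the input is scaled such that the composite estimate `K'' K' K η` stays below `ε`
    set η := ε / (2 * (K'' * (K' * K))) with hη
    have hη0 : 0 < η := by positivity
    refine ⟨_, hN.mem_nhds η hη0, fun f hf => ?_⟩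
    have h6 : K'' * (K' * (K * η)) < ε := by
      have : K'' * (K' * (K * η)) = ε / 2 := by
        rw [hη]
        field_simp
      linarith
    have h7 := h5 _ ε (T₀ f) h6 (h3 _ f.1 f.2.1 (h2 η hη0 f hf))
    exact fun n δ hδ y => hεU _ (h7 n δ hδ y)
  refine ⟨ψ.comp ⟨T₀, hT₀⟩, comp_mem_radDist _ (extPullC hQ h) (fun f => rfl) hψ, fun f => ?_⟩
  exact hψφ (T₀ f)

end Pull

/-! ### Analytic maps are contracting on small balls -/

section Analytic

variable {p : ℕ} [Fact p.Prime] {j k : ℕ}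

theorem isGauge_norm_padic : IsGauge fun a : ℚ_[p] => ‖a‖ := isGauge_norm_of_ultrametric

/-- The functions `p^2 z_i` are contracting. -/
theorem expBd_coord (i : Fin k) : ExpBd (fun a : ℚ_[p] => ‖a‖) 1 ((p : ℝ) ^ (-2 : ℤ))
    fun z : Fin k → ℤ_[p] => (p : ℚ_[p]) ^ 2 * (z i : ℚ_[p]) := by
  intro n
  have h := ((isContracting_ball (0 : Fin k → ℤ_[p])).expBd i n).map
    (N' := fun a : ℚ_[p] => ‖a‖) (PadicInt.Coe.ringHom (p := p)).toAddMonoidHom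
    (d := 1 * ((p : ℝ) ^ (-2 : ℤ)) ^ n) (fun b hb => hb)
  convert h using 1
  funext z
  change _ = (((0 + p ^ 2 • z) i : ℤ_[p]) : ℚ_[p])
  simp [nsmul_eq_mul]

theorem expBd_prod {ι M B : Type*} [AddCommGroup M] [CommRing B] [TopologicalSpace B] {N : B → ℝ}
    (hN : IsGauge N) (h1 : N 1 ≤ 1) {ρ : ℝ} (hρ : 0 ≤ ρ) (s : Finset ι) (F : ι → M → B)
    (h : ∀ i ∈ s, ExpBd N 1 ρ (F i)) : ExpBd N 1 ρ fun z => ∏ i ∈ s, F i z := by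
  classical
  induction s using Finset.induction_on with
  | empty => simpa using ExpBd.const hN hρ (1 : B) h1
  | insert i s hi ih =>
    have h2 := (h i (by simp)).mul hN (ih fun i hi => h i (by simp [hi]))
    rw [one_mul] at h2
    convert h2 using 1
    funext z
    simp [Finset.prod_insert hi]

theorem norm_intPoint_le (z : Fin k → ℤ_[p]) : ‖intPoint p k z‖ ≤ 1 :=
  (pi_norm_le_iff_of_nonneg zero_le_one).2 fun i => PadicInt.norm_le_one (z i)

theorem intPoint_injective : Function.Injective (intPoint p k) := fun z w h => by
  funext i
  exact Subtype.ext (congrFun h i)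

theorem continuous_intPoint : Continuous (intPoint p k) :=
  continuous_pi fun i => continuous_subtype_val.comp (continuous_apply i)

theorem mem_range_intPoint {u : Fin k → ℚ_[p]} : u ∈ Set.range (intPoint p k) ↔ ‖u‖ ≤ 1 := by
  constructor
  · rintro ⟨z, rfl⟩
    exact norm_intPoint_le z
  · intro h
    exact ⟨fun i => ⟨u i, (norm_le_pi_norm u i).trans h⟩, rfl⟩

/-- A power series is contracting on small balls: after rescaling by a large power of `p`, its
terms are products of constants of norm at most `1` and of functions `p^2 z_i`. -/
theorem exists_expBd_of_analyticAt {h : (Fin k → ℚ_[p]) → Fin j → ℚ_[p]} {u : Fin k → ℚ_[p]}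
    (hu : AnalyticAt ℚ_[p] h u) : ∃ n : ℕ,
      (Continuous fun z : Fin k → ℤ_[p] => h (u + p ^ n • intPoint p k z)) ∧
      ∀ i, ExpBd (fun a : ℚ_[p] => ‖a‖) 1 ((p : ℝ) ^ (-2 : ℤ))
        fun z : Fin k → ℤ_[p] => h (u + p ^ n • intPoint p k z) i - h u i := by
  classical
  obtain ⟨P, R, hP⟩ := hu
  obtain ⟨C, a, hC, ha, hCa⟩ := P.le_mul_pow_of_radius_pos (hP.r_pos.trans_le hP.r_le)
  obtain ⟨R₀, hR₀, hR₀R⟩ : ∃ R₀ : ℝ, 0 < R₀ ∧ ENNReal.ofReal R₀ ≤ R := by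
    obtain ⟨q, hq0, hqR⟩ := ENNReal.lt_iff_exists_nnreal_btwn.1 hP.r_pos
    exact ⟨q, by exact_mod_cast hq0, by simpa using hqR.le⟩
  have hp1 : (1 : ℝ) < p := by exact_mod_cast (Fact.out : p.Prime).one_lt
  have hp0 : (0 : ℝ) < p := by linarith
  set D := max C 1
  have hD : 1 ≤ D := le_max_right _ _
  -- the radius lies in the domain of convergence, and it compensates the growth `D a^m` of the
  -- coefficients together with a factor `p^2` for each variable
  obtain ⟨n, hn⟩ := exists_pow_lt_of_lt_one (y := (p : ℝ)⁻¹)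
    (lt_min hR₀ (by positivity : 0 < (p ^ 2 * D * a : ℝ)⁻¹)) (inv_lt_one_of_one_lt₀ hp1)
  have hn1 := hn.trans_le (min_le_left _ _)
  have hn2 := hn.trans_le (min_le_right _ _)
  set ρ : ℝ := (p : ℝ) ^ (-2 : ℤ) with hρ
  have hρ0 : 0 ≤ ρ := by positivity
  have hN := isGauge_norm_padic (p := p)
  have hpn : ‖((p ^ n : ℕ) : ℚ_[p])‖ = (p : ℝ)⁻¹ ^ n := by
    rw [Nat.cast_pow, norm_pow, Padic.norm_p]
  have hball : ∀ z : Fin k → ℤ_[p], p ^ n • intPoint p k z ∈ Metric.eball 0 R := by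
    intro z
    have h1 : ‖p ^ n • intPoint p k z‖ < R₀ := by
      rw [← Nat.cast_smul_eq_nsmul ℚ_[p], norm_smul, hpn]
      exact (mul_le_of_le_one_right (by positivity) (norm_intPoint_le z)).trans_lt hn1
    refine Metric.eball_subset_eball hR₀R ?_
    rw [Metric.eball_ofReal]
    simpa using h1
  refine ⟨n, ?_, fun i => ?_⟩
  · have hc : Continuous fun z : Fin k → ℤ_[p] => u + p ^ n • intPoint p k z := by
      have := continuous_intPoint (p := p) (k := k)
      fun_prop
    refine hP.continuousOn.comp_continuous hc fun z => ?_
    have := hball z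
    simpa [Metric.mem_eball, edist_eq_enorm_sub] using this
  have hterm : ∀ m, ExpBd (fun a : ℚ_[p] => ‖a‖) 1 ρ
      fun z : Fin k → ℤ_[p] => P (m + 1) (fun _ => p ^ n • intPoint p k z) i := by
    intro m
    let e : Fin k → Fin k → ℚ_[p] := fun l => Pi.single l 1
    have hexp : (fun z : Fin k → ℤ_[p] => P (m + 1) (fun _ => p ^ n • intPoint p k z) i) =
        ∑ s : Fin (m + 1) → Fin k, (fun z => ∏ l, ((p : ℚ_[p]) ^ 2 * (z (s l) : ℚ_[p]))) *
          fun _ => (((p : ℚ_[p]) ^ n * ((p : ℚ_[p]) ^ 2)⁻¹) ^ (m + 1) *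
            P (m + 1) (fun l => e (s l)) i) := by
      funext z
      have h1 : p ^ n • intPoint p k z = ∑ l, ((p : ℚ_[p]) ^ n * (z l : ℚ_[p])) • e l := by
        funext l'
        simp [e, Finset.sum_apply, Pi.single_apply, intPoint]
      rw [h1, ContinuousMultilinearMap.map_sum]
      simp only [ContinuousMultilinearMap.map_smul_univ, Finset.sum_apply, Pi.smul_apply,
        Pi.mul_apply, smul_eq_mul]
      refine Finset.sum_congr rfl fun s _ => ?_
      have hpne : (p : ℚ_[p]) ≠ 0 := by exact_mod_cast (Fact.out : p.Prime).ne_zero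
      rw [← mul_assoc]
      congr 1
      rw [← Fin.prod_const (m + 1) ((p : ℚ_[p]) ^ n * ((p : ℚ_[p]) ^ 2)⁻¹),
        ← Finset.prod_mul_distrib]
      refine Finset.prod_congr rfl fun l _ => ?_
      field_simp
    rw [hexp]
    refine fun N => DiffBd.sum hN (by positivity) fun s _ => ?_
    have h2 : ‖(((p : ℚ_[p]) ^ n * ((p : ℚ_[p]) ^ 2)⁻¹) ^ (m + 1) *
        P (m + 1) (fun l => e (s l)) i)‖ ≤ 1 := by
      have h3 : ‖P (m + 1) (fun l => e (s l)) i‖ ≤ D * a ^ (m + 1) := by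
        refine (norm_le_pi_norm _ i).trans (((P (m + 1)).le_opNorm _).trans ?_)
        have h4 : ∏ l, ‖e (s l)‖ ≤ 1 := Finset.prod_le_one (fun _ _ => norm_nonneg _) fun l _ => by
          simp only [e, Pi.norm_single, norm_one, le_refl]
        refine (mul_le_of_le_one_right (norm_nonneg _) h4).trans ((hCa _).trans ?_)
        gcongr
        exact le_max_left _ _
      have h5 : ‖(p : ℚ_[p]) ^ n * ((p : ℚ_[p]) ^ 2)⁻¹‖ ≤ (D * a)⁻¹ := by
        rw [norm_mul, norm_inv, norm_pow, norm_pow, Padic.norm_p, inv_pow (p : ℝ) 2, inv_inv]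
        calc (p : ℝ)⁻¹ ^ n * p ^ 2 ≤ (p ^ 2 * D * a : ℝ)⁻¹ * p ^ 2 := by gcongr
          _ = (D * a)⁻¹ := by field_simp
      rw [norm_mul, norm_pow]
      calc _ ≤ ((D * a)⁻¹) ^ (m + 1) * (D * a ^ (m + 1)) := by gcongr
        _ = (D ^ m)⁻¹ := by
          rw [mul_inv, mul_pow, inv_pow, inv_pow, pow_succ D]
          field_simp
        _ ≤ 1 := inv_le_one_of_one_le₀ (one_le_pow₀ hD)
    have h6 := (expBd_prod (M := Fin k → ℤ_[p]) hN (by simp) hρ0 Finset.univ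
      (fun (l : Fin (m + 1)) (z : Fin k → ℤ_[p]) => (p : ℚ_[p]) ^ 2 * (z (s l) : ℚ_[p]))
      fun l _ => expBd_coord (s l)).mul hN
      (ExpBd.const (M := Fin k → ℤ_[p]) hN hρ0 _ h2) N
    rwa [one_mul] at h6
  intro N
  refine DiffBd.of_tendsto (l := atTop) hN (F := fun M z => ∑ m ∈ Finset.range M,
    P (m + 1) (fun _ => p ^ n • intPoint p k z) i) (fun z => ?_) (Eventually.of_forall fun M => ?_)
  · have h1 := hP.hasSum (hball z)
    have h2 := (hasSum_nat_add_iff' 1).2 h1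
    have h3 := (h2.map (Pi.evalAddMonoidHom (fun _ : Fin j => ℚ_[p]) i)
      (continuous_apply i)).tendsto_sum_nat
    have h4 : P 0 (fun _ => p ^ n • intPoint p k z) = h u := by
      rw [← hP.coeff_zero (fun _ => 0)]
      congr 1
      funext l
      exact l.elim0
    rw [Finset.sum_range_one, h4] at h3
    exact h3
  · have h1 := DiffBd.sum (Z := Set.univ) (n := N) (s := Finset.range M) hN
      (by positivity : 0 ≤ 1 * ρ ^ N) fun m _ => hterm m N
    convert h1 using 1
    funext z
    simp [Finset.sum_apply]

/-- An analytic map with an integral value at `u` is integral and contracting on a small ball around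
`u`. -/
theorem exists_contracting_of_analyticAt {h : (Fin k → ℚ_[p]) → Fin j → ℚ_[p]}
    {u : Fin k → ℚ_[p]} (hu : AnalyticAt ℚ_[p] h u) (hmem : ‖h u‖ ≤ 1) :
    ∃ (n : ℕ) (G : (Fin k → ℤ_[p]) → Fin j → ℤ_[p]), IsContracting G ∧
      ∀ z, h (u + p ^ n • intPoint p k z) = intPoint p j (G z) := by
  obtain ⟨n, hc, hn⟩ := exists_expBd_of_analyticAt hu
  have hp1 : (1 : ℝ) < p := by exact_mod_cast (Fact.out : p.Prime).one_lt
  have hN := isGauge_norm_padic (p := p)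
  have hexp : ∀ i, ExpBd (fun a : ℚ_[p] => ‖a‖) 1 ((p : ℝ) ^ (-2 : ℤ))
      fun z : Fin k → ℤ_[p] => h (u + p ^ n • intPoint p k z) i := by
    intro i m
    have h1 := (hn i m).add hN (ExpBd.const (M := Fin k → ℤ_[p]) hN
      (by positivity : (0 : ℝ) ≤ (p : ℝ) ^ (-2 : ℤ)) (h u i) ((norm_le_pi_norm _ i).trans hmem) m)
    convert h1 using 1
    funext z
    simp
  have hle : ∀ z i, ‖h (u + p ^ n • intPoint p k z) i‖ ≤ 1 := fun z i => by
    simpa using hexp i 0 z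
  refine ⟨n, fun z i => ⟨_, hle z i⟩, ⟨?_, fun i m => ?_⟩, fun z => rfl⟩
  · exact continuous_pi fun i => Continuous.subtype_mk ((continuous_apply i).comp hc) _
  · exact (hexp i m).of_map (PadicInt.Coe.ringHom (p := p)).toAddMonoidHom fun b hb => hb

end Analytic

/-! ### Balls in analytic manifolds and locally analytic functions -/

section Local

variable {p : ℕ} [Fact p.Prime] {j k : ℕ}
variable {A : Type v} [CommRing A] [UniformSpace A] [IsUniformAddGroup A] [CompleteSpace A]
  [T2Space A] [IsTateRing A] [Algebra ℤ_[p] A] [ContinuousSMul ℤ_[p] A]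
variable {α β : Aˣ}

theorem zpFun_congr (hα : IsTopologicallyNilpotent (α : A))
    (hβ : IsTopologicallyNilpotent (β : A)) : zpFun (A := A) p k α = zpFun p k β := by
  obtain ⟨N, hN⟩ := exists_isGauge A
  ext f
  rw [mem_zpFun_iff hN hα, mem_zpFun_iff hN hβ]

theorem zpFun_comp_contracting (hα : IsTopologicallyNilpotent (α : A))
    {f : (Fin j → ℤ_[p]) → A} (hf : f ∈ zpFun p j α) {G : (Fin k → ℤ_[p]) → Fin j → ℤ_[p]}
    (hG : IsContracting G) : f ∘ G ∈ zpFun p k α := by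
  obtain ⟨N, hN⟩ := exists_isGauge A
  obtain ⟨hcont, C, ρ, hρ, hρ1, hC⟩ := (mem_zpFun_iff hN hα).1 hf
  obtain ⟨K, ρ', -, hρ', hρ'1, h⟩ := exists_expBd_comp (p := p) hN hρ hρ1
  exact (mem_zpFun_iff hN hα).2 ⟨hcont.comp hG.continuous, _, ρ', hρ', hρ'1, h G hG C f hcont hC⟩

theorem zpFun_ball (hα : IsTopologicallyNilpotent (α : A))
    {f : (Fin k → ℤ_[p]) → A} (hf : f ∈ zpFun p k α) (z : Fin k → ℤ_[p]) (n : ℕ) :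
    (fun w => f (z + p ^ n • w)) ∈ zpFun p k α := by
  obtain ⟨N, hN⟩ := exists_isGauge A
  obtain ⟨hcont, C, ρ, hρ, hρ1, hC⟩ := (mem_zpFun_iff hN hα).1 hf
  refine (mem_zpFun_iff hN hα).2 ⟨hcont.comp (isOpenEmbedding_ball z n).continuous, C, ρ, hρ, hρ1,
    fun m => ?_⟩
  have h := ((hC m).translate z).comp_hom (Z' := Set.univ)
    (nsmulAddMonoidHom (p ^ n)) (Set.mapsTo_univ _ _)
  simpa [add_comm z] using h

theorem exists_pow_smul_mem {z : Fin k → ℤ_[p]} {S : Set (Fin k → ℤ_[p])} (hS : S ∈ 𝓝 z) :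
    ∃ n, ∀ w : Fin k → ℤ_[p], z + p ^ n • w ∈ S := by
  obtain ⟨ε, hε, hεS⟩ := Metric.mem_nhds_iff.1 hS
  obtain ⟨n, hn⟩ := PadicInt.exists_pow_neg_lt p hε
  refine ⟨n, fun w => hεS ?_⟩
  rw [Metric.mem_ball, dist_eq_norm, add_sub_cancel_left]
  refine lt_of_le_of_lt ((pi_norm_le_iff_of_nonneg (by positivity)).2 fun i => ?_) hn
  rw [Pi.smul_apply, nsmul_eq_mul, Nat.cast_pow, norm_mul, PadicInt.norm_p_pow]
  exact mul_le_of_le_one_right (by positivity) (PadicInt.norm_le_one _)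

/-- Membership in `𝒜(ℤ_p^k, A)` is a local property. -/
theorem zpFun_of_local (hα : IsTopologicallyNilpotent (α : A)) {f : (Fin k → ℤ_[p]) → A}
    (h : ∀ z, ∃ n, (fun w => f (z + p ^ n • w)) ∈ zpFun p k α) : f ∈ zpFun p k α := by
  classical
  obtain ⟨N, hN⟩ := exists_isGauge A
  obtain ⟨n, hn⟩ := exists_uniform_radius
    (P := fun z n => (fun w => f (z + p ^ n • w)) ∈ zpFun (A := A) p k α) (fun z n hz w m => by
      have := zpFun_ball hα hz w m
      simpa only [smul_add, add_assoc, pow_add, mul_smul] using this) h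
  choose hcont C ρ hρ hρ1 hC using fun z => (mem_zpFun_iff hN hα).1 (hn z)
  have hfc : Continuous f := continuous_of_balls n hcont
  obtain ⟨t, -, ht⟩ := isCompact_univ.elim_nhds_subcover _
    fun (z : Fin k → ℤ_[p]) _ => ball_mem_nhds z n
  obtain ⟨C', hC'⟩ := (t.image C).bddAbove
  -- finitely many balls cover, so one rate and one constant work for all of them
  obtain ⟨σ, hσ0, hσ1, hσ⟩ : ∃ σ : ℝ, 0 < σ ∧ σ < 1 ∧ ∀ z ∈ t, ρ z ≤ σ := by
    clear ht hC'
    induction t using Finset.induction_on with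
    | empty => exact ⟨1 / 2, by norm_num, by norm_num, by simp⟩
    | insert a s ha ih =>
      obtain ⟨σ, h0, h1, h2⟩ := ih
      refine ⟨max (ρ a) σ, lt_max_of_lt_right h0, max_lt (hρ1 a) h1, fun z hz => ?_⟩
      rcases Finset.mem_insert.1 hz with rfl | hz
      · exact le_max_left _ _
      · exact (h2 z hz).trans (le_max_right _ _)
  have hball : ∀ y, ExpBd N (max C' 0) σ fun w => f (y + p ^ n • w) := by
    intro y m
    obtain ⟨z, hz, w, rfl⟩ := Set.mem_iUnion₂.1 (ht (Set.mem_univ y))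
    have h1 : C z ≤ C' := hC' (by
      rw [Finset.coe_image]
      exact ⟨z, hz, rfl⟩)
    have h2 := (((hC z).mono ((hC z).nonneg hN) (hρ z).le (h1.trans (le_max_left C' 0))
      (hσ z hz)) m).translate w
    convert h2 using 1
    funext v
    rw [smul_add, add_assoc, add_comm (p ^ n • v)]
  obtain ⟨K, ρ', -, hρ', hρ'1, h1⟩ := exists_expBd_of_steps (p := p) hN k n hσ0 hσ1
  exact (mem_zpFun_iff hN hα).2 ⟨hfc, _, ρ', hρ', hρ'1, h1 _ f (le_max_right _ _) hfc
    fun a => diffBd_steps_of_balls fun z => hball z a⟩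

end Local

section Ball

variable {p : ℕ} [Fact p.Prime] {j k : ℕ}
variable {Y : Type w} [TopologicalSpace Y] [ChartedSpace (Fin j → ℚ_[p]) Y]

/-- A parametrization by `ℤ_p^j` of an open subset of an analytic manifold, with analytic inverse.
The inverse is given by a coordinate function `κ` on the whole manifold, of which only the germs at
the points of the ball matter. Analyticity of `Q` itself is not needed. -/
structure IsBall (Q : (Fin j → ℤ_[p]) → Y) : Prop where
  continuous : Continuous Q
  injective : Function.Injective Q
  isOpen_range : IsOpen (Set.range Q)
  exists_coord : ∃ κ : Y → Fin j → ℚ_[p], (∀ z, κ (Q z) = intPoint p j z) ∧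
    ∀ z, ContMDiffAt 𝓘(ℚ_[p], Fin j → ℚ_[p]) 𝓘(ℚ_[p], Fin j → ℚ_[p]) ω κ (Q z)

theorem IsBall.isCompact_range {Q : (Fin j → ℤ_[p]) → Y} (hQ : IsBall Q) :
    IsCompact (Set.range Q) := _root_.isCompact_range hQ.continuous

/-- A map that is analytic at all integral points is contracting near those points that are mapped to
the ball, and avoids the ball near the others, because balls are open and closed. -/
theorem goodRel_of_contMDiffAt [T2Space Y] {Q : (Fin j → ℤ_[p]) → Y} (hQ : IsBall Q)
    {Γ : (Fin k → ℚ_[p]) → Y}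
    (hΓ : ∀ z, ContMDiffAt 𝓘(ℚ_[p], Fin k → ℚ_[p]) 𝓘(ℚ_[p], Fin j → ℚ_[p]) ω Γ (intPoint p k z)) :
    GoodRel (fun z => Γ (intPoint p k z)) Q := by
  intro z
  have hcont : Continuous fun z => Γ (intPoint p k z) :=
    continuous_iff_continuousAt.2 fun z =>
      (hΓ z).continuousAt.comp continuous_intPoint.continuousAt
  have hsmall : ∀ S : Set Y, IsOpen S → Γ (intPoint p k z) ∈ S →
      ∃ n, ∀ w, Γ (intPoint p k (z + p ^ n • w)) ∈ S :=
    fun S hS hz => exists_pow_smul_mem ((hS.preimage hcont).mem_nhds hz)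
  by_cases hz : Γ (intPoint p k z) ∈ Set.range Q
  · obtain ⟨κ, hκ, hκ'⟩ := hQ.exists_coord
    obtain ⟨v, hv⟩ := hz
    have h1 : ContDiffAt ℚ_[p] ω (κ ∘ Γ) (intPoint p k z) := by
      rw [← contMDiffAt_iff_contDiffAt]
      refine ContMDiffAt.comp _ ?_ (hΓ z)
      rw [← hv]
      exact hκ' v
    have h2 : ‖(κ ∘ Γ) (intPoint p k z)‖ ≤ 1 := by
      rw [Function.comp_apply, ← hv, hκ]
      exact norm_intPoint_le v
    obtain ⟨n, G, hG, hGn⟩ := exists_contracting_of_analyticAt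
      h1.analyticAt h2
    obtain ⟨m, hm⟩ := hsmall _ hQ.isOpen_range ⟨v, hv⟩
    refine ⟨n + m, Or.inr ⟨_, hG.comp_ball 0 m, fun w => ?_⟩⟩
    have e1 : p ^ (n + m) • w = p ^ n • (p ^ m • w) := by rw [pow_add, mul_smul]
    have e2 : p ^ (n + m) • w = p ^ m • (p ^ n • w) := by rw [add_comm, pow_add, mul_smul]
    obtain ⟨v', hv'⟩ := hm (p ^ n • w)
    rw [← e2] at hv'
    change Γ (intPoint p k (z + p ^ (n + m) • w)) = _
    rw [← hv']
    congr 1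
    apply intPoint_injective
    rw [zero_add, ← hGn, ← hκ, hv']
    change _ = κ (Γ _)
    congr 2
    funext i
    simp [intPoint, e1]
  · obtain ⟨n, hn⟩ := hsmall _ hQ.isCompact_range.isClosed.isOpen_compl hz
    exact ⟨n, Or.inl hn⟩

theorem IsBall.of_chart {c : OpenPartialHomeomorph Y (Fin j → ℚ_[p])}
    [IsManifold 𝓘(ℚ_[p], Fin j → ℚ_[p]) ω Y]
    (hc : c ∈ IsManifold.maximalAtlas 𝓘(ℚ_[p], Fin j → ℚ_[p]) ω Y)
    (ht : c.target = Set.range (intPoint p j)) : IsBall fun z => c.symm (intPoint p j z) := by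
  have hmem : ∀ z, intPoint p j z ∈ c.target := fun z => ht ▸ ⟨z, rfl⟩
  refine ⟨?_, ?_, ?_, c, fun z => c.right_inv (hmem z), fun z =>
    contMDiffAt_of_mem_maximalAtlas hc (c.map_target (hmem z))⟩
  · exact c.continuousOn_symm.comp_continuous continuous_intPoint hmem
  · intro z w h
    apply intPoint_injective
    rw [← c.right_inv (hmem z), ← c.right_inv (hmem w)]
    exact congrArg c h
  · have : (Set.range fun z => c.symm (intPoint p j z)) = c.source := by
      rw [← c.symm_image_target_eq_source, ht, ← Set.range_comp]
      rfl
    rw [this]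
    exact c.open_source

variable {A : Type v} [CommRing A] [UniformSpace A] [IsUniformAddGroup A] [CompleteSpace A]
  [T2Space A] [IsTateRing A] [Algebra ℤ_[p] A] [ContinuousSMul ℤ_[p] A]

/-- Locally analytic functions on a manifold, described without a decomposition: every point lies in
a ball on which the function belongs to `𝒜(ℤ_p^j, A)`. -/
def LocBall (α : Aˣ) (f : Y → A) : Prop :=
  ∀ y, ∃ Q : (Fin j → ℤ_[p]) → Y, IsBall Q ∧ y ∈ Set.range Q ∧ f ∘ Q ∈ zpFun p j α

variable {α β : Aˣ}

/-- Locally analytic functions pull back to locally analytic functions on `ℤ_p^k`. -/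
theorem LocBall.comp_mem_zpFun [T2Space Y] (hα : IsTopologicallyNilpotent (α : A))
    {f : Y → A} (hf : LocBall (p := p) (j := j) α f) {Γ : (Fin k → ℚ_[p]) → Y}
    (hΓ : ∀ z, ContMDiffAt 𝓘(ℚ_[p], Fin k → ℚ_[p]) 𝓘(ℚ_[p], Fin j → ℚ_[p]) ω Γ (intPoint p k z)) :
    (fun z => f (Γ (intPoint p k z))) ∈ zpFun p k α := by
  refine zpFun_of_local hα fun z => ?_
  obtain ⟨Q, hQ, hy, hfQ⟩ := hf (Γ (intPoint p k z))
  obtain ⟨n, hn⟩ := goodRel_of_contMDiffAt hQ hΓ z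
  refine ⟨n, ?_⟩
  rcases hn with hn | ⟨G, hG, hn⟩
  · refine absurd hy ?_
    simpa using hn 0
  · have := zpFun_comp_contracting hα hfQ hG
    convert this using 1
    funext w
    simp only [Function.comp_apply, ← hn w]

section Opens

variable {V U : TopologicalSpace.Opens Y}

theorem IsBall.inclusion (h : V ≤ U) {Q : (Fin j → ℤ_[p]) → V} (hQ : IsBall Q) :
    IsBall (Y := U) fun z => TopologicalSpace.Opens.inclusion h (Q z) := by
  classical
  obtain ⟨κ, hκ, hκ'⟩ := hQ.exists_coord
  have hemb : Topology.IsOpenEmbedding (TopologicalSpace.Opens.inclusion h) :=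
    TopologicalSpace.Opens.isOpenEmbedding_of_le h
  -- the coordinate function is extended by zero; only its germs at points of `V` matter
  let F : Y → Fin j → ℚ_[p] := fun x => if hx : x ∈ V then κ ⟨x, hx⟩ else 0
  refine ⟨hemb.continuous.comp hQ.continuous, hemb.injective.comp hQ.injective, ?_,
    fun x => F x, fun z => ?_, fun z => ?_⟩
  · have : (Set.range fun z => TopologicalSpace.Opens.inclusion h (Q z)) =
        TopologicalSpace.Opens.inclusion h '' Set.range Q := by
      rw [← Set.range_comp]
      rfl
    rw [this]
    exact hemb.isOpenMap _ hQ.isOpen_range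
  · have hz : ((Q z : V) : Y) ∈ V := (Q z).2
    change F (Q z : Y) = _
    rw [← hκ z]
    exact dif_pos hz
  · have h1 : ContMDiffAt 𝓘(ℚ_[p], Fin j → ℚ_[p]) 𝓘(ℚ_[p], Fin j → ℚ_[p]) ω F ((Q z : V) : Y) := by
      rw [← contMDiffAt_subtype_iff]
      have : (fun x : V => F x) = κ := by
        funext x
        exact dif_pos x.2
      rw [this]
      exact hκ' z
    exact contMDiffAt_subtype_iff.2 h1

theorem IsBall.codRestrict (h : V ≤ U) {Q : (Fin j → ℤ_[p]) → U} (hQ : IsBall Q)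
    (hV : ∀ z, (Q z : Y) ∈ V) : IsBall fun z => (⟨Q z, hV z⟩ : V) := by
  obtain ⟨κ, hκ, hκ'⟩ := hQ.exists_coord
  refine ⟨(continuous_subtype_val.comp hQ.continuous).subtype_mk _, fun z w hzw => ?_, ?_,
    fun x => κ (TopologicalSpace.Opens.inclusion h x), fun z => hκ z, fun z => ?_⟩
  · exact hQ.injective (Subtype.ext (congrArg Subtype.val hzw :))
  · have : (Set.range fun z => (⟨Q z, hV z⟩ : V)) =
        TopologicalSpace.Opens.inclusion h ⁻¹' Set.range Q := by
      ext x
      constructor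
      · rintro ⟨z, rfl⟩
        exact ⟨z, rfl⟩
      · rintro ⟨z, hz⟩
        exact ⟨z, Subtype.ext (congrArg Subtype.val hz :)⟩
    rw [this]
    exact hQ.isOpen_range.preimage (continuous_inclusion h)
  · exact ContMDiffAt.comp (x := (⟨Q z, hV z⟩ : V)) (g := κ) (f := TopologicalSpace.Opens.inclusion h)
      (hκ' z) (contMDiff_inclusion h).contMDiffAt

end Opens

end Ball

/-! ### Comparison with decompositions -/

section Decomp

variable {p : ℕ} [Fact p.Prime] {k : ℕ}
variable {X : Type u} [TopologicalSpace X] [ChartedSpace (Fin k → ℚ_[p]) X]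
variable {A : Type v} [CommRing A] [UniformSpace A] [IsUniformAddGroup A] [CompleteSpace A]
  [T2Space A] [IsTateRing A] [Algebra ℤ_[p] A] [ContinuousSMul ℤ_[p] A] {α β : Aˣ}

namespace Decomposition

theorem range_param (d : Decomposition p k X) (i : d.ι) :
    Set.range (d.param i) = (d.chart i).source := by
  rw [← (d.chart i).symm_image_target_eq_source, d.target_eq, ← Set.range_comp]
  rfl

theorem exists_param_eq (d : Decomposition p k X) (x : X) : ∃ i z, d.param i z = x := by
  obtain ⟨i, hi⟩ := Set.mem_iUnion.1 (d.cover.symm ▸ Set.mem_univ x)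
  rw [← d.range_param] at hi
  exact ⟨i, hi⟩

theorem param_eq_imp (d : Decomposition p k X) {i j : d.ι} {z w : Fin k → ℤ_[p]}
    (h : d.param i z = d.param j w) : i = j := by
  by_contra hij
  have h1 : d.param i z ∈ (d.chart i).source := d.range_param i ▸ ⟨z, rfl⟩
  have h2 : d.param i z ∈ (d.chart j).source := d.range_param j ▸ ⟨w, h.symm⟩
  exact Set.disjoint_left.1 (d.pairwise_disjoint hij) h1 h2

theorem isOpen_range_param (d : Decomposition p k X) (i : d.ι) : IsOpen (Set.range (d.param i)) := by
  rw [d.range_param]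
  exact (d.chart i).open_source

theorem continuous_param (d : Decomposition p k X) (i : d.ι) : Continuous (d.param i) :=
  (d.chart i).continuousOn_symm.comp_continuous continuous_intPoint fun z => by
    rw [d.target_eq]
    exact ⟨z, rfl⟩

/-- A compact set meets only finitely many pieces. -/
theorem finite_of_isCompact (d : Decomposition p k X) {K : Set X} (hK : IsCompact K) :
    {i | ∃ z, d.param i z ∈ K}.Finite := by
  obtain ⟨t, ht⟩ := hK.elim_finite_subcover (fun i => Set.range (d.param i)) d.isOpen_range_param
    fun x _ => by
      obtain ⟨i, z, h⟩ := d.exists_param_eq x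
      exact Set.mem_iUnion.2 ⟨i, z, h⟩
  refine t.finite_toSet.subset ?_
  rintro i ⟨z, hz⟩
  obtain ⟨i', hi', z', hz'⟩ := Set.mem_iUnion₂.1 (ht hz)
  rw [d.param_eq_imp hz'.symm]
  exact hi'

variable [IsManifold 𝓘(ℚ_[p], Fin k → ℚ_[p]) ω X]

theorem isBall_param (d : Decomposition p k X) (i : d.ι) : IsBall (d.param i) :=
  IsBall.of_chart (d.chart_mem i) (d.target_eq i)

theorem contMDiffAt_chart_symm (d : Decomposition p k X) (i : d.ι) (z : Fin k → ℤ_[p]) :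
    ContMDiffAt 𝓘(ℚ_[p], Fin k → ℚ_[p]) 𝓘(ℚ_[p], Fin k → ℚ_[p]) ω (d.chart i).symm
      (intPoint p k z) :=
  contMDiffAt_symm_of_mem_maximalAtlas (d.chart_mem i) (by
    rw [d.target_eq]
    exact ⟨z, rfl⟩)

end Decomposition

theorem mem_laFun {d : Decomposition p k X} {f : X → A} :
    f ∈ laFun α d ↔ ∀ i, f ∘ d.param i ∈ zpFun p k α := by
  rw [laFun, Submodule.mem_iInf]
  rfl

variable [IsManifold 𝓘(ℚ_[p], Fin k → ℚ_[p]) ω X] [T2Space X]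

/-- The space `𝒜(X, A)` does not depend on the decomposition. -/
theorem mem_laFun_iff (hα : IsTopologicallyNilpotent (α : A)) {d : Decomposition p k X}
    {f : X → A} : f ∈ laFun α d ↔ LocBall (p := p) (j := k) α f := by
  rw [mem_laFun]
  constructor
  · intro h x
    obtain ⟨i, z, rfl⟩ := d.exists_param_eq x
    exact ⟨d.param i, d.isBall_param i, ⟨z, rfl⟩, h i⟩
  · exact fun h i => h.comp_mem_zpFun hα (d.contMDiffAt_chart_symm i)

theorem LocBall.congr_unit (hα : IsTopologicallyNilpotent (α : A))
    (hβ : IsTopologicallyNilpotent (β : A)) {f : X → A} :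
    LocBall (p := p) (j := k) α f ↔ LocBall (p := p) (j := k) β f := by
  unfold LocBall
  rw [zpFun_congr hα hβ]

/-- For locally analytic functions, vanishing on almost all pieces means having support in a compact
set. -/
theorem mem_laFunC {d : Decomposition p k X} {f : X → A} :
    f ∈ laFunC α d ↔ f ∈ laFun α d ∧ ∃ K, IsCompact K ∧ ∀ x ∉ K, f x = 0 := by
  change f ∈ laFun α d ∧ {i | f ∘ d.param i ≠ 0}.Finite ↔ _
  refine and_congr_right fun _ => ⟨fun h => ?_, ?_⟩
  · refine ⟨⋃ i ∈ {i | f ∘ d.param i ≠ 0}, Set.range (d.param i),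
      h.isCompact_biUnion fun i _ => isCompact_range (d.continuous_param i), fun x hx => ?_⟩
    obtain ⟨i, z, rfl⟩ := d.exists_param_eq x
    by_contra hne
    exact hx (Set.mem_iUnion₂.2 ⟨i, fun h0 => hne (congrFun h0 z), z, rfl⟩)
  · rintro ⟨K, hK, hf⟩
    refine (d.finite_of_isCompact hK).subset fun i hi => ?_
    obtain ⟨z, hz⟩ := Function.ne_iff.1 hi
    exact ⟨z, by_contra fun h => hz (hf _ h)⟩

theorem mem_laFunC_iff (hα : IsTopologicallyNilpotent (α : A)) {d : Decomposition p k X}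
    {f : X → A} : f ∈ laFunC α d ↔
      LocBall (p := p) (j := k) α f ∧ ∃ K, IsCompact K ∧ ∀ x ∉ K, f x = 0 := by
  rw [mem_laFunC, mem_laFun_iff hα]

/-- Extension by zero of a function on a ball is locally analytic. -/
theorem extend_mem_laFun (hα : IsTopologicallyNilpotent (α : A)) (d : Decomposition p k X)
    {Q : (Fin k → ℤ_[p]) → X} (hQ : IsBall Q) {f : (Fin k → ℤ_[p]) → A} (hf : f ∈ zpFun p k α) :
    Function.extend Q f 0 ∈ laFun α d :=
  mem_laFun.2 fun i => extPull_mem_zpFun hα hα hQ.injective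
    (goodRel_of_contMDiffAt hQ (d.contMDiffAt_chart_symm i)) hf

theorem extend_mem_laFunC (hα : IsTopologicallyNilpotent (α : A)) (d : Decomposition p k X)
    {Q : (Fin k → ℤ_[p]) → X} (hQ : IsBall Q) {f : (Fin k → ℤ_[p]) → A} (hf : f ∈ zpFun p k α) :
    Function.extend Q f 0 ∈ laFunC α d :=
  mem_laFunC.2 ⟨extend_mem_laFun hα d hQ hf, _, hQ.isCompact_range, fun _ hx =>
    Function.extend_apply' _ _ _ hx⟩

end Decomp

/-! ### Distributions as linear forms -/

section LinearAlgebra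

variable {R E F W : Type*} [CommRing R] [AddCommMonoid E] [Module R E] [AddCommMonoid F]
  [Module R F] [AddCommMonoid W] [Module R W]

theorem existsUnique_linearMap {ev : F →ₗ[R] W} (hev : Function.Injective ev) (L : E →ₗ[R] W)
    (h : ∀ x, ∃ y, ev y = L x) : ∃! T : E →ₗ[R] F, ∀ x, ev (T x) = L x := by
  choose T hT using h
  refine ⟨⟨⟨T, fun x y => hev ?_⟩, fun a x => hev ?_⟩, hT, fun T' hT' => ?_⟩
  · rw [hT, map_add, map_add, hT, hT]
  · rw [RingHom.id_apply, hT, map_smul, map_smul, hT]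
  · ext x
    exact hev ((hT' x).trans (hT x).symm)

theorem existsUnique_linearEquiv {ev : F →ₗ[R] W} (hev : Function.Injective ev) {L : E →ₗ[R] W}
    (hL : Function.Injective L) (h : ∀ x, ∃ y, ev y = L x) (h' : ∀ y, ∃ x, L x = ev y) :
    ∃! T : E ≃ₗ[R] F, ∀ x, ev (T x) = L x := by
  obtain ⟨T, hT, -⟩ := existsUnique_linearMap hev L h
  refine ⟨LinearEquiv.ofBijective T ⟨fun x y hxy => hL ?_, fun y => ?_⟩, hT, fun T' hT' => ?_⟩
  · rw [← hT, ← hT, hxy]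
  · obtain ⟨x, hx⟩ := h' y
    exact ⟨x, hev ((hT x).trans hx)⟩
  · ext x
    exact hev ((hT' x).trans (hT x).symm)

end LinearAlgebra

section Dist

variable {p : ℕ} [Fact p.Prime] {k : ℕ}
variable {X : Type u} [TopologicalSpace X] [ChartedSpace (Fin k → ℚ_[p]) X]
variable {A : Type v} [CommRing A] [UniformSpace A] [IsUniformAddGroup A] [CompleteSpace A]
  [T2Space A] [IsTateRing A] [Algebra ℤ_[p] A] [ContinuousSMul ℤ_[p] A] {α β : Aˣ}

section Eval

variable {d : Decomposition p k X}

theorem DistC.eval_eq_sum (φ : DistC α d) (f : laFunC α d) {s : Finset d.ι}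
    (hs : ∀ i ∉ s, f.1 ∘ d.param i = 0) :
    φ.eval f = ∑ i ∈ s, (φ i).1 (laFun.piece ⟨f.1, laFunC_le f.2⟩ i) := by
  refine finsum_eq_sum_of_support_subset _ fun i hi => ?_
  by_contra h
  refine hi ?_
  have : laFun.piece ⟨f.1, laFunC_le f.2⟩ i = 0 := Subtype.ext (hs i h)
  beta_reduce
  rw [this, map_zero]

theorem exists_finset_laFunC (f : laFunC α d) :
    ∃ s : Finset d.ι, ∀ i ∉ s, f.1 ∘ d.param i = 0 :=
  ⟨f.2.2.toFinset, fun i hi => by simpa using hi⟩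

theorem Dist.eval_eq_sum (φ : Dist α d) (f : laFun α d) {s : Finset d.ι}
    (hs : ∀ i ∉ s, φ i = 0) : φ.eval f = ∑ i ∈ s, (φ i).1 (laFun.piece f i) := by
  refine finsum_eq_sum_of_support_subset _ fun i hi => ?_
  by_contra h
  refine hi ?_
  beta_reduce
  rw [hs i h]
  rfl

theorem Dist.exists_finset (φ : Dist α d) : ∃ s : Finset d.ι, ∀ i ∉ s, φ i = 0 :=
  ⟨(DFinsupp.finite_support φ).toFinset, fun i hi => by simpa using hi⟩

/-- Evaluation as a bilinear map. -/
def Dist.evalHom (α : Aˣ) (d : Decomposition p k X) : Dist α d →ₗ[A] laFun α d →ₗ[A] A := by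
  classical
  refine LinearMap.mk₂ A Dist.eval (fun φ ψ f => ?_) (fun a φ f => ?_) (fun φ f g => ?_)
    fun a φ f => ?_
  · obtain ⟨s, hs⟩ := φ.exists_finset
    obtain ⟨t, ht⟩ := ψ.exists_finset
    have hs' : ∀ i ∉ s ∪ t, φ i = 0 := fun i hi => hs i fun h => hi (Finset.mem_union_left _ h)
    have ht' : ∀ i ∉ s ∪ t, ψ i = 0 := fun i hi => ht i fun h => hi (Finset.mem_union_right _ h)
    rw [φ.eval_eq_sum f hs', ψ.eval_eq_sum f ht', ← Finset.sum_add_distrib,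
      (φ + ψ).eval_eq_sum f fun i hi => by
        rw [DirectSum.add_apply, hs' i hi, ht' i hi, add_zero]]
    rfl
  · obtain ⟨s, hs⟩ := φ.exists_finset
    rw [φ.eval_eq_sum f hs, (a • φ).eval_eq_sum f fun i hi => by
      rw [DirectSum.smul_apply, hs i hi, smul_zero], Finset.smul_sum]
    rfl
  · obtain ⟨s, hs⟩ := φ.exists_finset
    rw [φ.eval_eq_sum _ hs, φ.eval_eq_sum _ hs, φ.eval_eq_sum _ hs, ← Finset.sum_add_distrib]
    exact Finset.sum_congr rfl fun i _ => map_add (φ i).1 (laFun.piece f i) (laFun.piece g i)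
  · obtain ⟨s, hs⟩ := φ.exists_finset
    rw [φ.eval_eq_sum _ hs, φ.eval_eq_sum _ hs, Finset.smul_sum]
    exact Finset.sum_congr rfl fun i _ => map_smul (φ i).1 a (laFun.piece f i)

/-- Evaluation as a bilinear map. -/
def DistC.evalHom (α : Aˣ) (d : Decomposition p k X) : DistC α d →ₗ[A] laFunC α d →ₗ[A] A := by
  classical
  refine LinearMap.mk₂ A DistC.eval (fun φ ψ f => ?_) (fun a φ f => ?_) (fun φ f g => ?_)
    fun a φ f => ?_
  · obtain ⟨s, hs⟩ := exists_finset_laFunC f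
    rw [DistC.eval_eq_sum _ f hs, DistC.eval_eq_sum _ f hs, DistC.eval_eq_sum _ f hs,
      ← Finset.sum_add_distrib]
    rfl
  · obtain ⟨s, hs⟩ := exists_finset_laFunC f
    rw [DistC.eval_eq_sum _ f hs, DistC.eval_eq_sum _ f hs, Finset.smul_sum]
    rfl
  · obtain ⟨s, hs⟩ := exists_finset_laFunC f
    obtain ⟨t, ht⟩ := exists_finset_laFunC g
    have hs' : ∀ i ∉ s ∪ t, f.1 ∘ d.param i = 0 :=
      fun i hi => hs i fun h => hi (Finset.mem_union_left _ h)
    have ht' : ∀ i ∉ s ∪ t, g.1 ∘ d.param i = 0 :=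
      fun i hi => ht i fun h => hi (Finset.mem_union_right _ h)
    rw [φ.eval_eq_sum f hs', φ.eval_eq_sum g ht', ← Finset.sum_add_distrib,
      φ.eval_eq_sum (f + g) (s := s ∪ t) fun i hi => by
        change f.1 ∘ d.param i + g.1 ∘ d.param i = 0
        rw [hs' i hi, ht' i hi, add_zero]]
    exact Finset.sum_congr rfl fun i _ => map_add (φ i).1 (laFun.piece ⟨f.1, laFunC_le f.2⟩ i)
      (laFun.piece ⟨g.1, laFunC_le g.2⟩ i)
  · obtain ⟨s, hs⟩ := exists_finset_laFunC f
    rw [φ.eval_eq_sum f hs, Finset.smul_sum, φ.eval_eq_sum (a • f) (s := s) fun i hi => by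
        change a • (f.1 ∘ d.param i) = 0
        rw [hs i hi, smul_zero]]
    exact Finset.sum_congr rfl fun i _ =>
      map_smul (φ i).1 a (laFun.piece ⟨f.1, laFunC_le f.2⟩ i)

theorem Dist.evalHom_apply (φ : Dist α d) (f : laFun α d) : Dist.evalHom α d φ f = φ.eval f := rfl

theorem DistC.evalHom_apply (φ : DistC α d) (f : laFunC α d) :
    DistC.evalHom α d φ f = φ.eval f := rfl

end Eval

variable [IsManifold 𝓘(ℚ_[p], Fin k → ℚ_[p]) ω X] [T2Space X]

theorem extend_param_comp (d : Decomposition p k X) (i : d.ι) (h : (Fin k → ℤ_[p]) → A) :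
    Function.extend (d.param i) h 0 ∘ d.param i = h :=
  funext fun z => (d.isBall_param i).injective.extend_apply _ _ z

theorem extend_param_comp_of_ne (d : Decomposition p k X) {i l : d.ι} (hil : i ≠ l)
    (h : (Fin k → ℤ_[p]) → A) : Function.extend (d.param i) h 0 ∘ d.param l = 0 :=
  funext fun _ => Function.extend_apply' _ _ _ fun ⟨_, hw⟩ => hil (d.param_eq_imp hw)

/-- Extension by zero from a ball, as a linear map. -/
def extBall (hα : IsTopologicallyNilpotent (α : A)) (hβ : IsTopologicallyNilpotent (β : A))
    (d : Decomposition p k X) {Q : (Fin k → ℤ_[p]) → X} (hQ : IsBall Q) :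
    zpFun (A := A) p k β →ₗ[A] laFunC α d where
  toFun h := ⟨Function.extend Q h.1 0,
    extend_mem_laFunC hα d hQ (by rw [zpFun_congr hα hβ]; exact h.2)⟩
  map_add' f g := Subtype.ext (by simpa using Function.extend_add Q f.1 g.1 0 0)
  map_smul' a f := Subtype.ext (by simpa using Function.extend_smul a Q f.1 0)

/-- On the pieces in `s`, a function agrees with the sum over `s` of the extensions by zero of its
restrictions. -/
theorem sum_extend_pieces (d : Decomposition p k X) (f : X → A) (s : Finset d.ι) {i : d.ι}
    (hi : i ∈ s) (z : Fin k → ℤ_[p]) :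
    (∑ l ∈ s, Function.extend (d.param l) (f ∘ d.param l) 0) (d.param i z) = f (d.param i z) := by
  rw [Finset.sum_apply, Finset.sum_eq_single_of_mem i hi]
  · exact congrFun (extend_param_comp d i (f ∘ d.param i)) z
  · exact fun l _ hl => congrFun (extend_param_comp_of_ne d hl (f ∘ d.param l)) z

/-- The components of an element of `𝒟_c` are recovered from its values on functions supported on one
piece. -/
theorem DistC.eval_extend (hα : IsTopologicallyNilpotent (α : A)) {d : Decomposition p k X}
    (φ : DistC α d) (i : d.ι) (h : zpFun p k α) :
    φ.eval (extBall hα hα d (d.isBall_param i) h) = (φ i).1 h := by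
  rw [φ.eval_eq_sum (s := {i}) _ fun l hl => extend_param_comp_of_ne d
    (fun e => hl (by simp [e])) h.1, Finset.sum_singleton]
  congr 1
  exact Subtype.ext (extend_param_comp d i h.1)

theorem DistC.evalHom_injective (hα : IsTopologicallyNilpotent (α : A))
    (d : Decomposition p k X) : Function.Injective (DistC.evalHom α d) := by
  intro φ ψ h
  funext i
  ext x
  rw [← φ.eval_extend hα, ← ψ.eval_extend hα]
  exact LinearMap.congr_fun h _

theorem Dist.eval_extend (hα : IsTopologicallyNilpotent (α : A)) {d : Decomposition p k X}
    (φ : Dist α d) (i : d.ι) (h : zpFun p k α) :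
    φ.eval ⟨_, laFunC_le (extBall hα hα d (d.isBall_param i) h).2⟩ = (φ i).1 h := by
  refine (finsum_eq_single _ i fun l hl => ?_).trans ?_
  · have : laFun.piece ⟨_, laFunC_le (extBall hα hα d (d.isBall_param i) h).2⟩ l = 0 :=
      Subtype.ext (extend_param_comp_of_ne d hl.symm h.1)
    rw [this, map_zero]
  · congr 1
    exact Subtype.ext (extend_param_comp d i h.1)

theorem Dist.evalHom_injective (hα : IsTopologicallyNilpotent (α : A))
    (d : Decomposition p k X) : Function.Injective (Dist.evalHom α d) := by
  intro φ ψ h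
  refine DFinsupp.ext fun i => ?_
  ext x
  refine (φ.eval_extend hα i x).symm.trans ((LinearMap.congr_fun h _).trans (ψ.eval_extend hα i x))

/-- A linear form on `𝒜_c(X, A)` that restricts to a distribution on each piece is given by an
element of `𝒟_c(X, A)`. -/
theorem DistC.exists_eval_eq (hα : IsTopologicallyNilpotent (α : A)) (d : Decomposition p k X)
    (L : laFunC (A := A) α d →ₗ[A] A)
    (h : ∀ i, L ∘ₗ extBall hα hα d (d.isBall_param i) ∈ zpDist p k α) :
    ∃ φ, DistC.evalHom α d φ = L := by
  refine ⟨fun i => ⟨_, h i⟩, LinearMap.ext fun f => ?_⟩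
  obtain ⟨s, hs⟩ := exists_finset_laFunC f
  rw [DistC.evalHom_apply, DistC.eval_eq_sum _ f hs]
  simp only [LinearMap.comp_apply]
  rw [← map_sum]
  congr 1
  refine Subtype.ext (funext fun x => ?_)
  rw [AddSubmonoidClass.coe_finsetSum]
  obtain ⟨i, z, rfl⟩ := d.exists_param_eq x
  by_cases hi : i ∈ s
  · exact sum_extend_pieces d f.1 s hi z
  · have h1 : f.1 (d.param i z) = 0 := congrFun (hs i hi) z
    rw [h1, Finset.sum_apply]
    exact Finset.sum_eq_zero fun l hl =>
      congrFun (extend_param_comp_of_ne d (fun e => hi (by rwa [← e])) _) z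

/-- A linear form on `𝒜(X, A)` that only depends on finitely many pieces, and restricts to a
distribution on each of them, is given by an element of `𝒟(X, A)`. -/
theorem Dist.exists_eval_eq (hα : IsTopologicallyNilpotent (α : A)) (d : Decomposition p k X)
    (L : laFun (A := A) α d →ₗ[A] A) (s : Finset d.ι)
    (hs : ∀ f, (∀ i ∈ s, f.1 ∘ d.param i = 0) → L f = 0)
    (h : ∀ i, L ∘ₗ Submodule.inclusion laFunC_le ∘ₗ extBall hα hα d (d.isBall_param i) ∈
      zpDist p k α) :
    ∃ φ, Dist.evalHom α d φ = L := by
  classical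
  let φ : Dist α d := DFinsupp.mk s fun i => ⟨_, h i⟩
  have hφ : ∀ i ∈ s, φ i = ⟨_, h i⟩ := fun i hi => DFinsupp.mk_of_mem hi
  refine ⟨φ, LinearMap.ext fun f => ?_⟩
  rw [Dist.evalHom_apply, Dist.eval_eq_sum φ f (s := s) fun i hi => DFinsupp.mk_of_notMem hi]
  rw [Finset.sum_congr rfl fun i hi => by rw [hφ i hi]]
  simp only [LinearMap.comp_apply]
  rw [← map_sum, ← sub_eq_zero, ← map_sub]
  refine hs _ fun i hi => funext fun z => ?_
  refine sub_eq_zero.2 ?_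
  rw [AddSubmonoidClass.coe_finsetSum]
  exact sum_extend_pieces d f.1 s hi z

/-- Elements of `𝒟_c` restrict to distributions on arbitrary balls, not only on the pieces of the
decomposition: a ball meets finitely many pieces. -/
theorem DistC.comp_extBall_mem (hα : IsTopologicallyNilpotent (α : A))
    (hβ : IsTopologicallyNilpotent (β : A)) {d : Decomposition p k X} (φ : DistC α d)
    {Q : (Fin k → ℤ_[p]) → X} (hQ : IsBall Q) :
    DistC.evalHom α d φ ∘ₗ extBall hα hβ d hQ ∈ zpDist p k β := by
  have hfin := d.finite_of_isCompact hQ.isCompact_range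
  have hgood := fun i => goodRel_of_contMDiffAt hQ (d.contMDiffAt_chart_symm i)
  have : DistC.evalHom α d φ ∘ₗ extBall hα hβ d hQ = ∑ i ∈ hfin.toFinset,
      (φ i).1 ∘ₗ (extPull A (d.param i) Q).restrict
        (fun _ => extPull_mem_zpFun hα hβ hQ.injective (hgood i)) := by
    ext h
    rw [LinearMap.sum_apply]
    refine (φ.eval_eq_sum _ fun i hi => funext fun z => ?_).trans rfl
    refine Function.extend_apply' _ _ _ fun hz => hi ?_
    rw [Set.Finite.mem_toFinset]
    exact ⟨z, hz⟩
  rw [this]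
  exact Submodule.sum_mem _ fun i _ =>
    comp_extPull_mem_zpDist hα hβ hQ.injective (hgood i) (φ i).2

end Dist

section Transfer

variable {p : ℕ} [Fact p.Prime] {k j : ℕ}
variable {X : Type u} [TopologicalSpace X] [ChartedSpace (Fin k → ℚ_[p]) X]
  [IsManifold 𝓘(ℚ_[p], Fin k → ℚ_[p]) ω X] [T2Space X]
variable {Y : Type w} [TopologicalSpace Y] [ChartedSpace (Fin j → ℚ_[p]) Y]
  [IsManifold 𝓘(ℚ_[p], Fin j → ℚ_[p]) ω Y] [T2Space Y]
variable {A : Type v} [CommRing A] [UniformSpace A] [IsUniformAddGroup A] [CompleteSpace A]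
  [T2Space A] [IsTateRing A] [Algebra ℤ_[p] A] [ContinuousSMul ℤ_[p] A] {α β : Aˣ}

theorem laFun_congr (hα : IsTopologicallyNilpotent (α : A))
    (hβ : IsTopologicallyNilpotent (β : A)) (d d' : Decomposition p k X) :
    laFun (A := A) α d = laFun β d' := by
  ext f
  rw [mem_laFun_iff hα, mem_laFun_iff hβ, LocBall.congr_unit hα hβ]

theorem laFunC_congr (hα : IsTopologicallyNilpotent (α : A))
    (hβ : IsTopologicallyNilpotent (β : A)) (d d' : Decomposition p k X) :
    laFunC (A := A) α d = laFunC β d' := by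
  ext f
  rw [mem_laFunC_iff hα, mem_laFunC_iff hβ, LocBall.congr_unit hα hβ]

theorem comp_mem_laFun (hα : IsTopologicallyNilpotent (α : A)) (hβ : IsTopologicallyNilpotent (β : A))
    (d : Decomposition p k X)
    (d' : Decomposition p j Y) {g : X → Y}
    (hg : ContMDiff 𝓘(ℚ_[p], Fin k → ℚ_[p]) 𝓘(ℚ_[p], Fin j → ℚ_[p]) ω g) {f : Y → A}
    (hf : f ∈ laFun β d') : f ∘ g ∈ laFun α d := by
  have h := (mem_laFun_iff hβ).1 hf
  refine mem_laFun.2 fun i => ?_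
  rw [zpFun_congr hα hβ]
  exact h.comp_mem_zpFun hβ fun z =>
    hg.contMDiffAt.comp _ (d.contMDiffAt_chart_symm i z)

/-- Pullback of locally analytic functions. -/
def laFunPull (hα : IsTopologicallyNilpotent (α : A)) (hβ : IsTopologicallyNilpotent (β : A))
    (d : Decomposition p k X)
    (d' : Decomposition p j Y) {g : X → Y}
    (hg : ContMDiff 𝓘(ℚ_[p], Fin k → ℚ_[p]) 𝓘(ℚ_[p], Fin j → ℚ_[p]) ω g) :
    laFun (A := A) β d' →ₗ[A] laFun α d :=
  (LinearMap.funLeft A A g).restrict fun _ hf => comp_mem_laFun hα hβ d d' hg hf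

/-- The linear form `f ↦ φ(f ∘ g)` is given by an element of `𝒟(Y, A)`. -/
theorem Dist.exists_push (hα : IsTopologicallyNilpotent (α : A))
    (hβ : IsTopologicallyNilpotent (β : A)) (d : Decomposition p k X)
    (d' : Decomposition p j Y) {g : X → Y}
    (hg : ContMDiff 𝓘(ℚ_[p], Fin k → ℚ_[p]) 𝓘(ℚ_[p], Fin j → ℚ_[p]) ω g) (φ : Dist α d) :
    ∃ ψ, Dist.evalHom β d' ψ = Dist.evalHom α d φ ∘ₗ laFunPull hα hβ d d' hg := by
  classical
  obtain ⟨s, hs⟩ := φ.exists_finset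
  -- the image of the finitely many pieces that support the distribution is compact
  have hcomp : IsCompact (⋃ i ∈ s, Set.range (g ∘ d.param i)) :=
    s.isCompact_biUnion fun i _ => isCompact_range (hg.continuous.comp (d.continuous_param i))
  have hfin := d'.finite_of_isCompact hcomp
  refine Dist.exists_eval_eq hβ d' _ hfin.toFinset (fun f hf => ?_) fun i => ?_
  · refine (φ.eval_eq_sum _ hs).trans (Finset.sum_eq_zero fun i hi => ?_)
    have : laFun.piece (laFunPull hα hβ d d' hg f) i = 0 := by
      refine Subtype.ext (funext fun z => ?_)
      obtain ⟨l, w, hl⟩ := d'.exists_param_eq (g (d.param i z))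
      have h1 : f.1 (d'.param l w) = 0 := congrFun (hf l ((Set.Finite.mem_toFinset hfin).2
        ⟨w, Set.mem_iUnion₂.2 ⟨i, hi, z, hl.symm⟩⟩)) w
      rw [hl] at h1
      exact h1
    rw [this, map_zero]
  · have hgood := fun l => goodRel_of_contMDiffAt (d'.isBall_param i)
      (Γ := g ∘ (d.chart l).symm) fun z => hg.contMDiffAt.comp _ (d.contMDiffAt_chart_symm l z)
    have : (Dist.evalHom α d φ ∘ₗ laFunPull hα hβ d d' hg) ∘ₗ Submodule.inclusion laFunC_le ∘ₗ
        extBall hβ hβ d' (d'.isBall_param i) = ∑ l ∈ s,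
        (φ l).1 ∘ₗ (extPull A (g ∘ d.param l) (d'.param i)).restrict
          (fun _ => extPull_mem_zpFun hα hβ (d'.isBall_param i).injective (hgood l)) := by
      ext h
      rw [LinearMap.sum_apply]
      exact (φ.eval_eq_sum _ hs).trans rfl
    rw [this]
    exact Submodule.sum_mem _ fun l _ =>
      comp_extPull_mem_zpDist hα hβ (d'.isBall_param i).injective (hgood l) (φ l).2

theorem Dist.existsUnique_push (hα : IsTopologicallyNilpotent (α : A))
    (hβ : IsTopologicallyNilpotent (β : A)) (d : Decomposition p k X)
    (d' : Decomposition p j Y) {g : X → Y}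
    (hg : ContMDiff 𝓘(ℚ_[p], Fin k → ℚ_[p]) 𝓘(ℚ_[p], Fin j → ℚ_[p]) ω g) :
    ∃! push : Dist α d →ₗ[A] Dist β d', ∀ φ f,
      (push φ).eval f = φ.eval (laFunPull hα hβ d d' hg f) := by
  have := existsUnique_linearMap (Dist.evalHom_injective hβ d')
    ((LinearMap.lcomp A A (laFunPull hα hβ d d' hg)) ∘ₗ Dist.evalHom α d)
    fun φ => by exact Dist.exists_push hα hβ d d' hg φ
  refine (existsUnique_congr fun T => ?_).1 this
  exact ⟨fun h φ f => LinearMap.congr_fun (h φ) f, fun h φ => LinearMap.ext (h φ)⟩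

theorem Dist.existsUnique_equiv (hα : IsTopologicallyNilpotent (α : A))
    (hβ : IsTopologicallyNilpotent (β : A)) (d d' : Decomposition p k X) :
    ∃! e : Dist (A := A) α d ≃ₗ[A] Dist β d', ∀ (φ : Dist α d) (f : X → A) (hf : f ∈ laFun α d)
      (hf' : f ∈ laFun β d'), (e φ).eval ⟨f, hf'⟩ = φ.eval ⟨f, hf⟩ := by
  have hid : ContMDiff 𝓘(ℚ_[p], Fin k → ℚ_[p]) 𝓘(ℚ_[p], Fin k → ℚ_[p]) ω (id : X → X) :=
    contMDiff_id
  have := existsUnique_linearEquiv (Dist.evalHom_injective hβ d')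
    (L := (LinearMap.lcomp A A (laFunPull hα hβ d d' hid)) ∘ₗ Dist.evalHom α d)
    (fun φ ψ h => ?_) (fun φ => by exact Dist.exists_push hα hβ d d' hid φ) fun φ => ?_
  · refine (existsUnique_congr fun e => ?_).1 this
    constructor
    · exact fun h φ f hf hf' => LinearMap.congr_fun (h φ) ⟨f, hf'⟩
    · exact fun h φ => LinearMap.ext fun f => h φ f.1 _ f.2
  · refine Dist.evalHom_injective hα d (LinearMap.ext fun f => ?_)
    exact LinearMap.congr_fun h ⟨f.1, laFun_congr hα hβ d d' ▸ f.2⟩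
  · obtain ⟨ψ, hψ⟩ := Dist.exists_push hβ hα d' d hid φ
    refine ⟨ψ, LinearMap.ext fun f => ?_⟩
    exact LinearMap.congr_fun hψ ⟨f.1, (laFun_congr hα hβ d d').ge f.2⟩

theorem DistC.exists_congr (hα : IsTopologicallyNilpotent (α : A))
    (hβ : IsTopologicallyNilpotent (β : A)) (d d' : Decomposition p k X) (φ : DistC α d) :
    ∃ ψ, DistC.evalHom β d' ψ = DistC.evalHom α d φ ∘ₗ
      Submodule.inclusion (laFunC_congr hβ hα d' d).le :=
  DistC.exists_eval_eq hβ d' _ fun i => φ.comp_extBall_mem hα hβ (d'.isBall_param i)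

theorem DistC.existsUnique_equiv (hα : IsTopologicallyNilpotent (α : A))
    (hβ : IsTopologicallyNilpotent (β : A)) (d d' : Decomposition p k X) :
    ∃! e : DistC (A := A) α d ≃ₗ[A] DistC β d', ∀ (φ : DistC α d) (f : X → A)
      (hf : f ∈ laFunC α d) (hf' : f ∈ laFunC β d'), (e φ).eval ⟨f, hf'⟩ = φ.eval ⟨f, hf⟩ := by
  have := existsUnique_linearEquiv (DistC.evalHom_injective hβ d')
    (L := (LinearMap.lcomp A A (Submodule.inclusion (laFunC_congr hβ hα d' d).le)) ∘ₗ
      DistC.evalHom α d)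
    (fun φ ψ h => ?_) (fun φ => by exact DistC.exists_congr hα hβ d d' φ) fun φ => ?_
  · refine (existsUnique_congr fun e => ?_).1 this
    constructor
    · exact fun h φ f hf hf' => LinearMap.congr_fun (h φ) ⟨f, hf'⟩
    · exact fun h φ => LinearMap.ext fun f => h φ f.1 _ f.2
  · refine DistC.evalHom_injective hα d (LinearMap.ext fun f => ?_)
    exact LinearMap.congr_fun h ⟨f.1, laFunC_congr hα hβ d d' ▸ f.2⟩
  · obtain ⟨ψ, hψ⟩ := DistC.exists_congr hβ hα d' d φ
    refine ⟨ψ, LinearMap.ext fun f => ?_⟩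
    exact LinearMap.congr_fun hψ ⟨f.1, (laFunC_congr hα hβ d d').ge f.2⟩

theorem exists_subalgebra (hα : IsTopologicallyNilpotent (α : A)) (d : Decomposition p k X) :
    ∃ S : Subalgebra A (X → A), Subalgebra.toSubmodule S = laFun α d := by
  obtain ⟨N, hN⟩ := exists_isGauge A
  refine ⟨(laFun α d).toSubalgebra ?_ ?_, rfl⟩
  · refine mem_laFun.2 fun i => (mem_zpFun_iff hN hα).2
      ⟨continuous_const, N 1, 1 / 2, by norm_num, by norm_num, ?_⟩
    exact ExpBd.const hN (by norm_num) 1 le_rfl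
  · intro f g hf hg
    refine mem_laFun.2 fun i => (mem_zpFun_iff hN hα).2 ?_
    obtain ⟨hfc, C, ρ, hρ, hρ1, h⟩ := (mem_zpFun_iff hN hα).1 (mem_laFun.1 hf i)
    obtain ⟨hgc, C', ρ', hρ', hρ'1, h'⟩ := (mem_zpFun_iff hN hα).1 (mem_laFun.1 hg i)
    refine ⟨hfc.mul hgc, C * C', max ρ ρ', lt_max_of_lt_left hρ, max_lt hρ1 hρ'1, ?_⟩
    exact (h.mono (h.nonneg hN) hρ.le le_rfl (le_max_left _ _)).mul hN
      (h'.mono (h'.nonneg hN) hρ'.le le_rfl (le_max_right _ _))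

end Transfer

/-! ### Existence of decompositions -/

section Existence

variable {p : ℕ} [Fact p.Prime] {k : ℕ}
variable {X : Type u} [TopologicalSpace X] [ChartedSpace (Fin k → ℚ_[p]) X]

/-- The closed ball of radius `p^(-n)` in `ℚ_p^k`. -/
def padicBall (u : Fin k → ℚ_[p]) (n : ℕ) : Set (Fin k → ℚ_[p]) :=
  Metric.closedBall u ((p : ℝ) ^ (-n : ℤ))

theorem isOpen_padicBall (u : Fin k → ℚ_[p]) (n : ℕ) : IsOpen (padicBall u n) :=
  IsUltrametricDist.isOpen_closedBall _
    (zpow_ne_zero _ (Nat.cast_ne_zero.2 (Fact.out : p.Prime).ne_zero))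

theorem mem_padicBall_self (u : Fin k → ℚ_[p]) (n : ℕ) : u ∈ padicBall u n :=
  Metric.mem_closedBall_self (by positivity)

theorem padicBall_eq_of_mem {u x : Fin k → ℚ_[p]} {n : ℕ} (h : x ∈ padicBall u n) :
    padicBall x n = padicBall u n :=
  (IsUltrametricDist.closedBall_eq_of_mem h).symm

theorem padicBall_subset {m n : ℕ} (h : m ≤ n) (u : Fin k → ℚ_[p]) :
    padicBall u n ⊆ padicBall u m :=
  Metric.closedBall_subset_closedBall (zpow_le_zpow_right₀
    (Nat.one_le_cast.2 (Fact.out : p.Prime).one_le) (by omega))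

theorem exists_padicBall_subset {S : Set (Fin k → ℚ_[p])} (hS : IsOpen S) {u : Fin k → ℚ_[p]}
    (hu : u ∈ S) : ∃ n, padicBall u n ⊆ S := by
  obtain ⟨ε, hε, h⟩ := Metric.isOpen_iff.1 hS u hu
  obtain ⟨n, hn⟩ := PadicInt.exists_pow_neg_lt p hε
  exact ⟨n, (Metric.closedBall_subset_ball hn).trans h⟩

theorem exists_chart_ball_subset {c : OpenPartialHomeomorph X (Fin k → ℚ_[p])} {x : X}
    (hx : x ∈ c.source) {S : Set X} (hS : IsOpen S) (hxS : x ∈ S) :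
    ∃ n, padicBall (c x) n ⊆ c.target ∧ c.source ∩ c ⁻¹' padicBall (c x) n ⊆ S := by
  obtain ⟨n, hn⟩ := exists_padicBall_subset (c.isOpen_inter_preimage_symm hS) (u := c x)
    ⟨c.map_source hx, by simpa [c.left_inv hx] using hxS⟩
  refine ⟨n, fun y hy => (hn hy).1, fun y hy => ?_⟩
  have := (hn hy.2).2
  rwa [Set.mem_preimage, c.left_inv hy.1] at this

/-- A ball in a chart is the source of a chart with image `ℤ_p^k`. -/
theorem exists_chart_padicBall [IsManifold 𝓘(ℚ_[p], Fin k → ℚ_[p]) ω X]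
    {c : OpenPartialHomeomorph X (Fin k → ℚ_[p])}
    (hc : c ∈ IsManifold.maximalAtlas 𝓘(ℚ_[p], Fin k → ℚ_[p]) ω X) {u : Fin k → ℚ_[p]} {n : ℕ}
    (h : padicBall u n ⊆ c.target) :
    ∃ c' ∈ IsManifold.maximalAtlas 𝓘(ℚ_[p], Fin k → ℚ_[p]) ω X,
      c'.source = c.source ∩ c ⁻¹' padicBall u n ∧ c'.target = Set.range (intPoint p k) := by
  have hp0 : (p : ℚ_[p]) ^ n ≠ 0 := pow_ne_zero _ (Nat.cast_ne_zero.2 (Fact.out : p.Prime).ne_zero)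
  have hp1 : (0 : ℝ) < p := Nat.cast_pos.2 (Fact.out : p.Prime).pos
  let e : (Fin k → ℚ_[p]) ≃ₜ (Fin k → ℚ_[p]) :=
    (Homeomorph.subRight u).trans (Homeomorph.smulOfNeZero ((p : ℚ_[p]) ^ n)⁻¹ (inv_ne_zero hp0))
  have he : ∀ x, x ∈ padicBall u n ↔ e x ∈ Set.range (intPoint p k) := fun x => by
    change _ ↔ ((p : ℚ_[p]) ^ n)⁻¹ • (x - u) ∈ _
    rw [mem_range_intPoint, norm_smul, norm_inv, norm_pow, Padic.norm_p, padicBall,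
      mem_closedBall_iff_norm, inv_pow, inv_inv, zpow_neg, zpow_natCast, inv_eq_one_div,
      le_div_iff₀ (by positivity), mul_comm]
  have hS : IsOpen (c.source ∩ c ⁻¹' padicBall u n) := c.isOpen_inter_preimage (isOpen_padicBall u n)
  refine ⟨(c.transHomeomorph e).restrOpen _ hS, ?_, ?_, ?_⟩
  · refine OpenPartialHomeomorph.mem_maximalAtlas_of_contMDiffOn _ ?_ ?_
    · have h1 : ContDiff ℚ_[p] ω e := by
        change ContDiff ℚ_[p] ω fun x => ((p : ℚ_[p]) ^ n)⁻¹ • (x - u)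
        fun_prop
      exact h1.contMDiff.comp_contMDiffOn
        ((contMDiffOn_of_mem_maximalAtlas hc).mono fun x hx => hx.1)
    · have h1 : ContDiff ℚ_[p] ω e.symm := by
        change ContDiff ℚ_[p] ω fun x => (((p : ℚ_[p]) ^ n)⁻¹)⁻¹ • x + u
        fun_prop
      exact (contMDiffOn_symm_of_mem_maximalAtlas hc).comp h1.contMDiff.contMDiffOn
        fun x hx => hx.1
  · exact Set.inter_eq_right.2 Set.inter_subset_left
  · ext z
    change (e.symm z ∈ c.target ∧ c.symm (e.symm z) ∈ c.source ∩ c ⁻¹' padicBall u n) ↔ _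
    constructor
    · rintro ⟨h1, -, h2⟩
      rw [Set.mem_preimage, c.right_inv h1, he, e.apply_symm_apply] at h2
      exact h2
    · intro hz
      have h1 : e.symm z ∈ padicBall u n := by rwa [he, e.apply_symm_apply]
      refine ⟨h h1, c.map_target (h h1), ?_⟩
      rwa [Set.mem_preimage, c.right_inv (h h1)]

variable [IsManifold 𝓘(ℚ_[p], Fin k → ℚ_[p]) ω X]

/-- A partition into chart domains over which a given open cover can be refined to a
decomposition. The pieces are the maximal chart balls inside the parts and the members of the
cover. -/
theorem exists_decomposition {I : Type*} (a : X → I)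
    (c : I → OpenPartialHomeomorph X (Fin k → ℚ_[p]))
    (hc : ∀ i, c i ∈ IsManifold.maximalAtlas 𝓘(ℚ_[p], Fin k → ℚ_[p]) ω X)
    (ha : ∀ i, IsOpen {x | a x = i}) (hs : ∀ x, x ∈ (c (a x)).source) {O : Set (Set X)}
    (hO : ∀ S ∈ O, IsOpen S) (hO' : ∀ x, ∃ S ∈ O, x ∈ S) :
    ∃ d : Decomposition p k X, ∀ i, ∃ S ∈ O, Set.range (d.param i) ⊆ S := by
  classical
  let B : X → ℕ → Set X := fun x n => (c (a x)).source ∩ c (a x) ⁻¹' padicBall (c (a x) x) n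
  let good : X → ℕ → Prop := fun x n => padicBall (c (a x) x) n ⊆ (c (a x)).target ∧
    ∃ S ∈ O, B x n ⊆ {y | a y = a x} ∩ S
  have hgood : ∀ x, ∃ n, good x n := fun x => by
    obtain ⟨S, hS, hxS⟩ := hO' x
    obtain ⟨n, h1, h2⟩ := exists_chart_ball_subset (hs x) ((ha (a x)).inter (hO S hS)) ⟨rfl, hxS⟩
    exact ⟨n, h1, S, hS, h2⟩
  -- in an ultrametric space every point of a ball is a centre
  have key : ∀ x y n, good x n → y ∈ B x n → a y = a x ∧
      padicBall (c (a y) y) n = padicBall (c (a x) x) n ∧ B y n = B x n ∧ good y n := by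
    rintro x y n ⟨h1, S, hS, h2⟩ hy
    have h3 : a y = a x := (h2 hy).1
    have h4 : padicBall (c (a y) y) n = padicBall (c (a x) x) n := by
      rw [h3]
      exact padicBall_eq_of_mem hy.2
    have h5 : B y n = B x n := by
      simp only [B]
      rw [h4, h3]
    refine ⟨h3, h4, h5, ?_, S, hS, ?_⟩
    · rwa [h4, h3]
    · rwa [h5, h3]
  -- the smallest good exponent gives the maximal good ball around `x`
  let n : X → ℕ := fun x => Nat.find (hgood x)
  have hn : ∀ x, good x (n x) := fun x => Nat.find_spec (hgood x)
  have hself : ∀ x m, x ∈ B x m := fun x m => ⟨hs x, mem_padicBall_self _ _⟩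
  have hBn : ∀ x y, y ∈ B x (n x) → B y (n y) = B x (n x) := by
    intro x y hy
    obtain ⟨h3, h4, h5, h6⟩ := key x y _ (hn x) hy
    have h7 : n y ≤ n x := Nat.find_min' _ h6
    have h8 : x ∈ B y (n y) := by
      have h9 : x ∈ B y (n x) := h5 ▸ hself x _
      exact ⟨h9.1, padicBall_subset h7 _ h9.2⟩
    have h10 : n x ≤ n y := Nat.find_min' _ (key y x _ (hn y) h8).2.2.2
    rw [le_antisymm h7 h10, h5]
  choose c' hc' hsrc htgt using fun x => exists_chart_padicBall (hc (a x)) (hn x).1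
  let P : Set.range (fun x => B x (n x)) → X := fun s => s.2.choose
  have hP : ∀ s, B (P s) (n (P s)) = s.1 := fun s => s.2.choose_spec
  let d : Decomposition p k X :=
    { ι := Set.range fun x => B x (n x)
      chart := fun s => c' (P s)
      chart_mem := fun s => hc' _
      target_eq := fun s => htgt _
      pairwise_disjoint := fun s t hst => by
        change Disjoint (c' (P s)).source (c' (P t)).source
        rw [hsrc, hsrc]
        refine Set.disjoint_left.2 fun x hx hx' => hst (Subtype.ext ?_)
        rw [← hP s, ← hP t]
        exact (hBn _ _ hx).symm.trans (hBn _ _ hx')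
      cover := Set.eq_univ_of_forall fun x => Set.mem_iUnion.2 ⟨⟨_, x, rfl⟩, by
        rw [hsrc]
        change x ∈ B (P ⟨_, x, rfl⟩) (n (P ⟨_, x, rfl⟩))
        rw [hP]
        exact hself x _⟩ }
  refine ⟨d, fun s => ?_⟩
  obtain ⟨-, S, hS, h⟩ := hn (P s)
  refine ⟨S, hS, ?_⟩
  rw [d.range_param]
  change (c' (P s)).source ⊆ S
  rw [hsrc]
  exact fun x hx => (h hx).2

theorem exists_isBall_subset {S : Set X} (hS : IsOpen S) {x : X} (hx : x ∈ S) :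
    ∃ Q : (Fin k → ℤ_[p]) → X, IsBall Q ∧ x ∈ Set.range Q ∧ Set.range Q ⊆ S := by
  obtain ⟨n, h1, h2⟩ := exists_chart_ball_subset (mem_chart_source (Fin k → ℚ_[p]) x) hS hx
  obtain ⟨c', hc', hs, ht⟩ := exists_chart_padicBall (IsManifold.chart_mem_maximalAtlas x) h1
  have h3 : (Set.range fun z => c'.symm (intPoint p k z)) = c'.source := by
    rw [← c'.symm_image_target_eq_source, ht, ← Set.range_comp]
    rfl
  refine ⟨_, IsBall.of_chart hc' ht, ?_, ?_⟩
  · rw [h3, hs]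
    exact ⟨mem_chart_source _ x, mem_padicBall_self _ _⟩
  · rw [h3, hs]
    exact h2

theorem exists_isClopen_between (p : ℕ) [Fact p.Prime] (k : ℕ) {X : Type u} [TopologicalSpace X]
    [ChartedSpace (Fin k → ℚ_[p]) X] [IsManifold 𝓘(ℚ_[p], Fin k → ℚ_[p]) ω X] [T2Space X]
    {K S : Set X} (hK : IsCompact K) (hS : IsOpen S) (hKS : K ⊆ S) : ∃ V, IsClopen V ∧ K ⊆ V ∧ V ⊆ S := by
  choose! Q hQ hxQ hQS using fun x (hx : x ∈ S) => exists_isBall_subset (p := p) (k := k) hS hx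
  obtain ⟨t, ht, hKt⟩ := hK.elim_nhds_subcover (fun x => Set.range (Q x))
    fun x hx => (hQ x (hKS hx)).isOpen_range.mem_nhds (hxQ x (hKS hx))
  refine ⟨_, ⟨t.finite_toSet.isClosed_biUnion fun x hx =>
    (hQ x (hKS (ht x hx))).isCompact_range.isClosed, isOpen_biUnion fun x hx =>
    (hQ x (hKS (ht x hx))).isOpen_range⟩, hKt, Set.iUnion₂_subset fun x hx => hQS x (hKS (ht x hx))⟩

/-- A paracompact manifold is a disjoint union of open subsets of chart domains. A locally finite
clopen cover `K` by subsets of chart domains is made disjoint by assigning each point to the first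
member that contains it, for some well-ordering. -/
theorem exists_partition [T2Space X] [ParacompactSpace X] :
    ∃ a : X → X, (∀ i, IsOpen {x | a x = i}) ∧
      ∀ x, x ∈ (chartAt (Fin k → ℚ_[p]) (a x)).source := by
  classical
  choose Q hQ hxQ hQS using fun x : X => exists_isBall_subset (p := p) (k := k)
    (chartAt (Fin k → ℚ_[p]) x).open_source (mem_chart_source _ x)
  obtain ⟨v, hvo, hvc, hvf, hv⟩ := precise_refinement (fun x => Set.range (Q x))
    (fun x => (hQ x).isOpen_range) (Set.eq_univ_of_forall fun x => Set.mem_iUnion.2 ⟨x, hxQ x⟩)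
  obtain ⟨w, hwc, -, hw⟩ := exists_iUnion_eq_closure_subset hvo (fun x => hvf.point_finite x) hvc
  choose K hK hwK hKv using fun x => exists_isClopen_between p k
    ((hQ x).isCompact_range.of_isClosed_subset isClosed_closure ((hw x).trans (hv x))) (hvo x) (hw x)
  have hKf : LocallyFinite K := hvf.subset hKv
  have hKc : ∀ x, ∃ i, x ∈ K i := fun x => by
    obtain ⟨i, hi⟩ := Set.mem_iUnion.1 (hwc.symm ▸ Set.mem_univ x)
    exact ⟨i, hwK i (subset_closure hi)⟩
  let r : X → X → Prop := WellOrderingRel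
  have hr : WellFounded r := IsWellFounded.wf
  let a : X → X := fun x => hr.min {i | x ∈ K i} (hKc x)
  have haK : ∀ x, x ∈ K (a x) := fun x => hr.min_mem {i | x ∈ K i} (hKc x)
  refine ⟨a, fun i => ?_, fun x => hQS _ (hv _ (hKv _ (haK x)))⟩
  have : {x | a x = i} = K i ∩ (⋃ l : {l // r l i}, K l)ᶜ := by
    ext x
    simp only [Set.mem_ofPred_eq, Set.mem_inter_iff, Set.mem_compl_iff, Set.mem_iUnion, not_exists]
    constructor
    · rintro rfl
      exact ⟨haK x, fun l hl => hr.not_lt_min {i | x ∈ K i} hl l.2⟩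
    · rintro ⟨h1, h2⟩
      rcases trichotomous_of r (a x) i with h | h | h
      · exact absurd (haK x) (h2 ⟨_, h⟩)
      · exact h
      · exact absurd h (hr.not_lt_min {i | x ∈ K i} h1)
  rw [this]
  refine (hK i).isOpen.inter (isOpen_compl_iff.2 ?_)
  exact (hKf.comp_injective Subtype.val_injective).isClosed_iUnion fun l => (hK l).isClosed

/-- Paracompactness is only assumed for the ambient manifold, so the partition of the open subset is
induced from there. -/
theorem exists_decomposition_opens [T2Space X] [ParacompactSpace X]
    (U : TopologicalSpace.Opens X) {O : Set (Set U)}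
    (hO : ∀ S ∈ O, IsOpen S) (hO' : ∀ x, ∃ S ∈ O, x ∈ S) :
    ∃ d : Decomposition p k U, ∀ i, ∃ S ∈ O, Set.range (d.param i) ⊆ S := by
  obtain ⟨a, ha, hs⟩ := exists_partition (p := p) (k := k) (X := X)
  let c : {i // ∃ x : U, a x = i} → OpenPartialHomeomorph U (Fin k → ℚ_[p]) :=
    fun i => (chartAt (Fin k → ℚ_[p]) i.1).subtypeRestr ⟨i.2.choose⟩
  refine exists_decomposition (fun x : U => ⟨a x, x, rfl⟩) c (fun i => ?_) (fun i => ?_)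
    (fun x => ?_) hO hO'
  · exact StructureGroupoid.subtypeRestr_mem_maximalAtlas (chart_mem_atlas _ _) _
  · have : {x : U | (⟨a x, x, rfl⟩ : {i // ∃ x : U, a x = i}) = i} =
        Subtype.val ⁻¹' {x | a x = i.1} := by
      ext x
      simp [Subtype.ext_iff]
    rw [this]
    exact (ha i.1).preimage continuous_subtype_val
  · rw [OpenPartialHomeomorph.subtypeRestr_source]
    exact hs x

theorem nonempty_decomposition [T2Space X] [ParacompactSpace X] :
    Nonempty (Decomposition p k X) := by
  obtain ⟨a, ha, hs⟩ := exists_partition (p := p) (k := k) (X := X)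
  obtain ⟨d, -⟩ := exists_decomposition a _ (fun i => IsManifold.chart_mem_maximalAtlas i) ha hs
    (O := {Set.univ}) (by simp) (by simp)
  exact ⟨d⟩

end Existence

/-! ### The sheaf of locally analytic functions -/

section Abstract

open CategoryTheory TopologicalSpace Opposite

/-- A sheaf of modules given by restriction maps that satisfy unique gluing. -/
theorem exists_sheaf {A : Type v} [CommRing A] {X : Type u} [TopologicalSpace X]
    (M : Opens X → Type (max u v)) [∀ U, AddCommGroup (M U)] [∀ U, Module A (M U)]
    (res : ∀ V U : Opens X, V ≤ U → (M U →ₗ[A] M V))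
    (res_id : ∀ U s, res U U le_rfl s = s)
    (res_comp : ∀ W V U (h : W ≤ V) (h' : V ≤ U) s,
      res W V h (res V U h' s) = res W U (h.trans h') s)
    (glue : ∀ {ι : Type u} (U : ι → Opens X) (s : ∀ i, M (U i)),
      (∀ i j, res (U i ⊓ U j) (U i) inf_le_left (s i) =
        res (U i ⊓ U j) (U j) inf_le_right (s j)) →
      ∃! t, ∀ i, res (U i) (iSup U) (le_iSup U i) t = s i) :
    ∃ (F : TopCat.Presheaf (ModuleCat.{max u v} A) (TopCat.of X))
      (e : ∀ U : Opens X, F.obj (op U) ≃ₗ[A] M U),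
      (∀ V U (h : V ≤ U) s, e V (F.map (homOfLE h).op s) = res V U h (e U s)) ∧ F.IsSheaf := by
  let F : TopCat.Presheaf (ModuleCat.{max u v} A) (TopCat.of X) :=
    { obj := fun U => ModuleCat.of A (M U.unop)
      map := fun {U V} h => ModuleCat.ofHom (res V.unop U.unop h.unop.le)
      map_id := fun U => by
        ext s
        exact res_id _ s
      map_comp := fun {U V W} f g => by
        ext s
        exact (res_comp _ _ _ _ _ s).symm }
  refine ⟨F, fun U => LinearEquiv.refl A _, fun V U h s => rfl, ?_⟩
  rw [TopCat.Presheaf.isSheaf_iff_isSheafUniqueGluing]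
  intro ι U s hs
  exact glue U s hs

end Abstract

section Sheaf

variable {p : ℕ} [Fact p.Prime] {k : ℕ}
variable {X : Type u} [TopologicalSpace X] [T2Space X] [ParacompactSpace X]
  [ChartedSpace (Fin k → ℚ_[p]) X] [IsManifold 𝓘(ℚ_[p], Fin k → ℚ_[p]) ω X]
variable {A : Type v} [CommRing A] [UniformSpace A] [IsUniformAddGroup A] [CompleteSpace A]
  [T2Space A] [IsTateRing A] [Algebra ℤ_[p] A] [ContinuousSMul ℤ_[p] A] {α β : Aˣ}

open TopologicalSpace

theorem laFun_exists_glue (hα : IsTopologicallyNilpotent (α : A)) {ι : Type*} (U : ι → Opens X)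
    (d : ∀ i, Decomposition p k (U i)) (d' : Decomposition p k (iSup U : Opens X))
    (s : ∀ i, laFun (A := A) α (d i))
    (hs : ∀ i j x (hi : x ∈ U i) (hj : x ∈ U j), (s i).1 ⟨x, hi⟩ = (s j).1 ⟨x, hj⟩) :
    ∃ t ∈ laFun (A := A) α d', ∀ i x (hi : x ∈ U i), t ⟨x, le_iSup U i hi⟩ = (s i).1 ⟨x, hi⟩ := by
  choose i hi using fun x : (iSup U : Opens X) => Opens.mem_iSup.1 x.2
  let t : ((iSup U : Opens X) : Type u) → A := fun x => (s (i x)).1 ⟨x, hi x⟩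
  have ht : ∀ i x (hi : x ∈ U i), t ⟨x, le_iSup U i hi⟩ = (s i).1 ⟨x, hi⟩ :=
    fun l x hl => hs _ _ x _ hl
  refine ⟨t, (mem_laFun_iff hα).2 fun x => ?_, ht⟩
  obtain ⟨Q, hQ, ⟨z, hz⟩, h⟩ := (mem_laFun_iff hα).1 (s (i x)).2 ⟨x, hi x⟩
  refine ⟨_, hQ.inclusion (le_iSup U (i x)), ⟨z, Subtype.ext (congrArg Subtype.val hz :)⟩, ?_⟩
  convert h using 1
  funext w
  exact ht (i x) _ (Q w).2

/-- The sheaf of locally analytic functions. -/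
theorem exists_sheaf_laFun (hα : IsTopologicallyNilpotent (α : A))
    (d : ∀ U : Opens X, Decomposition p k U) :
    ∃ (F : TopCat.Presheaf (ModuleCat.{max u v} A) (TopCat.of X))
      (e : ∀ U : Opens X, F.obj (Opposite.op U) ≃ₗ[A] laFun α (d U)),
      (∀ (V U : Opens X) (h : V ≤ U) (s : F.obj (Opposite.op U)) (x : V),
        (e V (F.map (CategoryTheory.homOfLE h).op s)).1 x = (e U s).1 (Set.inclusion h x)) ∧
      F.IsSheaf := by
  have glue : ∀ {ι : Type u} (U : ι → Opens X) (s : ∀ i, laFun (A := A) α (d (U i))),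
      (∀ i j, laFunPull hα hα (d (U i ⊓ U j)) (d (U i)) (g := Opens.inclusion inf_le_left)
        (contMDiff_inclusion inf_le_left) (s i) = laFunPull hα hα (d (U i ⊓ U j)) (d (U j))
        (g := Opens.inclusion inf_le_right) (contMDiff_inclusion inf_le_right) (s j)) →
      ∃! t, ∀ i, laFunPull hα hα (d (U i)) (d (iSup U)) (g := Opens.inclusion (le_iSup U i))
        (contMDiff_inclusion (le_iSup U i)) t = s i := by
    intro ι U s hs
    obtain ⟨t, ht, ht'⟩ := laFun_exists_glue hα U (fun i => d (U i)) (d (iSup U)) s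
      fun i j x hi hj => congrFun (congrArg Subtype.val (hs i j)) ⟨x, hi, hj⟩
    refine ⟨⟨t, ht⟩, fun i => Subtype.ext (funext fun x => ht' i x x.2), fun t' h' => ?_⟩
    refine Subtype.ext (funext fun x => ?_)
    obtain ⟨i, hi⟩ := Opens.mem_iSup.1 x.2
    have := congrFun (congrArg Subtype.val (h' i)) ⟨x, hi⟩
    exact this.trans (ht' i x hi).symm
  obtain ⟨F, e, h1, h2⟩ := exists_sheaf (fun U => laFun (A := A) α (d U))
    (fun V U h => laFunPull hα hα (d V) (d U) (g := Opens.inclusion h) (contMDiff_inclusion h))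
    (fun U s => rfl) (fun W V U h h' s => rfl) fun U s hs => by exact glue U s hs
  exact ⟨F, e, fun V U h s x => by rw [h1]; rfl, h2⟩

/-! ### Extension by zero -/

section Extend

variable {W V U : Opens X}

theorem extendByZero_apply_mem (h : V ≤ U) (f : V → A) {x : U} (hx : (x : X) ∈ V) :
    extendByZero h f x = f ⟨x, hx⟩ :=
  (Set.inclusion_injective h).extend_apply f 0 (⟨x, hx⟩ : V)

theorem extendByZero_apply_notMem (h : V ≤ U) (f : V → A) {x : U} (hx : (x : X) ∉ V) :
    extendByZero h f x = 0 :=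
  Function.extend_apply' _ _ _ fun ⟨y, hy⟩ => hx (hy ▸ y.2)

theorem extendByZero_self (f : U → A) : extendByZero le_rfl f = f :=
  funext fun x => extendByZero_apply_mem _ f x.2

theorem extendByZero_trans (h : W ≤ V) (h' : V ≤ U) (f : W → A) :
    extendByZero h' (extendByZero h f) = extendByZero (h.trans h') f := by
  funext x
  by_cases hW : (x : X) ∈ W
  · rw [extendByZero_apply_mem h' _ (h hW), extendByZero_apply_mem (x := ⟨x, h hW⟩) h _ hW,
      extendByZero_apply_mem _ _ hW]
  · rw [extendByZero_apply_notMem (h.trans h') _ hW]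
    by_cases hV : (x : X) ∈ V
    · rw [extendByZero_apply_mem h' _ hV, extendByZero_apply_notMem (x := ⟨x, hV⟩) h _ hW]
    · exact extendByZero_apply_notMem h' _ hV

theorem extendByZero_extend (h : V ≤ U) {Q : (Fin k → ℤ_[p]) → V} (hQ : Function.Injective Q)
    (f : (Fin k → ℤ_[p]) → A) :
    extendByZero h (Function.extend Q f 0) =
      Function.extend (fun z => (Opens.inclusion h (Q z) : U)) f 0 := by
  have hi : Function.Injective fun z => (Opens.inclusion h (Q z) : U) :=
    (Set.inclusion_injective h).comp hQ
  funext x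
  by_cases hx : ∃ z, Opens.inclusion h (Q z) = x
  · obtain ⟨z, rfl⟩ := hx
    rw [hi.extend_apply]
    exact ((Set.inclusion_injective h).extend_apply _ _ _).trans (hQ.extend_apply _ _ _)
  · rw [Function.extend_apply' _ _ _ hx]
    by_cases hV : (x : X) ∈ V
    · rw [extendByZero_apply_mem h _ hV]
      exact Function.extend_apply' _ _ _ fun ⟨z, hz⟩ => hx ⟨z, Subtype.ext (congrArg Subtype.val hz :)⟩
    · exact extendByZero_apply_notMem h _ hV

/-- Extension by zero as a linear map. -/
def extendByZeroHom (A : Type*) [CommRing A] (h : V ≤ U) : (V → A) →ₗ[A] (U → A) where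
  toFun := extendByZero h
  map_add' f g := by simpa [extendByZero] using Function.extend_add (Set.inclusion h) f g 0 0
  map_smul' a f := by simpa [extendByZero] using Function.extend_smul a (Set.inclusion h) f 0

end Extend

/-- A function in `𝒜_c(X, A)` is the sum of its restrictions to the pieces of any decomposition. -/
theorem laFunC_eq_sum {Y : Type*} [TopologicalSpace Y] [T2Space Y]
    [ChartedSpace (Fin k → ℚ_[p]) Y] [IsManifold 𝓘(ℚ_[p], Fin k → ℚ_[p]) ω Y]
    (hα : IsTopologicallyNilpotent (α : A)) (d d' : Decomposition p k Y)
    (f : laFunC (A := A) α d) : ∃ (s : Finset d'.ι) (h : d'.ι → zpFun (A := A) p k α),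
      f = ∑ i ∈ s, extBall hα hα d (d'.isBall_param i) (h i) := by
  have hf : f.1 ∈ laFunC α d' := (laFunC_congr hα hα d d').le f.2
  obtain ⟨s, hs⟩ := exists_finset_laFunC ⟨f.1, hf⟩
  refine ⟨s, fun i => laFun.piece ⟨f.1, hf.1⟩ i, Subtype.ext (funext fun x => ?_)⟩
  rw [AddSubmonoidClass.coe_finsetSum]
  obtain ⟨i, z, rfl⟩ := d'.exists_param_eq x
  by_cases hi : i ∈ s
  · exact (sum_extend_pieces d' f.1 s hi z).symm
  · have h1 : f.1 (d'.param i z) = 0 := congrFun (hs i hi) z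
    rw [h1, Finset.sum_apply]
    exact (Finset.sum_eq_zero fun l hl =>
      congrFun (extend_param_comp_of_ne d' (fun e => hi (by rwa [← e])) _) z).symm

theorem extendByZero_mem_laFunC (hα : IsTopologicallyNilpotent (α : A)) {V U : Opens X} (h : V ≤ U)
    (dV : Decomposition p k V) (dU : Decomposition p k U) {f : V → A} (hf : f ∈ laFunC α dV) :
    extendByZero h f ∈ laFunC α dU := by
  obtain ⟨s, g, hg⟩ := laFunC_eq_sum hα dV dV ⟨f, hf⟩
  have h1 : f = ∑ i ∈ s, Function.extend (dV.param i) (g i).1 0 := by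
    have := congrArg Subtype.val hg
    rwa [AddSubmonoidClass.coe_finsetSum] at this
  change extendByZeroHom A h f ∈ _
  rw [h1, map_sum]
  refine Submodule.sum_mem _ fun i _ => ?_
  change extendByZero h (Function.extend (dV.param i) (g i).1 0) ∈ _
  rw [extendByZero_extend h (dV.isBall_param i).injective]
  exact extend_mem_laFunC hα dU ((dV.isBall_param i).inclusion h) (g i).2

/-- Extension by zero of compactly supported functions. -/
def laFunCExtend (hα : IsTopologicallyNilpotent (α : A)) {V U : Opens X} (h : V ≤ U)
    (dV : Decomposition p k V) (dU : Decomposition p k U) :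
    laFunC (A := A) α dV →ₗ[A] laFunC α dU :=
  (extendByZeroHom A h).restrict fun _ hf => extendByZero_mem_laFunC hα h dV dU hf

theorem laFunCExtend_extBall (hα : IsTopologicallyNilpotent (α : A)) {V U : Opens X} (h : V ≤ U)
    (dV : Decomposition p k V) (dU : Decomposition p k U) {Q : (Fin k → ℤ_[p]) → V} (hQ : IsBall Q)
    (f : zpFun (A := A) p k α) :
    laFunCExtend hα h dV dU (extBall hα hα dV hQ f) = extBall hα hα dU (hQ.inclusion h) f :=
  Subtype.ext (extendByZero_extend h hQ.injective f.1)

/-! ### The sheaf of distributions -/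

/-- The dual of extension by zero preserves `𝒟_c`, because balls in `V` are balls in `U`. -/
theorem DistC.existsUnique_res (hα : IsTopologicallyNilpotent (α : A)) {V U : Opens X} (h : V ≤ U)
    (dV : Decomposition p k V) (dU : Decomposition p k U) :
    ∃! r : DistC (A := A) α dU →ₗ[A] DistC α dV, ∀ φ,
      DistC.evalHom α dV (r φ) = DistC.evalHom α dU φ ∘ₗ laFunCExtend hα h dV dU := by
  refine existsUnique_linearMap (DistC.evalHom_injective hα dV)
    ((LinearMap.lcomp A A (laFunCExtend hα h dV dU)) ∘ₗ DistC.evalHom α dU) fun φ => ?_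
  refine DistC.exists_eval_eq hα dV _ fun i => ?_
  have : ((LinearMap.lcomp A A (laFunCExtend hα h dV dU)) ∘ₗ DistC.evalHom α dU) φ ∘ₗ
      extBall hα hα dV (dV.isBall_param i) =
      DistC.evalHom α dU φ ∘ₗ extBall hα hα dU ((dV.isBall_param i).inclusion h) :=
    LinearMap.ext fun f => congrArg (DistC.evalHom α dU φ)
      (laFunCExtend_extBall hα h dV dU (dV.isBall_param i) f)
  rw [this]
  exact φ.comp_extBall_mem hα hα _

/-- Restriction of distributions, dual to extension by zero. -/
def DistC.res (hα : IsTopologicallyNilpotent (α : A)) {V U : Opens X} (h : V ≤ U)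
    (dV : Decomposition p k V) (dU : Decomposition p k U) : DistC (A := A) α dU →ₗ[A] DistC α dV :=
  (DistC.existsUnique_res hα h dV dU).choose

theorem DistC.evalHom_res (hα : IsTopologicallyNilpotent (α : A)) {V U : Opens X} (h : V ≤ U)
    (dV : Decomposition p k V) (dU : Decomposition p k U) (φ : DistC (A := A) α dU) :
    DistC.evalHom α dV (DistC.res hα h dV dU φ) =
      DistC.evalHom α dU φ ∘ₗ laFunCExtend hα h dV dU :=
  (DistC.existsUnique_res hα h dV dU).choose_spec.1 φ

theorem DistC.evalHom_res_extBall (hα : IsTopologicallyNilpotent (α : A)) {V U : Opens X}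
    (h : V ≤ U) (dV : Decomposition p k V) (dU : Decomposition p k U) (φ : DistC (A := A) α dU)
    {Q : (Fin k → ℤ_[p]) → V} (hQ : IsBall Q) (f : zpFun (A := A) p k α) :
    DistC.evalHom α dV (DistC.res hα h dV dU φ) (extBall hα hα dV hQ f) =
      DistC.evalHom α dU φ (extBall hα hα dU (hQ.inclusion h) f) := by
  rw [DistC.evalHom_res, LinearMap.comp_apply, laFunCExtend_extBall]

/-- Linear forms on `𝒜_c(U, A)` are determined by their values on functions supported on balls that
are subordinate to a given open cover. -/
theorem DistC.ext_of_ball (hα : IsTopologicallyNilpotent (α : A)) {U : Opens X}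
    (d : Decomposition p k U) {O : Set (Set U)} (hO : ∀ S ∈ O, IsOpen S)
    (hO' : ∀ x, ∃ S ∈ O, x ∈ S) {L L' : laFunC (A := A) α d →ₗ[A] A}
    (h : ∀ (Q : (Fin k → ℤ_[p]) → U) (hQ : IsBall Q), (∃ S ∈ O, Set.range Q ⊆ S) →
      ∀ f, L (extBall hα hα d hQ f) = L' (extBall hα hα d hQ f)) : L = L' := by
  obtain ⟨e, he⟩ := exists_decomposition_opens (p := p) (k := k) U hO hO'
  ext f
  obtain ⟨s, g, hg⟩ := laFunC_eq_sum hα d e f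
  rw [hg, map_sum, map_sum]
  exact Finset.sum_congr rfl fun i _ => h _ (e.isBall_param i) (he i) _

/-- Gluing of distributions. On the pieces of a decomposition of the union that is subordinate to the
cover, the glued distribution is defined by restricting any of the given ones. -/
theorem DistC.existsUnique_glue (hα : IsTopologicallyNilpotent (α : A)) {ι : Type*}
    (U : ι → Opens X) (d : ∀ U : Opens X, Decomposition p k U)
    (s : ∀ i, DistC (A := A) α (d (U i)))
    (hs : ∀ i j, DistC.res hα (inf_le_left : U i ⊓ U j ≤ U i) (d _) (d _) (s i) =
      DistC.res hα (inf_le_right : U i ⊓ U j ≤ U j) (d _) (d _) (s j)) :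
    ∃! t, ∀ i, DistC.res hα (le_iSup U i) (d _) (d _) t = s i := by
  classical
  let O : Set (Set (iSup U : Opens X)) := Set.range fun i => Subtype.val ⁻¹' (U i : Set X)
  have hO : ∀ S ∈ O, IsOpen S := by
    rintro _ ⟨i, rfl⟩
    exact (U i).2.preimage continuous_subtype_val
  have hO' : ∀ x, ∃ S ∈ O, x ∈ S := fun x => by
    obtain ⟨i, hi⟩ := Opens.mem_iSup.1 x.2
    exact ⟨_, ⟨i, rfl⟩, hi⟩
  -- a decomposition of the union each piece of which lies in a member of the covering
  obtain ⟨e, he⟩ := exists_decomposition_opens (p := p) (k := k) (iSup U) hO hO'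
  have he' : ∀ l, ∃ i, ∀ z, (e.param l z : X) ∈ U i := fun l => by
    obtain ⟨_, ⟨i, rfl⟩, h⟩ := he l
    exact ⟨i, fun z => h ⟨z, rfl⟩⟩
  choose i hi using he'
  have hball := fun l => (e.isBall_param l).codRestrict (le_iSup U (i l)) (hi l)
  let φ : DistC (A := A) α e := fun l => ⟨_, (s (i l)).comp_extBall_mem hα hα (hball l)⟩
  obtain ⟨t, ht⟩ := DistC.exists_congr hα hα e (d (iSup U)) φ
  have hres : ∀ j, DistC.res hα (le_iSup U j) (d _) (d _) t = s j := fun j => by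
    apply DistC.evalHom_injective hα
    refine DistC.ext_of_ball hα (d (U j))
      (O := Set.range fun l => Set.inclusion (le_iSup U j) ⁻¹' Set.range (e.param l)) ?_ ?_ ?_
    · rintro _ ⟨l, rfl⟩
      exact (e.isOpen_range_param l).preimage (continuous_inclusion (le_iSup U j))
    · intro x
      obtain ⟨l, z, hz⟩ := e.exists_param_eq (Set.inclusion (le_iSup U j) x)
      exact ⟨_, ⟨l, rfl⟩, z, hz⟩
    · rintro Q hQ ⟨_, ⟨l, rfl⟩, hl⟩ f
      have hl' : ∀ z, ∃ w, e.param l w = Opens.inclusion (le_iSup U j) (Q z) := fun z => hl ⟨z, rfl⟩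
      have hQi : ∀ z, (Q z : X) ∈ U (i l) := fun z => by
        obtain ⟨w, hw⟩ := hl' z
        have := hi l w
        rw [hw] at this
        exact this
      have hQ' : IsBall fun z => (⟨Q z, (Q z).2, hQi z⟩ : (U j ⊓ U (i l) : Opens X)) :=
        hQ.codRestrict inf_le_left fun z => ⟨(Q z).2, hQi z⟩
      -- compare with the distribution `s (i l)`, which defines `t` on the piece `l` that contains `Q`
      have e1 : DistC.evalHom α (d (U j)) (s j) (extBall hα hα (d (U j)) hQ f) =
          DistC.evalHom α (d (U (i l))) (s (i l))
            (extBall hα hα _ (hQ'.inclusion inf_le_right) f) :=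
        ((DistC.evalHom_res_extBall hα inf_le_left (d _) (d _) (s j) hQ' f).symm.trans
          (LinearMap.congr_fun (congrArg _ (hs j (i l))) _)).trans
          (DistC.evalHom_res_extBall hα inf_le_right (d _) (d _) (s (i l)) hQ' f)
      rw [DistC.evalHom_res_extBall, ht, e1]
      -- a function supported in the piece `l` only sees the component of `φ` at `l`
      have h0 : ∀ m ∉ ({l} : Finset e.ι),
          Function.extend (fun z => Opens.inclusion (le_iSup U j) (Q z)) f.1 0 ∘ e.param m = 0 :=
        fun m hm => funext fun z => Function.extend_apply' _ _ _ fun ⟨w, hw⟩ => by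
          obtain ⟨w', hw'⟩ := hl' w
          exact hm (Finset.mem_singleton.2 (e.param_eq_imp (hw.symm.trans hw'.symm)))
      refine (φ.eval_eq_sum _ h0).trans ((Finset.sum_singleton _ _).trans ?_)
      change DistC.evalHom α (d (U (i l))) (s (i l)) _ = _
      congr 1
      refine Subtype.ext (funext fun x => ?_)
      change Function.extend (fun z => (⟨e.param l z, hi l z⟩ : U (i l)))
        (Function.extend (fun z => Opens.inclusion (le_iSup U j) (Q z)) f.1 0 ∘ e.param l) 0 x =
        Function.extend (fun z => (⟨Q z, hQi z⟩ : U (i l))) f.1 0 x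
      have hinj : Function.Injective fun z => (⟨Q z, hQi z⟩ : U (i l)) :=
        (hQ'.inclusion inf_le_right).injective
      by_cases hx : ∃ w, (⟨e.param l w, hi l w⟩ : U (i l)) = x
      · obtain ⟨w, rfl⟩ := hx
        rw [(hball l).injective.extend_apply, Function.comp_apply]
        by_cases hw : ∃ z, Opens.inclusion (le_iSup U j) (Q z) = e.param l w
        · obtain ⟨z, hz⟩ := hw
          have h1 : (⟨e.param l w, hi l w⟩ : U (i l)) = ⟨Q z, hQi z⟩ :=
            Subtype.ext (congrArg Subtype.val hz.symm :)
          rw [h1, ← hz]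
          exact (((hQ.inclusion (le_iSup U j)).injective).extend_apply _ _ z).trans
            (hinj.extend_apply _ _ z).symm
        · rw [Function.extend_apply' _ _ _ hw]
          refine (Function.extend_apply' (f := fun z => (⟨Q z, hQi z⟩ : U (i l))) f.1 0 _ ?_).symm
          exact fun ⟨z, hz⟩ => hw ⟨z, Subtype.ext (congrArg Subtype.val hz :)⟩
      · rw [Function.extend_apply' _ _ _ hx]
        refine (Function.extend_apply' _ _ _ fun ⟨z, hz⟩ => hx ?_).symm
        obtain ⟨w, hw⟩ := hl' z
        exact ⟨w, hz ▸ Subtype.ext (congrArg Subtype.val hw :)⟩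
  refine ⟨t, hres, fun t' ht' => DistC.evalHom_injective hα _
    (DistC.ext_of_ball hα _ hO hO' ?_)⟩
  rintro Q hQ ⟨_, ⟨j, rfl⟩, hj⟩ f
  have hQj : ∀ z, (Q z : X) ∈ U j := fun z => hj ⟨z, rfl⟩
  have hQ' := hQ.codRestrict (le_iSup U j) hQj
  exact (DistC.evalHom_res_extBall hα (le_iSup U j) (d _) (d _) t' hQ' f).symm.trans
    ((LinearMap.congr_fun (congrArg _ ((ht' j).trans (hres j).symm)) _).trans
    (DistC.evalHom_res_extBall hα (le_iSup U j) (d _) (d _) t hQ' f))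

/-- The sheaf of distributions. -/
theorem exists_sheaf_distC (hα : IsTopologicallyNilpotent (α : A))
    (d : ∀ U : Opens X, Decomposition p k U) :
    ∃ (F : TopCat.Presheaf (ModuleCat.{max u v} A) (TopCat.of X))
      (e : ∀ U : Opens X, F.obj (Opposite.op U) ≃ₗ[A] DistC α (d U)),
      (∀ (V U : Opens X) (h : V ≤ U) (s : F.obj (Opposite.op U)) (f : V → A)
        (hf : f ∈ laFunC α (d V)) (hf' : extendByZero h f ∈ laFunC α (d U)),
        DistC.eval (e V (F.map (CategoryTheory.homOfLE h).op s)) ⟨f, hf⟩ =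
          DistC.eval (e U s) ⟨extendByZero h f, hf'⟩) ∧
      F.IsSheaf := by
  have res_id : ∀ (U : Opens X) (s : DistC (A := A) α (d U)),
      DistC.res hα le_rfl (d U) (d U) s = s := by
    intro U s
    apply DistC.evalHom_injective hα
    rw [DistC.evalHom_res]
    exact LinearMap.ext fun f => congrArg (DistC.evalHom α (d U) s)
      (Subtype.ext (extendByZero_self f.1))
  have res_comp : ∀ (W V U : Opens X) (h : W ≤ V) (h' : V ≤ U) (s : DistC (A := A) α (d U)),
      DistC.res hα h (d W) (d V) (DistC.res hα h' (d V) (d U) s) =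
        DistC.res hα (h.trans h') (d W) (d U) s := by
    intro W V U h h' s
    apply DistC.evalHom_injective hα
    rw [DistC.evalHom_res, DistC.evalHom_res, DistC.evalHom_res]
    exact LinearMap.ext fun f => congrArg (DistC.evalHom α (d U) s)
      (Subtype.ext (extendByZero_trans h h' f.1))
  obtain ⟨F, e, h1, h2⟩ := exists_sheaf (fun U => DistC (A := A) α (d U))
    (fun V U h => DistC.res hα h (d V) (d U)) res_id res_comp
    fun U s hs => DistC.existsUnique_glue hα U d s hs
  refine ⟨F, e, fun V U h s f hf hf' => ?_, h2⟩
  rw [h1]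
  exact LinearMap.congr_fun (DistC.evalHom_res hα h (d V) (d U) (e U s)) ⟨f, hf⟩

end Sheaf

/-! ### The logarithm of a `ℤ_p`-analytic module -/

section Log

variable {p : ℕ} [Fact p.Prime] {k : ℕ}

/-- The projection of `ℚ_p` onto `ℤ_p` that is zero outside of the unit ball. It extends scalar
multiplication by `ℤ_p` to a function on `ℚ_p`, so that it can be differentiated. -/
def clampInt (t : ℚ_[p]) : ℤ_[p] := if h : ‖t‖ ≤ 1 then ⟨t, h⟩ else 0

theorem clampInt_coe (z : ℤ_[p]) : clampInt (z : ℚ_[p]) = z := dif_pos z.2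

theorem clampInt_zero : clampInt (0 : ℚ_[p]) = 0 := by
  simpa using clampInt_coe (0 : ℤ_[p])

variable {X : Type u} [TopologicalSpace X] [ChartedSpace (Fin k → ℚ_[p]) X]
  [AddCommGroup X] [Module ℤ_[p] X]

/-- Addition of the module, read in a chart. -/
def chartAdd (φ : OpenPartialHomeomorph X (Fin k → ℚ_[p]))
    (q : (Fin k → ℚ_[p]) × (Fin k → ℚ_[p])) : Fin k → ℚ_[p] :=
  φ (φ.symm q.1 + φ.symm q.2)

/-- Scalar multiplication of the module, read in a chart. -/
def chartSmul (φ : OpenPartialHomeomorph X (Fin k → ℚ_[p])) (q : ℚ_[p] × (Fin k → ℚ_[p])) :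
    Fin k → ℚ_[p] :=
  φ (clampInt q.1 • φ.symm q.2)

/-- The logarithm in a chart: the derivative of `t ↦ t • x` at `t = 0`. -/
def chartLog (φ : OpenPartialHomeomorph X (Fin k → ℚ_[p])) (u : Fin k → ℚ_[p]) : Fin k → ℚ_[p] :=
  fderiv ℚ_[p] (chartSmul φ) (0, u) (1, 0)

variable {φ : OpenPartialHomeomorph X (Fin k → ℚ_[p])}

theorem chartSmul_zero (u : Fin k → ℚ_[p]) : chartSmul φ (0, u) = φ 0 := by
  rw [chartSmul, clampInt_zero, zero_smul]

theorem chartSmul_chart_zero (h0 : (0 : X) ∈ φ.source) (t : ℚ_[p]) :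
    chartSmul φ (t, φ 0) = φ 0 := by
  rw [chartSmul, φ.left_inv h0, smul_zero]

theorem contMDiffAt_clampBall {t : ℚ_[p]} (ht : ‖t‖ ≤ 1) :
    ContMDiffAt 𝓘(ℚ_[p], ℚ_[p]) 𝓘(ℚ_[p], ℚ_[p]) ω
      (fun t : ℚ_[p] => (⟨clampInt t, (clampInt t).2⟩ : unitBall p)) t := by
  refine (contMDiffAt_subtype_iff (U := unitBall p) (x := ⟨t, ht⟩)).1 ?_
  have : (fun x : unitBall p => (⟨clampInt (x : ℚ_[p]), (clampInt (x : ℚ_[p])).2⟩ : unitBall p)) =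
      id := by
    funext x
    exact Subtype.ext (congrArg Subtype.val (clampInt_coe (⟨x.1, x.2⟩ : ℤ_[p])) :)
  rw [this]
  exact contMDiffAt_id

section Smul

variable [IsManifold 𝓘(ℚ_[p], Fin k → ℚ_[p]) ω X]
  (hφ : φ ∈ IsManifold.maximalAtlas 𝓘(ℚ_[p], Fin k → ℚ_[p]) ω X)
  (hs : ContMDiff (𝓘(ℚ_[p], ℚ_[p]).prod 𝓘(ℚ_[p], Fin k → ℚ_[p])) 𝓘(ℚ_[p], Fin k → ℚ_[p]) ω
    (fun q : unitBall p × X => unitBall.toInt q.1 • q.2))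

include hφ hs

theorem contMDiffAt_clampInt_smul {t : ℚ_[p]} {u : Fin k → ℚ_[p]} (ht : ‖t‖ ≤ 1)
    (hu : u ∈ φ.target) :
    ContMDiffAt 𝓘(ℚ_[p], ℚ_[p] × (Fin k → ℚ_[p])) 𝓘(ℚ_[p], Fin k → ℚ_[p]) ω
      (fun q : ℚ_[p] × (Fin k → ℚ_[p]) => clampInt q.1 • φ.symm q.2) (t, u) := by
  have h1 : ContMDiffAt 𝓘(ℚ_[p], ℚ_[p] × (Fin k → ℚ_[p])) 𝓘(ℚ_[p], ℚ_[p]) ω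
      (fun q : ℚ_[p] × (Fin k → ℚ_[p]) => (⟨clampInt q.1, (clampInt q.1).2⟩ : unitBall p))
      (t, u) :=
    ContMDiffAt.comp (g := fun t : ℚ_[p] => (⟨clampInt t, (clampInt t).2⟩ : unitBall p))
      (f := Prod.fst) (t, u) (contMDiffAt_clampBall ht) contDiff_fst.contMDiff.contMDiffAt
  have h2 : ContMDiffAt 𝓘(ℚ_[p], ℚ_[p] × (Fin k → ℚ_[p])) 𝓘(ℚ_[p], Fin k → ℚ_[p]) ω
      (fun q : ℚ_[p] × (Fin k → ℚ_[p]) => φ.symm q.2) (t, u) :=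
    ContMDiffAt.comp (g := φ.symm) (f := Prod.snd) (t, u)
      (contMDiffAt_symm_of_mem_maximalAtlas hφ hu) contDiff_snd.contMDiff.contMDiffAt
  exact (hs.contMDiffAt (x := ((⟨clampInt t, (clampInt t).2⟩ : unitBall p), φ.symm u))).comp (t, u)
    (h1.prodMk h2)

theorem contDiffAt_chartSmul {t : ℚ_[p]} {u : Fin k → ℚ_[p]} (ht : ‖t‖ ≤ 1)
    (hu : u ∈ φ.target) (h : clampInt t • φ.symm u ∈ φ.source) :
    ContDiffAt ℚ_[p] ω (chartSmul φ) (t, u) := by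
  rw [← contMDiffAt_iff_contDiffAt]
  exact ContMDiffAt.comp (g := φ) (t, u) (contMDiffAt_of_mem_maximalAtlas hφ h)
    (contMDiffAt_clampInt_smul hφ hs ht hu)

end Smul

theorem eventually_mem_target (h0 : (0 : X) ∈ φ.source) : ∀ᶠ u in 𝓝 (φ 0), u ∈ φ.target :=
  φ.open_target.mem_nhds (φ.map_source h0)

theorem eventually_add_mem_source [ContinuousAdd X] (h0 : (0 : X) ∈ φ.source) :
    ∀ᶠ q : (Fin k → ℚ_[p]) × (Fin k → ℚ_[p]) in 𝓝 (φ 0, φ 0),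
      φ.symm q.1 + φ.symm q.2 ∈ φ.source := by
  have hsymm := φ.continuousAt_symm (φ.map_source h0)
  have hc : ContinuousAt (fun q : (Fin k → ℚ_[p]) × (Fin k → ℚ_[p]) => φ.symm q.1 + φ.symm q.2)
      (φ 0, φ 0) :=
    (ContinuousAt.comp (f := Prod.fst) (x := (φ 0, φ 0)) hsymm continuousAt_fst).add
      (ContinuousAt.comp (f := Prod.snd) (x := (φ 0, φ 0)) hsymm continuousAt_snd)
  refine hc.preimage_mem_nhds (φ.open_source.mem_nhds ?_)
  simpa [φ.left_inv h0] using h0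

section Add

variable [ContMDiffAdd 𝓘(ℚ_[p], Fin k → ℚ_[p]) ω X]
  (hφ : φ ∈ IsManifold.maximalAtlas 𝓘(ℚ_[p], Fin k → ℚ_[p]) ω X) (h0 : (0 : X) ∈ φ.source)

include hφ h0

theorem contDiffAt_chartAdd : ContDiffAt ℚ_[p] ω (chartAdd φ) (φ 0, φ 0) := by
  have ht := φ.map_source h0
  have h := contMDiffAt_symm_of_mem_maximalAtlas hφ ht
  rw [← contMDiffAt_iff_contDiffAt]
  refine ContMDiffAt.comp (g := φ) (φ 0, φ 0) (contMDiffAt_of_mem_maximalAtlas hφ ?_) ?_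
  · rw [φ.left_inv h0, add_zero]
    exact h0
  · exact (ContMDiffAt.comp (g := φ.symm) (f := Prod.fst) (φ 0, φ 0) h
      contDiff_fst.contMDiff.contMDiffAt).add (ContMDiffAt.comp (g := φ.symm) (f := Prod.snd)
      (φ 0, φ 0) h contDiff_snd.contMDiff.contMDiffAt)

theorem hasFDerivAt_chartAdd : HasFDerivAt (chartAdd φ)
    (ContinuousLinearMap.fst ℚ_[p] _ _ + ContinuousLinearMap.snd ℚ_[p] _ _) (φ 0, φ 0) := by
  have hD := ((contDiffAt_chartAdd hφ h0).differentiableAt (by simp)).hasFDerivAt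
  set D := fderiv ℚ_[p] (chartAdd φ) (φ 0, φ 0)
  have h1 : D ∘L ContinuousLinearMap.inl ℚ_[p] _ _ = ContinuousLinearMap.id ℚ_[p] _ := by
    refine (HasFDerivAt.comp (φ 0) (f := fun x => (x, φ 0)) hD
      (hasFDerivAt_prodMk_left _ _)).unique ((hasFDerivAt_id _).congr_of_eventuallyEq ?_)
    filter_upwards [eventually_mem_target h0] with x hx
    simp only [Function.comp_apply, chartAdd, φ.left_inv h0, add_zero, φ.right_inv hx, id]
  have h2 : D ∘L ContinuousLinearMap.inr ℚ_[p] _ _ = ContinuousLinearMap.id ℚ_[p] _ := by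
    refine (HasFDerivAt.comp (φ 0) (f := fun x => (φ 0, x)) hD
      (hasFDerivAt_prodMk_right _ _)).unique ((hasFDerivAt_id _).congr_of_eventuallyEq ?_)
    filter_upwards [eventually_mem_target h0] with x hx
    simp only [Function.comp_apply, chartAdd, φ.left_inv h0, zero_add, φ.right_inv hx, id]
  refine hD.congr_fderiv (ContinuousLinearMap.ext fun q => ?_)
  have h3 : D q = D (q.1, 0) + D (0, q.2) := by rw [← map_add, Prod.mk_add_mk, add_zero, zero_add]
  have h4 : D (q.1, 0) = q.1 := DFunLike.congr_fun h1 q.1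
  have h5 : D (0, q.2) = q.2 := DFunLike.congr_fun h2 q.2
  rw [h3, h4, h5]
  rfl

theorem hasFDerivAt_chart_nsmul (m : ℕ) : HasFDerivAt (fun u => φ (m • φ.symm u))
    ((m : ℚ_[p]) • ContinuousLinearMap.id ℚ_[p] (Fin k → ℚ_[p])) (φ 0) := by
  induction m with
  | zero => simpa using hasFDerivAt_const (𝕜 := ℚ_[p]) (φ 0) (φ 0)
  | succ m ih =>
    have hc : ContinuousAt (fun u => m • φ.symm u) (φ 0) := by
      have := continuousAdd_of_contMDiffAdd 𝓘(ℚ_[p], Fin k → ℚ_[p]) ω (G := X)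
      exact (φ.continuousAt_symm (φ.map_source h0)).const_smul m
    have h1 := hasFDerivAt_chartAdd hφ h0
    have h2 : HasFDerivAt (fun u => chartAdd φ (φ (m • φ.symm u), u)) _ (φ 0) :=
      HasFDerivAt.comp (φ 0) (g := chartAdd φ) (f := fun u => (φ (m • φ.symm u), u))
        (g' := ContinuousLinearMap.fst ℚ_[p] _ _ + ContinuousLinearMap.snd ℚ_[p] _ _)
        (by simpa only [φ.left_inv h0, smul_zero] using h1) (ih.prodMk (hasFDerivAt_id _))
    refine (h2.congr_of_eventuallyEq ?_).congr_fderiv ?_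
    · have h3 : ∀ᶠ u in 𝓝 (φ 0), m • φ.symm u ∈ φ.source :=
        hc.preimage_mem_nhds (φ.open_source.mem_nhds (by simpa [φ.left_inv h0] using h0))
      filter_upwards [h3] with u hu
      simp only [chartAdd, φ.left_inv hu, succ_nsmul]
    · ext v i
      simp [add_mul]

variable (hs : ContMDiff (𝓘(ℚ_[p], ℚ_[p]).prod 𝓘(ℚ_[p], Fin k → ℚ_[p])) 𝓘(ℚ_[p], Fin k → ℚ_[p]) ω
    (fun q : unitBall p × X => unitBall.toInt q.1 • q.2))

include hs

theorem contDiffAt_chartSmul_chart_zero {t : ℚ_[p]} (ht : ‖t‖ ≤ 1) :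
    ContDiffAt ℚ_[p] ω (chartSmul φ) (t, φ 0) :=
  contDiffAt_chartSmul hφ hs ht (φ.map_source h0) (by rwa [φ.left_inv h0, smul_zero])

/-- Multiplication by a natural number is iterated addition, so its derivative at the origin is known. -/
theorem fderiv_chartSmul_natCast (m : ℕ) (v : Fin k → ℚ_[p]) :
    fderiv ℚ_[p] (chartSmul φ) ((m : ℚ_[p]), φ 0) (0, v) = (m : ℚ_[p]) • v := by
  have hm : ‖(m : ℚ_[p])‖ ≤ 1 := (m : ℤ_[p]).2
  have hD := ((contDiffAt_chartSmul_chart_zero hφ h0 hs hm).differentiableAt (by simp)).hasFDerivAt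
  have h1 : (fun u => φ (m • φ.symm u)) = chartSmul φ ∘ fun u => ((m : ℚ_[p]), u) := by
    funext u
    have : clampInt (m : ℚ_[p]) = m := clampInt_coe (m : ℤ_[p])
    rw [Function.comp_apply, chartSmul, this, Nat.cast_smul_eq_nsmul]
  have h2 := hasFDerivAt_chart_nsmul hφ h0 m
  rw [h1] at h2
  have h3 := h2.unique (HasFDerivAt.comp (φ 0) (f := fun u => ((m : ℚ_[p]), u)) hD
    (hasFDerivAt_prodMk_right _ _))
  exact (DFunLike.congr_fun h3 v).symm

theorem hasDerivAt_chartSmul {u : Fin k → ℚ_[p]} (hu : u ∈ φ.target) :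
    HasDerivAt (fun t => chartSmul φ (t, u)) (chartLog φ u) 0 := by
  have hD := ((contDiffAt_chartSmul hφ hs (t := 0) (by simp) hu (by
    rwa [clampInt_zero, zero_smul])).differentiableAt (by simp)).hasFDerivAt
  have hi : HasDerivAt (fun t : ℚ_[p] => (t, u)) (1, 0) 0 :=
    (hasDerivAt_id _).prodMk (hasDerivAt_const _ _)
  exact hD.comp_hasDerivAt (0 : ℚ_[p]) hi

theorem analyticAt_chartLog : AnalyticAt ℚ_[p] (chartLog φ) (φ 0) := by
  have h1 := (contDiffAt_chartSmul_chart_zero hφ h0 hs (t := 0) (by simp)).analyticAt.fderiv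
  have h2 : AnalyticAt ℚ_[p] (fun u : Fin k → ℚ_[p] => ((0 : ℚ_[p]), u)) (φ 0) :=
    analyticAt_const.prod analyticAt_id
  exact ((ContinuousLinearMap.apply ℚ_[p] (Fin k → ℚ_[p])
    ((1, 0) : ℚ_[p] × (Fin k → ℚ_[p]))).analyticAt _).comp (h1.comp h2)

/-- The derivative of the logarithm is computed from the symmetry of second derivatives: the
derivative of multiplication by `p ^ n` at the origin is `p ^ n`. -/
theorem fderiv_chartLog : fderiv ℚ_[p] (chartLog φ) (φ 0) = ContinuousLinearMap.id ℚ_[p] _ := by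
  have hc := contDiffAt_chartSmul_chart_zero hφ h0 hs (t := 0) (by simp)
  have hF := hc.analyticAt.fderiv.differentiableAt.hasFDerivAt
  have hsymm := hc.isSymmSndFDerivAt_of_omega
  set D := fderiv ℚ_[p] (fderiv ℚ_[p] (chartSmul φ)) (0, φ 0)
  refine ContinuousLinearMap.ext fun v => ?_
  have h1 : fderiv ℚ_[p] (chartLog φ) (φ 0) v = D (0, v) (1, 0) := by
    have h2 : HasFDerivAt (fun u => fderiv ℚ_[p] (chartSmul φ) (0, u))
        (D ∘L ContinuousLinearMap.inr ℚ_[p] _ _) (φ 0) :=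
      HasFDerivAt.comp (φ 0) (f := fun u => ((0 : ℚ_[p]), u)) hF (hasFDerivAt_prodMk_right _ _)
    have h3 : HasFDerivAt (chartLog φ) _ (φ 0) := h2.clm_apply (hasFDerivAt_const (1, 0) _)
    rw [h3.fderiv]
    simp
  have h2 : HasDerivAt (fun t => fderiv ℚ_[p] (chartSmul φ) (t, φ 0) (0, v)) (D (1, 0) (0, v)) 0 := by
    have hi : HasDerivAt (fun t : ℚ_[p] => (t, φ 0)) (1, 0) 0 :=
      (hasDerivAt_id _).prodMk (hasDerivAt_const _ _)
    have h3 : HasDerivAt (fun t => fderiv ℚ_[p] (chartSmul φ) (t, φ 0)) (D (1, 0)) 0 :=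
      hF.comp_hasDerivAt (0 : ℚ_[p]) hi
    simpa using h3.clm_apply (hasDerivAt_const (0 : ℚ_[p]) ((0, v) : ℚ_[p] × (Fin k → ℚ_[p])))
  have hp : (p : ℚ_[p]) ≠ 0 := Nat.cast_ne_zero.2 (Fact.out : p.Prime).ne_zero
  have h3 : Tendsto (fun n : ℕ => (p : ℚ_[p]) ^ n) atTop (𝓝[≠] 0) := by
    refine tendsto_nhdsWithin_iff.2 ⟨tendsto_pow_atTop_nhds_zero_of_norm_lt_one ?_,
      Eventually.of_forall fun n => pow_ne_zero n hp⟩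
    exact Padic.norm_p_lt_one
  have h4 := h2.tendsto_slope.comp h3
  have h5 : ∀ n : ℕ, slope (fun t => fderiv ℚ_[p] (chartSmul φ) (t, φ 0) (0, v)) 0
      ((p : ℚ_[p]) ^ n) = v := by
    intro n
    have h6 := fderiv_chartSmul_natCast hφ h0 hs (p ^ n) v
    have h7 := fderiv_chartSmul_natCast hφ h0 hs 0 v
    rw [Nat.cast_pow] at h6
    rw [Nat.cast_zero, zero_smul] at h7
    rw [slope_def_module, h6, h7, sub_zero, sub_zero, smul_smul, inv_mul_cancel₀ (pow_ne_zero n hp),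
      one_smul]
  have h6 : D (1, 0) (0, v) = v := tendsto_nhds_unique h4 (by
    simpa only [Function.comp_def, h5] using tendsto_const_nhds)
  rw [h1, hsymm.eq, h6]
  rfl

/-- The logarithm is additive near the origin: differentiate `t • (x + y) = t • x + t • y` at `t = 0`. -/
theorem eventually_chartLog_add : ∀ᶠ q in 𝓝 (φ 0, φ 0),
    chartLog φ (chartAdd φ q) = chartLog φ q.1 + chartLog φ q.2 := by
  have hadd := continuousAdd_of_contMDiffAdd 𝓘(ℚ_[p], Fin k → ℚ_[p]) ω (G := X)
  have h1 := eventually_add_mem_source h0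
  have ht := φ.open_target.mem_nhds (φ.map_source h0)
  filter_upwards [h1, prod_mem_nhds ht ht] with q hq hqt
  have hA : chartAdd φ q ∈ φ.target := φ.map_source hq
  have hsmall : ∀ u ∈ φ.target, ∀ᶠ t : ℚ_[p] in 𝓝 0, clampInt t • φ.symm u ∈ φ.source := by
    intro u hu
    have hc := (contMDiffAt_clampInt_smul hφ hs (t := 0) (by simp) hu).continuousAt
    have hc' : ContinuousAt (fun t : ℚ_[p] => clampInt t • φ.symm u) 0 :=
      ContinuousAt.comp (f := fun t : ℚ_[p] => (t, u)) (x := (0 : ℚ_[p])) hc (by fun_prop)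
    refine hc'.preimage_mem_nhds (φ.open_source.mem_nhds ?_)
    rwa [clampInt_zero, zero_smul]
  have hR : HasDerivAt (fun t => chartAdd φ (chartSmul φ (t, q.1), chartSmul φ (t, q.2)))
      (chartLog φ q.1 + chartLog φ q.2) 0 := by
    refine HasFDerivAt.comp_hasDerivAt_of_eq (0 : ℚ_[p]) (hasFDerivAt_chartAdd hφ h0)
      ((hasDerivAt_chartSmul hφ h0 hs hqt.1).prodMk (hasDerivAt_chartSmul hφ h0 hs hqt.2)) ?_
    rw [chartSmul_zero, chartSmul_zero]
  refine (hasDerivAt_chartSmul hφ h0 hs hA).unique (hR.congr_of_eventuallyEq ?_)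
  filter_upwards [hsmall _ hqt.1, hsmall _ hqt.2] with t h2 h3
  simp only [chartSmul, chartAdd, φ.left_inv hq, φ.left_inv h2, φ.left_inv h3, smul_add]

end Add

end Log

/-! ### The exponential map -/

section Exp

variable {p : ℕ} [Fact p.Prime] {k : ℕ}

theorem intPoint_add (w w' : Fin k → ℤ_[p]) :
    intPoint p k (w + w') = intPoint p k w + intPoint p k w' :=
  funext fun i => PadicInt.coe_add (w i) (w' i)

variable {X : Type u} [TopologicalSpace X] [ChartedSpace (Fin k → ℚ_[p]) X]
  [AddCommGroup X] [Module ℤ_[p] X] [ContMDiffAdd 𝓘(ℚ_[p], Fin k → ℚ_[p]) ω X]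

/-- A `ℤ_p`-analytic module contains a copy of `ℤ_p^k` as an open neighbourhood of the origin: `η` is
the exponential map on a small lattice `p^n ℤ_p^k`, and `lam` is the logarithm divided by `p^n`. -/
theorem exists_exp {φ : OpenPartialHomeomorph X (Fin k → ℚ_[p])}
    (hφ : φ ∈ IsManifold.maximalAtlas 𝓘(ℚ_[p], Fin k → ℚ_[p]) ω X) (h0 : (0 : X) ∈ φ.source)
    (hs : ContMDiff (𝓘(ℚ_[p], ℚ_[p]).prod 𝓘(ℚ_[p], Fin k → ℚ_[p])) 𝓘(ℚ_[p], Fin k → ℚ_[p]) ω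
      (fun q : unitBall p × X => unitBall.toInt q.1 • q.2)) :
    ∃ (η : (Fin k → ℤ_[p]) → X) (lam : X → Fin k → ℚ_[p]), Continuous η ∧
      (∀ w w', η (w + w') = η w + η w') ∧ lam 0 = 0 ∧
      ContMDiffAt 𝓘(ℚ_[p], Fin k → ℚ_[p]) 𝓘(ℚ_[p], Fin k → ℚ_[p]) ω lam 0 ∧
      ∀ᶠ x in 𝓝 (0 : X), ∀ w, intPoint p k w = lam x → η w = x := by
  have hℓ := analyticAt_chartLog hφ h0 hs
  have hd : HasStrictFDerivAt (chartLog φ)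
      ((ContinuousLinearEquiv.refl ℚ_[p] (Fin k → ℚ_[p]) : _ ≃L[ℚ_[p]] _) : _ →L[ℚ_[p]] _)
      (φ 0) := by
    have := hℓ.hasStrictFDerivAt
    rwa [fderiv_chartLog hφ h0 hs] at this
  let Θ := hd.toOpenPartialHomeomorph (chartLog φ)
  have hΘ : ⇑Θ = chartLog φ := rfl
  have hΘ0 : φ 0 ∈ Θ.source := hd.mem_toOpenPartialHomeomorph_source
  have hℓ0 : chartLog φ (φ 0) = 0 := by
    refine (hasDerivAt_chartSmul hφ h0 hs (φ.map_source h0)).unique ?_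
    simp only [chartSmul_chart_zero h0]
    exact hasDerivAt_const _ _
  have hΘs0 : Θ.symm 0 = φ 0 := by
    rw [← hℓ0]
    exact Θ.left_inv hΘ0
  have h00 : chartAdd φ (φ 0, φ 0) = φ 0 := by
    rw [chartAdd, φ.left_inv h0, add_zero]
  have hprod : ∀ᶠ q in 𝓝 (φ 0) ×ˢ 𝓝 (φ 0),
      chartLog φ (chartAdd φ q) = chartLog φ q.1 + chartLog φ q.2 ∧ chartAdd φ q ∈ Θ.source ∧
        φ.symm q.1 + φ.symm q.2 ∈ φ.source := by
    rw [← nhds_prod_eq]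
    refine (eventually_chartLog_add hφ h0 hs).and (Eventually.and ?_ ?_)
    · refine (contDiffAt_chartAdd hφ h0).continuousAt.preimage_mem_nhds
        (Θ.open_source.mem_nhds ?_)
      rwa [h00]
    · have := continuousAdd_of_contMDiffAdd 𝓘(ℚ_[p], Fin k → ℚ_[p]) ω (G := X)
      exact eventually_add_mem_source h0
  obtain ⟨S, hS, hSP⟩ := eventually_prod_self_iff'.1 hprod
  have hV : Θ.target ∩ Θ.symm ⁻¹' (S ∩ φ.target) ∈ 𝓝 (0 : Fin k → ℚ_[p]) := by
    have h1 : (0 : Fin k → ℚ_[p]) ∈ Θ.target := by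
      rw [← hℓ0]
      exact Θ.map_source hΘ0
    refine inter_mem (Θ.open_target.mem_nhds h1)
      ((Θ.continuousAt_symm h1).preimage_mem_nhds ?_)
    rw [hΘs0]
    exact inter_mem hS (eventually_mem_target h0)
  obtain ⟨T, hTV, hT, hT0⟩ := mem_nhds_iff.1 hV
  obtain ⟨n, hn⟩ := exists_padicBall_subset hT hT0
  have hp : (p : ℚ_[p]) ^ n ≠ 0 := pow_ne_zero _ (Nat.cast_ne_zero.2 (Fact.out : p.Prime).ne_zero)
  let e : (Fin k → ℤ_[p]) → Fin k → ℚ_[p] := fun w => (p : ℚ_[p]) ^ n • intPoint p k w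
  have he : ∀ w, e w ∈ Θ.target ∩ Θ.symm ⁻¹' (S ∩ φ.target) := fun w => by
    refine hTV (hn ?_)
    rw [padicBall, mem_closedBall_zero_iff, norm_smul, norm_pow, Padic.norm_p, zpow_neg,
      zpow_natCast, inv_pow]
    exact mul_le_of_le_one_right (by positivity) (norm_intPoint_le w)
  have hec : Continuous e :=
    (continuous_const_smul ((p : ℚ_[p]) ^ n)).comp continuous_intPoint
  refine ⟨fun w => φ.symm (Θ.symm (e w)), fun x => ((p : ℚ_[p]) ^ n)⁻¹ • chartLog φ (φ x),
    ?_, fun w w' => ?_, ?_, ?_, ?_⟩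
  · exact φ.continuousOn_symm.comp_continuous
      (Θ.continuousOn_symm.comp_continuous hec fun w => (he w).1) fun w => (he w).2.2
  · obtain ⟨h1, h2, h3⟩ := hSP _ (he w).2.1 _ (he w').2.1
    have h4 : Θ.symm (e (w + w')) = chartAdd φ (Θ.symm (e w), Θ.symm (e w')) := by
      rw [← Θ.left_inv h2, hΘ, h1, ← hΘ, Θ.right_inv (he w).1, Θ.right_inv (he w').1]
      simp only [e, intPoint_add, smul_add]
    change φ.symm (Θ.symm (e (w + w'))) = _
    rw [h4, chartAdd, φ.left_inv h3]
  · change ((p : ℚ_[p]) ^ n)⁻¹ • chartLog φ (φ 0) = 0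
    rw [hℓ0, smul_zero]
  · have h1 : ContDiffAt ℚ_[p] ω (fun u => ((p : ℚ_[p]) ^ n)⁻¹ • chartLog φ u) (φ 0) :=
      hℓ.contDiffAt.const_smul _
    exact h1.contMDiffAt.comp (0 : X) (contMDiffAt_of_mem_maximalAtlas hφ h0)
  · filter_upwards [φ.open_source.mem_nhds h0,
      (φ.continuousAt h0).preimage_mem_nhds (Θ.open_source.mem_nhds hΘ0)] with x hx hx' w hw
    have h1 : e w = Θ (φ x) := by
      simp only [e]
      rw [hw, smul_smul, mul_inv_cancel₀ hp, one_smul, hΘ]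
    change φ.symm (Θ.symm (e w)) = x
    rw [h1, Θ.left_inv hx', φ.left_inv hx]

end Exp

/-! ### Continuous characters -/

section Character

variable {p : ℕ} [Fact p.Prime] {k : ℕ}
variable {A : Type v} [CommRing A] [UniformSpace A] [IsUniformAddGroup A] [CompleteSpace A]
  [T2Space A] [IsTateRing A] [Algebra ℤ_[p] A] [ContinuousSMul ℤ_[p] A] {α : Aˣ}

/-- For a character `g`, a difference operator is multiplication by `g z - 1`. -/
theorem diffBd_of_character {N : A → ℝ} (hN : IsGauge N) {M : Type*} [AddCommGroup M] {g : M → A}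
    (hadd : ∀ w w', g (w + w') = g w * g w') {C ρ : ℝ} (hρ : 0 ≤ ρ) (hC : ∀ w, N (g w) ≤ C)
    (hg : ∀ w, N (g w - 1) ≤ ρ) (n : ℕ) (a : A) :
    DiffBd N Set.univ n (fun w => a * g w) (N a * C * ρ ^ n) := by
  have hC0 : 0 ≤ C := (hN.nonneg _).trans (hC 0)
  induction n generalizing a with
  | zero =>
    intro w
    rw [pow_zero, mul_one]
    exact (hN.mul_le _ _).trans (mul_le_mul_of_nonneg_left (hC w) (hN.nonneg a))
  | succ n ih =>
    intro z _
    have : fwdDiff z (fun w => a * g w) = fun w => a * (g z - 1) * g w := by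
      funext w
      rw [fwdDiff, hadd]
      ring
    rw [this]
    refine (ih (a * (g z - 1))).mono ?_
    have h1 : N (a * (g z - 1)) ≤ N a * ρ :=
      (hN.mul_le _ _).trans (mul_le_mul_of_nonneg_left (hg z) (hN.nonneg a))
    calc N (a * (g z - 1)) * C * ρ ^ n ≤ N a * ρ * C * ρ ^ n := by gcongr
      _ = N a * C * ρ ^ (n + 1) := by ring

/-- On a small subgroup `p^n ℤ_p^k` the character is close to `1`, so its differences decay exponentially,
and on the cosets of this subgroup it is a multiple of its restriction to the subgroup. -/
theorem character_mem_zpFun (hα : IsTopologicallyNilpotent (α : A)) {ξ : (Fin k → ℤ_[p]) → A}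
    (hc : Continuous ξ) (h0 : ξ 0 = 1) (hadd : ∀ w w', ξ (w + w') = ξ w * ξ w') :
    ξ ∈ zpFun p k α := by
  obtain ⟨N, hN⟩ := exists_isGauge A
  have hnhds : {w | N (ξ w - 1) < 1 / 2} ∈ 𝓝 (0 : Fin k → ℤ_[p]) := by
    have h1 : ContinuousAt (fun w => ξ w - 1) 0 := (hc.sub continuous_const).continuousAt
    refine h1.preimage_mem_nhds (t := {a | N a < 1 / 2}) ?_
    rw [h0, sub_self]
    exact hN.mem_nhds _ (by norm_num)
  obtain ⟨n, hn⟩ := exists_pow_smul_mem hnhds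
  simp only [zero_add, Set.mem_ofPred_eq] at hn
  have hg : (fun w => ξ (p ^ n • w)) ∈ zpFun p k α := by
    refine (mem_zpFun_iff hN hα).2 ⟨hc.comp (continuous_const_smul _), N 1 * max (1 / 2) (N 1), 1 / 2,
      by norm_num, by norm_num, fun m => ?_⟩
    have := diffBd_of_character hN (g := fun w => ξ (p ^ n • w))
      (fun w w' => by rw [smul_add, hadd]) (C := max (1 / 2) (N 1)) (ρ := 1 / 2) (by norm_num)
      (fun w => ?_) (fun w => (hn w).le) m 1
    · simpa only [one_mul] using this
    · have h1 := hN.add_le (ξ (p ^ n • w) - 1) 1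
      rw [sub_add_cancel] at h1
      exact h1.trans (max_le_max_right _ (hn w).le)
  refine zpFun_of_local hα fun z => ⟨n, ?_⟩
  have h1 : (fun w => ξ (z + p ^ n • w)) = ξ z • fun w => ξ (p ^ n • w) :=
    funext fun w => hadd _ _
  rw [h1]
  exact Submodule.smul_mem _ _ hg

variable {X : Type u} [TopologicalSpace X] [ChartedSpace (Fin k → ℚ_[p]) X]
  [AddCommGroup X] [Module ℤ_[p] X] [ContMDiffAdd 𝓘(ℚ_[p], Fin k → ℚ_[p]) ω X]

/-- Near a point `x₀` one has `χ(x) = χ(x₀) (χ ∘ η)(lam(x - x₀))`. -/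
theorem character_mem_laFun (hα : IsTopologicallyNilpotent (α : A))
    (hs : ContMDiff (𝓘(ℚ_[p], ℚ_[p]).prod 𝓘(ℚ_[p], Fin k → ℚ_[p])) 𝓘(ℚ_[p], Fin k → ℚ_[p]) ω
      (fun q : unitBall p × X => unitBall.toInt q.1 • q.2))
    {χ : X → A} (hc : Continuous χ) (h0 : χ 0 = 1) (hadd : ∀ x y, χ (x + y) = χ x * χ y)
    (d : Decomposition p k X) : χ ∈ laFun α d := by
  obtain ⟨η, lam, hηc, hη, hlam0, hlam, hηlam⟩ := exists_exp
    (IsManifold.chart_mem_maximalAtlas (0 : X)) (mem_chart_source (Fin k → ℚ_[p]) (0 : X)) hs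
  have hη0 : η 0 = 0 := by simpa using hη 0 0
  have hξ : χ ∘ η ∈ zpFun p k α := character_mem_zpFun hα (hc.comp hηc) (by simp [hη0, h0])
    fun w w' => by simp only [Function.comp_apply, hη, hadd]
  have hcadd := continuousAdd_of_contMDiffAdd 𝓘(ℚ_[p], Fin k → ℚ_[p]) ω (G := X)
  refine mem_laFun.2 fun i => zpFun_of_local hα fun z => ?_
  let Γ : (Fin k → ℚ_[p]) → X := fun u => (d.chart i).symm u + -d.param i z
  have hΓz : Γ (intPoint p k z) = 0 := add_neg_cancel (d.param i z)
  have hΓ : ContMDiffAt 𝓘(ℚ_[p], Fin k → ℚ_[p]) 𝓘(ℚ_[p], Fin k → ℚ_[p]) ω (lam ∘ Γ)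
      (intPoint p k z) := by
    refine ContMDiffAt.comp _ (by rwa [hΓz]) ?_
    exact (d.contMDiffAt_chart_symm i z).add contMDiffAt_const
  obtain ⟨n, G, hG, hGn⟩ := exists_contracting_of_analyticAt hΓ.contDiffAt.analyticAt (by
    rw [Function.comp_apply, hΓz, hlam0, norm_zero]
    exact zero_le_one)
  have hnear : ∀ᶠ z' in 𝓝 z, ∀ w, intPoint p k w = lam (d.param i z' + -d.param i z) →
      η w = d.param i z' + -d.param i z := by
    have h1 : ContinuousAt (fun z' => d.param i z' + -d.param i z) z :=
      ((d.continuous_param i).add continuous_const).continuousAt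
    refine h1.eventually (p := fun x => ∀ w, intPoint p k w = lam x → η w = x) ?_
    change ∀ᶠ y in 𝓝 (d.param i z + -d.param i z), _
    rw [add_neg_cancel]
    exact hηlam
  obtain ⟨m, hm⟩ := exists_pow_smul_mem hnear
  refine ⟨n + m, ?_⟩
  have h1 : (fun w => (χ ∘ d.param i) (z + p ^ (n + m) • w)) =
      χ (d.param i z) • ((χ ∘ η) ∘ fun w => G (0 + p ^ m • w)) := by
    funext w
    have e1 : p ^ (n + m) • w = p ^ n • (p ^ m • w) := by rw [pow_add, mul_smul]
    have e2 : p ^ (n + m) • w = p ^ m • (p ^ n • w) := by rw [add_comm, pow_add, mul_smul]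
    have h2 : η (G (0 + p ^ m • w)) = d.param i (z + p ^ (n + m) • w) + -d.param i z := by
      rw [e2]
      refine hm _ _ ?_
      rw [← e2, zero_add, ← hGn]
      change lam (Γ _) = lam (Γ _)
      congr 2
      funext l
      simp [intPoint, e1]
    change χ (d.param i (z + p ^ (n + m) • w)) = χ (d.param i z) * χ (η (G (0 + p ^ m • w)))
    rw [h2, ← hadd]
    congr 1
    abel
  rw [h1]
  exact Submodule.smul_mem _ _ (zpFun_comp_contracting hα hξ (hG.comp_ball 0 m))

end Character

end LocAn

end

theorem theorem3 {p : ℕ} [Fact p.Prime]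
    -- a complete Tate `ℤ_p`-algebra and a topologically nilpotent unit
    {A : Type v} [CommRing A] [UniformSpace A] [IsUniformAddGroup A] [CompleteSpace A] [T2Space A]
    [LocAn.IsTateRing A] [Algebra ℤ_[p] A] [ContinuousSMul ℤ_[p] A]
    (α : Aˣ) (hα : IsTopologicallyNilpotent (α : A))
    -- a locally `ℚ_p`-analytic manifold
    {k : ℕ} (X : Type u) [TopologicalSpace X] [T2Space X] [ParacompactSpace X]
    [ChartedSpace (Fin k → ℚ_[p]) X] [IsManifold 𝓘(ℚ_[p], Fin k → ℚ_[p]) ω X] :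
    -- the modules are well defined: decompositions exist, and neither the decomposition nor the
    -- topologically nilpotent unit matters
    (Nonempty (LocAn.Decomposition p k X) ∧
      (∀ U : TopologicalSpace.Opens X, Nonempty (LocAn.Decomposition p k U)) ∧
      ∀ (d d' : LocAn.Decomposition p k X) (β : Aˣ), IsTopologicallyNilpotent (β : A) →
        LocAn.laFun α d = LocAn.laFun β d' ∧
        LocAn.laFunC α d = LocAn.laFunC β d' ∧
        (∃! e : LocAn.Dist α d ≃ₗ[A] LocAn.Dist β d',
          ∀ (φ : LocAn.Dist α d) (f : X → A) (hf : f ∈ LocAn.laFun α d)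
            (hf' : f ∈ LocAn.laFun β d'),
            LocAn.Dist.eval (e φ) ⟨f, hf'⟩ = LocAn.Dist.eval φ ⟨f, hf⟩) ∧
        (∃! e : LocAn.DistC α d ≃ₗ[A] LocAn.DistC β d',
          ∀ (φ : LocAn.DistC α d) (f : X → A) (hf : f ∈ LocAn.laFunC α d)
            (hf' : f ∈ LocAn.laFunC β d'),
            LocAn.DistC.eval (e φ) ⟨f, hf'⟩ = LocAn.DistC.eval φ ⟨f, hf⟩)) ∧
    -- (1) `𝒜(X, A)` is a ring under pointwise operations
    (∀ d : LocAn.Decomposition p k X,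
      ∃ S : Subalgebra A (X → A), Subalgebra.toSubmodule S = LocAn.laFun α d) ∧
    -- (2) pullback of functions and pushforward of distributions
    (∀ {j : ℕ} (Y : Type w) [TopologicalSpace Y] [T2Space Y] [ParacompactSpace Y]
      [ChartedSpace (Fin j → ℚ_[p]) Y] [IsManifold 𝓘(ℚ_[p], Fin j → ℚ_[p]) ω Y] (g : X → Y),
      ContMDiff 𝓘(ℚ_[p], Fin k → ℚ_[p]) 𝓘(ℚ_[p], Fin j → ℚ_[p]) ω g →
      ∀ (dX : LocAn.Decomposition p k X) (dY : LocAn.Decomposition p j Y),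
        ∃ pull : LocAn.laFun α dY →ₗ[A] LocAn.laFun α dX,
          (∀ (f : LocAn.laFun α dY) (x : X), (pull f).1 x = f.1 (g x)) ∧
          ∃! push : LocAn.Dist α dX →ₗ[A] LocAn.Dist α dY,
            ∀ (φ : LocAn.Dist α dX) (f : LocAn.laFun α dY),
              LocAn.Dist.eval (push φ) f = LocAn.Dist.eval φ (pull f)) ∧
    -- (3) `U ↦ 𝒜(U, A)`, with restriction of functions, and `U ↦ 𝒟_c(U, A)`, with the maps dual
    -- to extension by zero, are sheaves of `A`-modules on `X`
    (∀ d : ∀ U : TopologicalSpace.Opens X, LocAn.Decomposition p k U,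
      (∃ (F : TopCat.Presheaf (ModuleCat.{max u v} A) (TopCat.of X))
        (e : ∀ U : TopologicalSpace.Opens X,
          F.obj (Opposite.op U) ≃ₗ[A] LocAn.laFun α (d U)),
        (∀ (V U : TopologicalSpace.Opens X) (h : V ≤ U) (s : F.obj (Opposite.op U)) (x : V),
          (e V (F.map (CategoryTheory.homOfLE h).op s)).1 x = (e U s).1 (Set.inclusion h x)) ∧
        F.IsSheaf) ∧
      (∀ (V U : TopologicalSpace.Opens X) (h : V ≤ U), ∀ f ∈ LocAn.laFunC α (d V),
        LocAn.extendByZero h f ∈ LocAn.laFunC α (d U)) ∧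
      (∃ (F : TopCat.Presheaf (ModuleCat.{max u v} A) (TopCat.of X))
        (e : ∀ U : TopologicalSpace.Opens X,
          F.obj (Opposite.op U) ≃ₗ[A] LocAn.DistC α (d U)),
        (∀ (V U : TopologicalSpace.Opens X) (h : V ≤ U) (s : F.obj (Opposite.op U))
          (f : V → A) (hf : f ∈ LocAn.laFunC α (d V))
          (hf' : LocAn.extendByZero h f ∈ LocAn.laFunC α (d U)),
          LocAn.DistC.eval (e V (F.map (CategoryTheory.homOfLE h).op s)) ⟨f, hf⟩ =
            LocAn.DistC.eval (e U s) ⟨LocAn.extendByZero h f, hf'⟩) ∧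
        F.IsSheaf)) ∧
    -- (4) continuous characters of finitely generated `ℤ_p`-modules are locally analytic
    (∀ [AddCommGroup X] [Module ℤ_[p] X] [Module.Finite ℤ_[p] X]
      [ContMDiffAdd 𝓘(ℚ_[p], Fin k → ℚ_[p]) ω X],
      ContMDiff (𝓘(ℚ_[p], ℚ_[p]).prod 𝓘(ℚ_[p], Fin k → ℚ_[p])) 𝓘(ℚ_[p], Fin k → ℚ_[p]) ω
        (fun q : LocAn.unitBall p × X => LocAn.unitBall.toInt q.1 • q.2) →
      ∀ χ : Multiplicative X →* Aˣ, Continuous (fun x : X => χ (Multiplicative.ofAdd x)) →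
      ∀ d : LocAn.Decomposition p k X,
        (fun x : X => (χ (Multiplicative.ofAdd x) : A)) ∈ LocAn.laFun α d) := by
  refine ⟨⟨LocAn.nonempty_decomposition, fun U => ?_, fun d d' β hβ =>
    ⟨LocAn.laFun_congr hα hβ d d', LocAn.laFunC_congr hα hβ d d',
      LocAn.Dist.existsUnique_equiv hα hβ d d', LocAn.DistC.existsUnique_equiv hα hβ d d'⟩⟩,
    LocAn.exists_subalgebra hα, ?_, fun d => ⟨LocAn.exists_sheaf_laFun hα d,
      fun V U h f hf => LocAn.extendByZero_mem_laFunC hα h (d V) (d U) hf,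
      LocAn.exists_sheaf_distC hα d⟩, ?_⟩
  · obtain ⟨d, -⟩ := LocAn.exists_decomposition_opens (p := p) (k := k) U (O := {Set.univ})
      (by simp) (by simp)
    exact ⟨d⟩
  · intro j Y _ _ _ _ _ g hg dX dY
    exact ⟨LocAn.laFunPull hα hα dX dY hg, fun f x => rfl,
      LocAn.Dist.existsUnique_push hα hα dX dY hg⟩
  · intro _ _ _ _ hs χ hχ d
    exact LocAn.character_mem_laFun hα hs (χ := fun x => (χ (Multiplicative.ofAdd x) : A))
      (Units.continuous_val.comp hχ) (by simp) (fun x y => by simp) d
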